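/- **Setting.** Let $B\ge 4$, $G=I-\frac1B\mathbf 1\mathbf 1^T\in\mathbb R^{B\times B}$, $\mathsf n(z)=\sqrt B\,z/\|z\|$, and for $\phi:\mathbb R\to\mathbb R$ (applied coordinatewise) let $\mathcal B_\phi(h)=\phi(\mathsf n(Gh))$. A *BSB1 fixed point* is a positive semidefinite matrix $\Sigma^*$ with one common diagonal entry and one common off-diagonal entry, with $G\Sigma^*G\neq0$, and with $\Sigma^*=\mathbb E[\mathcal B_\phi(h)\mathcal B_\phi(h)^T:h\sim\mathcal N(0,\Sigma^*)]$. Put $$\mathcal F(\Sigma^*)\{\Lambda\}=\mathbb E\big[J_h\Lambda J_h^T\big],\quad J_h=\tfrac{\partial(\phi\circ\mathsf n)(z)}{\partial z}\Big|_{z=Gh},\qquad \mathcal T\{\Pi\}=\mathbb E\big[\mathcal B_\phi'(h)^T\,\Pi\,\mathcal B_\phi'(h)\big],\qquad h\sim\mathcal N(0,\Sigma^*),$$ where $\mathcal B_\phi'(h)$ is the Jacobian matrix of $\mathcal B_\phi$ at $h$; $\mathcal T$ is the backward operator. Let $G^{\otimes2}\{\Lambda\}=G\Lambda G$, $\mathbb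 H^G=\{\Lambda=\Lambda^T: G\Lambda G=\Lambda\}$, $\mathbb L=\{GDG: D \text{ diagonal},\ \operatorname{tr}D=0\}$ and $\mathbb M=\{\Lambda\in\mathbb H^G:\operatorname{Diag}\Lambda=0\}$. For $\alpha>-\frac12$ let $\mathsf c_\alpha=\pi^{-1/2}2^{\alpha-1}\Gamma(\alpha+\frac12)$ and, for $c=\cos\theta\in[-1,1)$, $$\mathrm J_\alpha(c)=\frac{\Gamma(\alpha+1)}{2\pi\mathsf c_\alpha}(\sin\theta)^{2\alpha+1}\int_0^{\pi/2}\frac{\cos^\alpha\eta\,d\eta}{(1-\cos\theta\cos\eta)^{1+\alpha}},\qquad \mathrm J_\alpha(1)=1 .$$ If $\psi$ is positive-homogeneous of degree $\alpha$ (i.e. $\psi(rx)=r^\alpha\psi(x)$ for $r>0$), put $a=\psi(1)$, $b=-\psi(-1)$ and $\mathrm J_\psi(c)=(a^2+b^2)\mathrm J_\alpha(c)-2ab\,\mathrm J_\alpha(-c)$. **Theorem.** (1) Let $\alpha>\frac12$ and let $\phi\ne0$ be positive-homogeneous of degree $\alpha$. There is exactly one BSB1 fixed point $\Sigma^*$,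 and the expectations defining $\mathcal F(\Sigma^*)$ and $\mathcal T$ are finite. The spaces $\mathbb RG,\mathbb L,\mathbb M$ are nonzero and give an orthogonal decomposition (for the trace inner product) of $\mathbb H^G$. Both $G^{\otimes2}\circ\mathcal F(\Sigma^*)$ and $\mathcal T$ map $\mathbb H^G$ to itself, and act on $\mathbb RG$, $\mathbb L$, $\mathbb M$ as multiplication by $\lambda_G,\lambda_{\mathbb L},\lambda_{\mathbb M}$ respectively. Here, with $c=\frac{-1}{B-1}$ and $\Delta=\mathrm J_\phi(1)-\mathrm J_\phi(c)\ne0$ ($\mathrm J_\phi$ being differentiable at $c$), $$\begin{aligned} \lambda_G&=\frac{(B-3+2\alpha)\big((2\alpha-1)\mathrm J_\phi'(c)+\alpha^2(B-1)\mathrm J_\phi(1)\big)}{(2\alpha-1)(B-3)(B-1)\Delta}-\frac{\alpha^2}{B-3}\\ &=\frac{\alpha^2(B-3+2\alpha)\big(\mathrm J_\phi(1)+\frac1{B-1}\mathrm J_{\alpha^{-1}\phi'}(c)\big)}{(2\alpha-1)(B-3)\Delta}-\frac{\alpha^2}{B-3}\\ &=\frac{\alpha^2\big((B-2)\mathrm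 J_\phi(1)+(B-3+2\alpha)\frac1{B-1}\mathrm J_{\alpha^{-1}\phi'}(c)+(2\alpha-1)\mathrm J_\phi(c)\big)}{(2\alpha-1)(B-3)\Delta},\\ \lambda_{\mathbb L}&=-\frac{2\alpha^2(B-2)(B-1+\alpha)}{(B-3)(B-1)(B-1+2\alpha)}+2\,\frac{\alpha^2(3B-4)+\alpha(3B^2-11B+8)+(B-3)(B-1)^2}{(B-3)(B-1)^2(B-1+2\alpha)}\cdot\frac{\mathrm J_\phi'(c)}{\Delta}\\ &\qquad+\frac{\alpha^2(B-2)(B-3+2\alpha)}{(2\alpha-1)(B-3)(B-1)}\cdot\frac{\mathrm J_\phi(1)}{\Delta},\\ \lambda_{\mathbb M}&=\frac{B\big(B^2+2(\alpha-2)B+2(\alpha-3)\alpha+3\big)}{(B-3)(B-1)(B-1+2\alpha)}\cdot\frac{\mathrm J_\phi'(c)}{\Delta}. \end{aligned}$$ Say that *gradients explode at rate $\beta$* if for every positive semidefinite $\Pi$ with $\mathcal T\{\Pi\}\neq0$ one has $\operatorname{tr}\big(\mathcal T^L\{\Pi\}\big)=\beta^{L+o(L)}$ as $L\to\infty$; this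 trace is the squared gradient norm after back-propagation through $L$ layers in the (mean-field, gradient-independent) backward dynamics $\Pi^{l}=\mathcal T\{\Pi^{l+1}\}$ at the fixed point. (2) For $\phi=\mathrm{relu}$, gradients explode at rate $$\frac1{B-3}\left(\frac{B-1+\mathrm J_1'\left(\frac{-1}{B-1}\right)}{1-\mathrm J_1\left(\frac{-1}{B-1}\right)}-1\right),\qquad \mathrm J_1(c)=\tfrac1\pi\big(\sqrt{1-c^2}+(\pi-\arccos c)\,c\big),$$ which is strictly decreasing in the integer $B\ge4$ and tends to $\frac{\pi}{\pi-1}$ as $B\to\infty$. (3) For linear $\phi(x)=mx$, $m\neq0$, gradients explode at rate $\frac{B-2}{B-3}$, which tends to $1$ as $B\to\infty$. -/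

import Mathlib

open MeasureTheory ProbabilityTheory Filter Topology Asymptotics

noncomputable section

namespace BatchNorm

/-! ### Positive-homogeneous functions and their J-functions -/

/-- `φ` is positive-homogeneous of degree `α`: `φ (r x) = r ^ α φ x` for all `r > 0`. -/
def IsPosHomogeneous (α : ℝ) (φ : ℝ → ℝ) : Prop :=
  ∀ r : ℝ, 0 < r → ∀ x : ℝ, φ (r * x) = r ^ α * φ x

/-- The rectified linear unit. -/
def relu (x : ℝ) : ℝ := max x 0

/-- The constant `c_α = π^(-1/2) 2^(α-1) Γ(α + 1/2)`. -/
def cConst (α : ℝ) : ℝ := 1 / √Real.pi * 2 ^ (α - 1) * Real.Gamma (α + 1 / 2)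

/-- The function `J_α(θ)`, for `α > -1/2`, as an integral over `[0, π/2]`. -/
def angularJ (α θ : ℝ) : ℝ :=
  1 / (2 * Real.pi * cConst α) * Real.sin θ ^ (2 * α + 1) * Real.Gamma (α + 1) *
    ∫ η in (0 : ℝ)..(Real.pi / 2), Real.cos η ^ α / (1 - Real.cos θ * Real.cos η) ^ (1 + α)

/-- `𝕁_α(c) = J_α(arccos c)` for `c ∈ [-1, 1]`. At `c = 1` the integral formula is of the form
`0 · ∞`; the value there is the continuous extension `𝕁_α(1) = 1`. -/
def kernelJ (α c : ℝ) : ℝ := if c = 1 then 1 else angularJ α (Real.arccos c)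

/-- `𝕁_φ(c) = (a² + b²) 𝕁_α(c) - 2ab 𝕁_α(-c)` for a function `φ` that is positive-homogeneous of
degree `α`, where `φ(x) = a x^α` for `x > 0` and `φ(x) = -b |x|^α` for `x < 0`,
that is, `a = φ(1)` and `b = -φ(-1)`. -/
def homJ (α : ℝ) (φ : ℝ → ℝ) (c : ℝ) : ℝ :=
  (φ 1 ^ 2 + (-φ (-1)) ^ 2) * kernelJ α c - 2 * φ 1 * (-φ (-1)) * kernelJ α (-c)

/-- The arc-cosine kernel `𝕁_1(c) = (√(1 - c²) + (π - arccos c) c) / π`. -/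
def arcCosKernel (c : ℝ) : ℝ :=
  1 / Real.pi * (√(1 - c ^ 2) + (Real.pi - Real.arccos c) * c)

/-! ### Batch normalization -/

/-- The projection matrix `G = I - (1/B) 𝟙𝟙ᵀ`. -/
def centering (B : ℕ) : Matrix (Fin B) (Fin B) ℝ :=
  1 - (1 / (B : ℝ)) • Matrix.of fun _ _ => 1

/-- `h ↦ G h`. -/
def center {B : ℕ} (h : EuclideanSpace ℝ (Fin B)) : EuclideanSpace ℝ (Fin B) :=
  Matrix.toEuclideanLin (centering B) h

/-- `𝗇(z) = √B z / ‖z‖`. -/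
def normalize {B : ℕ} (z : EuclideanSpace ℝ (Fin B)) : EuclideanSpace ℝ (Fin B) :=
  (√(B : ℝ) / ‖z‖) • z

/-- `φ` applied to each coordinate. -/
def applyCoord {B : ℕ} (φ : ℝ → ℝ) (z : EuclideanSpace ℝ (Fin B)) : EuclideanSpace ℝ (Fin B) :=
  WithLp.toLp 2 fun i => φ (z i)

/-- `φ ∘ 𝗇`. -/
def phiNormalize {B : ℕ} (φ : ℝ → ℝ) (z : EuclideanSpace ℝ (Fin B)) : EuclideanSpace ℝ (Fin B) :=
  applyCoord φ (normalize z)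

/-- Batch normalization followed by `φ`: `ℬ_φ(h) = φ(√B G h / ‖G h‖)`. -/
def batchNorm {B : ℕ} (φ : ℝ → ℝ) (h : EuclideanSpace ℝ (Fin B)) : EuclideanSpace ℝ (Fin B) :=
  phiNormalize φ (center h)

/-- The Jacobian matrix `(∂ f_i / ∂ x_j)` of `f` at `x`. -/
def jacobian {B : ℕ} (f : EuclideanSpace ℝ (Fin B) → EuclideanSpace ℝ (Fin B))
    (x : EuclideanSpace ℝ (Fin B)) : Matrix (Fin B) (Fin B) ℝ :=
  Matrix.of fun i j => (fderiv ℝ f x (EuclideanSpace.single j 1)) i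

/-! ### Gaussian second moments of functions and of matrix-valued functions -/

/-- The centred Gaussian law `N(0, S)` on `ℝ^B` (for positive semidefinite `S`). -/
def gaussianLaw {B : ℕ} (S : Matrix (Fin B) (Fin B) ℝ) : Measure (EuclideanSpace ℝ (Fin B)) :=
  multivariateGaussian 0 S

/-- `V_Φ(S) = E[Φ(h) Φ(h)ᵀ : h ∼ N(0, S)]`. -/
def secondMoment {B : ℕ} (Φ : EuclideanSpace ℝ (Fin B) → EuclideanSpace ℝ (Fin B))
    (S : Matrix (Fin B) (Fin B) ℝ) : Matrix (Fin B) (Fin B) ℝ :=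
  Matrix.of fun i j => ∫ h, Φ h i * Φ h j ∂(gaussianLaw S)

/-- All entries of the random tensor `T_h ⊗ T_h`, `h ∼ N(0, S)`, have finite expectation. -/
def HasSecondMoments {B : ℕ} (T : EuclideanSpace ℝ (Fin B) → Matrix (Fin B) (Fin B) ℝ)
    (S : Matrix (Fin B) (Fin B) ℝ) : Prop :=
  ∀ i j k l : Fin B, Integrable (fun h => T h i k * T h j l) (gaussianLaw S)

/-- `V_T(S) = E[T_h ⊗ T_h : h ∼ N(0, S)]`, the linear operator `Λ ↦ E[T_h Λ T_hᵀ]` on matrices. -/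
def secondMomentOp {B : ℕ} (T : EuclideanSpace ℝ (Fin B) → Matrix (Fin B) (Fin B) ℝ)
    (S : Matrix (Fin B) (Fin B) ℝ) : Module.End ℝ (Matrix (Fin B) (Fin B) ℝ) where
  toFun Λ := Matrix.of fun i j => ∑ k, ∑ l, (∫ h, T h i k * T h j l ∂(gaussianLaw S)) * Λ k l
  map_add' X Y := by
    ext i j
    simp [mul_add, Finset.sum_add_distrib]
  map_smul' c X := by
    ext i j
    simp [Finset.mul_sum, mul_left_comm]

/-- `G^{⊗2} : Λ ↦ G Λ G`. -/
def centerOp (B : ℕ) : Module.End ℝ (Matrix (Fin B) (Fin B) ℝ) where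
  toFun Λ := centering B * Λ * centering B
  map_add' X Y := by simp [mul_add, add_mul]
  map_smul' c X := by simp

/-- `𝓕(S) = E[(J(Gh))^{⊗2} : h ∼ N(0, S)]`, where `J(z)` is the Jacobian of `φ ∘ 𝗇` at `z`. -/
def backwardF {B : ℕ} (φ : ℝ → ℝ) (S : Matrix (Fin B) (Fin B) ℝ) :
    Module.End ℝ (Matrix (Fin B) (Fin B) ℝ) :=
  secondMomentOp (fun h => jacobian (phiNormalize φ) (center h)) S

/-- The backward operator `V_{ℬ_φ'}(S)† : Π ↦ E[ℬ_φ'(h)ᵀ Π ℬ_φ'(h) : h ∼ N(0, S)]`. -/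
def backwardOp {B : ℕ} (φ : ℝ → ℝ) (S : Matrix (Fin B) (Fin B) ℝ) :
    Module.End ℝ (Matrix (Fin B) (Fin B) ℝ) :=
  secondMomentOp (fun h => (jacobian (batchNorm φ) h).transpose) S

/-! ### BSB1 fixed points of the forward dynamics `S ↦ V_{ℬ_φ}(S)` -/

/-- One common entry on the diagonal and one common entry off the diagonal. -/
def IsBSB1 {B : ℕ} (S : Matrix (Fin B) (Fin B) ℝ) : Prop :=
  ∃ a b : ℝ, S = Matrix.of fun i j => if i = j then a else b

/-- A BSB1 fixed point of `S ↦ V_{ℬ_φ}(S)` in the positive semidefinite matrices. The condition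
`G S G ≠ 0` says that a Gaussian batch with covariance `S` is not almost surely constant, so that
batch normalization, which divides by `‖G h‖`, makes sense on it. -/
def IsBSB1FixedPoint {B : ℕ} (φ : ℝ → ℝ) (S : Matrix (Fin B) (Fin B) ℝ) : Prop :=
  S.PosSemidef ∧ IsBSB1 S ∧ centerOp B S ≠ 0 ∧ secondMoment (batchNorm φ) S = S

/-! ### The invariant subspaces -/

/-- The symmetric matrices `Λ` with `G Λ G = Λ`. -/
def spaceH (B : ℕ) : Submodule ℝ (Matrix (Fin B) (Fin B) ℝ) where
  carrier := {Λ | Λ.IsSymm ∧ centerOp B Λ = Λ}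
  add_mem' := by
    rintro X Y ⟨hX, hX'⟩ ⟨hY, hY'⟩
    exact ⟨hX.add hY, by rw [map_add, hX', hY']⟩
  zero_mem' := ⟨Matrix.isSymm_zero, map_zero _⟩
  smul_mem' := by
    rintro c X ⟨hX, hX'⟩
    exact ⟨hX.smul c, by rw [map_smul, hX']⟩

/-- The line `ℝ G`. -/
def spaceG (B : ℕ) : Submodule ℝ (Matrix (Fin B) (Fin B) ℝ) :=
  Submodule.span ℝ {centering B}

/-- `𝕃 = {G D G : D diagonal, tr D = 0}`. -/
def spaceL (B : ℕ) : Submodule ℝ (Matrix (Fin B) (Fin B) ℝ) where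
  carrier := {Λ | ∃ d : Fin B → ℝ, ∑ i, d i = 0 ∧ Λ = centerOp B (Matrix.diagonal d)}
  add_mem' := by
    rintro X Y ⟨d, hd, rfl⟩ ⟨e, he, rfl⟩
    refine ⟨d + e, by simp [Finset.sum_add_distrib, hd, he], ?_⟩
    rw [← map_add, Matrix.diagonal_add]
    rfl
  zero_mem' := ⟨0, by simp, by simp⟩
  smul_mem' := by
    rintro c X ⟨d, hd, rfl⟩
    exact ⟨c • d, by simp [← Finset.mul_sum, hd], by rw [← map_smul, Matrix.diagonal_smul]⟩

/-- `𝕄 = {Λ ∈ ℍ^G : Diag Λ = 0}`. -/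
def spaceM (B : ℕ) : Submodule ℝ (Matrix (Fin B) (Fin B) ℝ) where
  carrier := {Λ | Λ ∈ spaceH B ∧ Λ.diag = 0}
  add_mem' := by
    rintro X Y ⟨hX, hX'⟩ ⟨hY, hY'⟩
    exact ⟨add_mem hX hY, by rw [Matrix.diag_add, hX', hY', add_zero]⟩
  zero_mem' := ⟨zero_mem _, Matrix.diag_zero⟩
  smul_mem' := by
    rintro c X ⟨hX, hX'⟩
    exact ⟨Submodule.smul_mem _ c hX, by rw [Matrix.diag_smul, hX', smul_zero]⟩

/-- The two spaces are orthogonal for the trace inner product. -/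
def TraceOrthogonal {B : ℕ} (U W : Submodule ℝ (Matrix (Fin B) (Fin B) ℝ)) : Prop :=
  ∀ X ∈ U, ∀ Y ∈ W, (X.transpose * Y).trace = 0

/-- `T` maps `ℍ^G` to itself and acts on `ℝ G`, `𝕃`, `𝕄` as multiplication by `lG`, `lL`, `lM`. -/
def HasEigenvaluesGLM {B : ℕ} (T : Module.End ℝ (Matrix (Fin B) (Fin B) ℝ)) (lG lL lM : ℝ) :
    Prop :=
  (∀ Λ ∈ spaceH B, T Λ ∈ spaceH B) ∧
    spaceG B ≤ Module.End.eigenspace T lG ∧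
    spaceL B ≤ Module.End.eigenspace T lL ∧
    spaceM B ≤ Module.End.eigenspace T lM

/-! ### The closed forms; `j₁`, `jc`, `dj` stand for `𝕁_φ(1)`, `𝕁_φ(-1/(B-1))`, `𝕁_φ'(-1/(B-1))` -/

/-- The eigenvalue on `ℝ G`. -/
def eigenvalueG (α B j₁ jc dj : ℝ) : ℝ :=
  (B - 3 + 2 * α) * ((2 * α - 1) * dj + α ^ 2 * (B - 1) * j₁) /
      ((2 * α - 1) * (B - 3) * (B - 1) * (j₁ - jc)) -
    α ^ 2 / (B - 3)

/-- The second form of the eigenvalue on `ℝ G`; `jd` stands for `𝕁_{φ'/α}(-1/(B-1))`. -/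
def eigenvalueG' (α B j₁ jc jd : ℝ) : ℝ :=
  α ^ 2 * (B - 3 + 2 * α) * (j₁ + 1 / (B - 1) * jd) / ((2 * α - 1) * (B - 3) * (j₁ - jc)) -
    α ^ 2 / (B - 3)

/-- The third form of the eigenvalue on `ℝ G`; `jd` stands for `𝕁_{φ'/α}(-1/(B-1))`. -/
def eigenvalueG'' (α B j₁ jc jd : ℝ) : ℝ :=
  α ^ 2 * ((B - 2) * j₁ + (B - 3 + 2 * α) * (1 / (B - 1)) * jd + (2 * α - 1) * jc) /
    ((2 * α - 1) * (B - 3) * (j₁ - jc))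

/-- The eigenvalue on `𝕃`. -/
def eigenvalueL (α B j₁ jc dj : ℝ) : ℝ :=
  -(2 * α ^ 2 * (B - 2) * (B - 1 + α) / ((B - 3) * (B - 1) * (B - 1 + 2 * α))) +
    2 * ((α ^ 2 * (3 * B - 4) + α * (3 * B ^ 2 - 11 * B + 8) + (B - 3) * (B - 1) ^ 2) /
        ((B - 3) * (B - 1) ^ 2 * (B - 1 + 2 * α))) * (dj / (j₁ - jc)) +
    α ^ 2 * (B - 2) * (B - 3 + 2 * α) / ((2 * α - 1) * (B - 3) * (B - 1)) * (j₁ / (j₁ - jc))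

/-- The eigenvalue on `𝕄`. -/
def eigenvalueM (α B j₁ jc dj : ℝ) : ℝ :=
  B * (B ^ 2 + 2 * (α - 2) * B + 2 * (α - 3) * α + 3) /
    ((B - 3) * (B - 1) * (B - 1 + 2 * α)) * (dj / (j₁ - jc))

/-! ### Gradient explosion -/

/-- In the backward dynamics `Π^l = V_{ℬ_φ'}(S)† {Π^{l+1}}` at the fixed point `S`, the squared
gradient norm `tr Π^0` (summed over the batch) of a depth-`L` network grows as `β^(L + o(L))`,
for every gradient covariance `P` at the last layer whose gradient does not vanish identically
after one step of back-propagation. -/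
def GradientExplodesAtRate {B : ℕ} (φ : ℝ → ℝ) (S : Matrix (Fin B) (Fin B) ℝ) (β : ℝ) : Prop :=
  ∀ P : Matrix (Fin B) (Fin B) ℝ, P.PosSemidef → backwardOp φ S P ≠ 0 →
    ∃ e : ℕ → ℝ, e =o[atTop] (fun L : ℕ => (L : ℝ)) ∧
      ∀ L : ℕ, ((backwardOp φ S ^ L) P).trace = β ^ ((L : ℝ) + e L)

/-- The explosion rate of the ReLU network with batch size `B`. -/
def reluRate (B : ℝ) : ℝ :=
  1 / (B - 3) *
    ((B - 1 + deriv arcCosKernel (-1 / (B - 1))) / (1 - arcCosKernel (-1 / (B - 1))) - 1)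

/-- The explosion rate of the linear network with batch size `B`. -/
def linearRate (B : ℝ) : ℝ := (B - 2) / (B - 3)

end BatchNorm

end

open BatchNorm

/-! Batch normalization forgets scale. If h has a BSB1 covariance with diagonal a and off-diagonal
b, then Gh is distributed as √(a-b) times the standard Gaussian of the (B-1)-dimensional hyperplane
of sum-zero vectors (`map_center_gaussianLaw`). Every expectation is therefore the integral of a
homogeneous function under one rotation-invariant law, and in polar coordinates a power of the norm
only changes a Gamma factor (`IsHomogeneousOn.integral_norm_rpow_mul`). Consequently the forward map
sends all admissible BSB1 covariances to one and the same matrix, which is the only fixed point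
(`IsPosHomogeneous.isBSB1FixedPoint_iff`), and the second moments of the Jacobian reduce to the
moments E[φ'φ'], E[φφ'g], E[φφgg] of the hyperplane Gaussian
(`IsPosHomogeneous.jacobianEntry_mul_centeredLaw`).

These moments are rational in B and α and linear in 𝕁_φ(1), 𝕁_φ(c), 𝕁_φ'(c), where c = -1/(B-1) is
the correlation of two coordinates. A planar computation identifies E[φφ] with 𝕁_φ
(`integral_posPow_mul_posPow`), and a three-term recurrence for the angular integral
(`kernelIntegral_recurrence`) expresses the J-functions of φ' and of xφ(x) by 𝕁_φ and 𝕁_φ'.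
Integration by parts is replaced by a radial argument: for unit Gaussians u, v of correlation c, the
form u² - 2cuv + v² is (1-c²) times the squared radius in the plane, so it multiplies the
expectation of a degree-k function by (1-c²)(k+2) (`integral_quadratic_mul`). Applied to φ'φ' and φφ
this gives the mixed moments whose extra indices are k and l; the others follow from exchangeability
and from Σ g_j = 0.

By exchangeability, on symmetric Λ with zero row sums an off-diagonal entry (k,l) of 𝓕Λ is a
combination of Λ_kl, Λ_kk + Λ_ll and tr Λ, and a diagonal entry one of Λ_kk and tr Λ. After
projection by G such an operator is scalar on ℝG, 𝕃 and 𝕄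
(`IsPosHomogeneous.hasEigenvaluesGLM_backwardF`). On ℍ^G the backward operator is its adjoint for
the trace form, and the decomposition is orthogonal, so the eigenvalues are the same.

The trace vanishes on 𝕃 and 𝕄. One backward step brings Π into ℍ^G, and every later step multiplies
the trace by λ_G: the explosion rate is λ_G. For ReLU its monotonicity is read off in the variable t
= 1/(B-1) (`reluProfile_strictMonoOn`). -/

namespace BatchNorm

/-! ### The integrals behind the J-functions -/

/-- `∫₀^{π/2} cos^β η / (1 - c cos η)^(1 + β) dη`. -/
noncomputable def kernelIntegral (β c : ℝ) : ℝ :=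
  ∫ η in (0 : ℝ)..(Real.pi / 2), Real.cos η ^ β / (1 - c * Real.cos η) ^ (1 + β)

lemma one_sub_mul_cos_pos {c : ℝ} (hc : c < 1) {η : ℝ} (h0 : 0 ≤ Real.cos η) :
    0 < 1 - c * Real.cos η := by
  have := Real.cos_le_one η
  rcases le_or_gt c 0 with h | h <;> nlinarith

lemma cos_nonneg_of_mem_Icc {η : ℝ} (hη : η ∈ Set.Icc 0 (Real.pi / 2)) : 0 ≤ Real.cos η :=
  Real.cos_nonneg_of_mem_Icc ⟨by linarith [hη.1, Real.pi_pos], hη.2⟩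

lemma cos_pos_of_mem_Ioo' {η : ℝ} (hη : η ∈ Set.Ioo 0 (Real.pi / 2)) : 0 < Real.cos η :=
  Real.cos_pos_of_mem_Ioo ⟨by linarith [hη.1, Real.pi_pos], hη.2⟩

lemma intervalIntegrable_cos_rpow {β : ℝ} (hβ : -1 < β) :
    IntervalIntegrable (fun η => Real.cos η ^ β) volume 0 (Real.pi / 2) := by
  have hpi := Real.pi_pos
  rcases le_or_gt 0 β with h | h
  · exact (ContinuousOn.rpow_const Real.continuous_cos.continuousOn
      (fun x _ => Or.inr h)).intervalIntegrable
  · have h1 : IntervalIntegrable (fun x : ℝ => (2 / Real.pi) ^ β * (Real.pi / 2 - x) ^ β) volume 0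
        (Real.pi / 2) := by
      refine IntervalIntegrable.const_mul ?_ _
      have := (intervalIntegral.intervalIntegrable_rpow' (a := Real.pi / 2) (b := 0) hβ).comp_sub_left
        (Real.pi / 2)
      simpa using this
    refine h1.mono_fun' (Measurable.aestronglyMeasurable (by fun_prop)) ?_
    rw [Set.uIoc_of_le (by positivity)]
    rw [EventuallyLE, ae_restrict_iff' measurableSet_Ioc]
    have hne : ∀ᵐ x : ℝ, x ≠ Real.pi / 2 := by simp [ae_iff]
    filter_upwards [hne] with x hx hx'
    have hlt : x < Real.pi / 2 := lt_of_le_of_ne hx'.2 hx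
    -- Jordan's inequality sin y ≥ 2y/π at y = π/2 - x: for β < 0 it dominates cos^β by a power that
    -- is integrable at π/2 since β > -1.
    have hcos : 2 / Real.pi * (Real.pi / 2 - x) ≤ Real.cos x := by
      rw [← Real.sin_pi_div_two_sub]
      exact Real.mul_le_sin (by linarith) (by linarith [hx'.1])
    have hp : 0 < 2 / Real.pi * (Real.pi / 2 - x) := mul_pos (by positivity) (by linarith)
    rw [Real.norm_of_nonneg (Real.rpow_nonneg (hp.le.trans hcos) _),
      ← Real.mul_rpow (by positivity) (by linarith)]
    exact Real.rpow_le_rpow_of_nonpos hp hcos h.le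

lemma intervalIntegrable_kernelIntegrand {β γ c : ℝ} (hβ : -1 < β) (hc : c < 1) :
    IntervalIntegrable (fun η => Real.cos η ^ β / (1 - c * Real.cos η) ^ γ) volume 0
      (Real.pi / 2) := by
  simp_rw [div_eq_mul_inv]
  refine (intervalIntegrable_cos_rpow hβ).mul_continuousOn ?_
  rw [Set.uIcc_of_le (by positivity)]
  refine ContinuousOn.inv₀ (ContinuousOn.rpow_const (by fun_prop) fun x hx => Or.inl
    (one_sub_mul_cos_pos hc (cos_nonneg_of_mem_Icc hx)).ne') fun x hx => ?_
  exact (Real.rpow_pos_of_pos (one_sub_mul_cos_pos hc (cos_nonneg_of_mem_Icc hx)) _).ne'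

/-- Integrate the derivative of sin η cos^α η / (1 - c cos η)^(1+α) over [0, π/2]. The boundary
terms vanish: sin 0 = 0 at one end, and cos(π/2) = 0 with α > 0 at the other. -/
lemma kernelIntegral_recurrence {α c : ℝ} (hα : 0 < α) (hc : c < 1) :
    (1 - c ^ 2) * (1 + α) * kernelIntegral (α + 1) c =
      α * kernelIntegral (α - 1) c + (2 * α + 1) * c * kernelIntegral α c := by
  have hpi := Real.pi_pos
  have i1 := intervalIntegrable_kernelIntegrand (β := α + 1) (γ := 1 + (α + 1)) (by linarith) hc
  have i2 := intervalIntegrable_kernelIntegrand (β := α - 1) (γ := 1 + (α - 1)) (by linarith) hc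
  have i3 := intervalIntegrable_kernelIntegrand (β := α) (γ := 1 + α) (by linarith) hc
  have key := intervalIntegral.integral_eq_sub_of_hasDerivAt_of_le (a := 0) (b := Real.pi / 2)
    (f := fun η => Real.sin η * (Real.cos η ^ α / (1 - c * Real.cos η) ^ (1 + α)))
    (f' := fun η => (1 - c ^ 2) * (1 + α) *
        (Real.cos η ^ (α + 1) / (1 - c * Real.cos η) ^ (1 + (α + 1))) -
        α * (Real.cos η ^ (α - 1) / (1 - c * Real.cos η) ^ (1 + (α - 1))) -
        (2 * α + 1) * c * (Real.cos η ^ α / (1 - c * Real.cos η) ^ (1 + α)))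
    (by positivity) ?_ ?_ (((i1.const_mul _).sub (i2.const_mul _)).sub (i3.const_mul _))
  · rw [intervalIntegral.integral_sub ((i1.const_mul _).sub (i2.const_mul _)) (i3.const_mul _),
      intervalIntegral.integral_sub (i1.const_mul _) (i2.const_mul _),
      intervalIntegral.integral_const_mul, intervalIntegral.integral_const_mul,
      intervalIntegral.integral_const_mul] at key
    simp only [Real.cos_pi_div_two, Real.sin_zero, Real.zero_rpow hα.ne', zero_div, mul_zero,
      zero_mul, sub_zero] at key
    unfold kernelIntegral
    linarith
  · refine Real.continuous_sin.continuousOn.mul (ContinuousOn.div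
      (Real.continuous_cos.continuousOn.rpow_const fun _ _ => Or.inr hα.le)
      (ContinuousOn.rpow_const (by fun_prop) fun x hx => Or.inl
      (one_sub_mul_cos_pos hc (cos_nonneg_of_mem_Icc hx)).ne') fun x hx => ?_)
    exact (Real.rpow_pos_of_pos (one_sub_mul_cos_pos hc (cos_nonneg_of_mem_Icc hx)) _).ne'
  · intro x hx
    have hq := cos_pos_of_mem_Ioo' hx
    have hX := one_sub_mul_cos_pos hc hq.le
    have d1 := (Real.hasDerivAt_cos x).rpow_const (p := α) (Or.inl hq.ne')
    have d2 := (((Real.hasDerivAt_cos x).const_mul c).const_sub 1).rpow_const (p := 1 + α)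
      (Or.inl hX.ne')
    have d := (Real.hasDerivAt_sin x).mul (d1.div d2 (Real.rpow_pos_of_pos hX _).ne')
    refine d.congr_deriv ?_
    have e1 : Real.cos x ^ α = Real.cos x ^ (α - 1) * Real.cos x := by
      rw [← Real.rpow_add_one hq.ne']; ring_nf
    have e2 : Real.cos x ^ (α + 1) = Real.cos x ^ (α - 1) * Real.cos x ^ 2 := by
      rw [Real.rpow_add_one hq.ne', e1]; ring
    have f1 : (1 - c * Real.cos x) ^ (1 + α) = (1 - c * Real.cos x) ^ α * (1 - c * Real.cos x) := by
      rw [add_comm, Real.rpow_add_one hX.ne']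
    have f2 : (1 - c * Real.cos x) ^ (1 + (α + 1)) =
        (1 - c * Real.cos x) ^ α * (1 - c * Real.cos x) ^ 2 := by
      rw [show 1 + (α + 1) = 1 + α + 1 by ring, Real.rpow_add_one hX.ne', f1]; ring
    simp only [Pi.div_apply]
    rw [show 1 + (α - 1) = α by ring, show 1 + α - 1 = α by ring, e2, f2, e1, f1]
    have hs : Real.sin x ^ 2 = 1 - Real.cos x ^ 2 := by rw [Real.sin_sq]
    have p1 := (Real.rpow_pos_of_pos hX α).ne'
    generalize hXe : 1 - c * Real.cos x = X at *
    have hX' := hX.ne'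
    field_simp
    rw [← hXe]
    linear_combination (-(Real.cos x * c) * (1 + α) - α * (1 - Real.cos x * c)) * hs

lemma hasDerivAt_kernelIntegral {α c : ℝ} (hα : 0 < α) (hc : c < 1) :
    HasDerivAt (kernelIntegral α) ((1 + α) * kernelIntegral (α + 1) c) c := by
  have hpi := Real.pi_pos
  -- A lower bound for 1 - x cos η on the ball of radius (1-c)/2 around c: it is at least 1 if x ≤ 0
  -- and at least 1 - x > (1-c)/2 if x > 0.
  set δ := min ((1 - c) / 2) 1 with hδ
  have hδ0 : 0 < δ := lt_min (by linarith) one_pos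
  have hlow : ∀ x ∈ Metric.ball c ((1 - c) / 2), ∀ η ∈ Set.Icc 0 (Real.pi / 2),
      δ ≤ 1 - x * Real.cos η := by
    intro x hx η hη
    rw [Real.ball_eq_Ioo] at hx
    have h0 := cos_nonneg_of_mem_Icc hη
    have h1 := Real.cos_le_one η
    rcases le_or_gt x 0 with h | h
    · exact (min_le_right _ _).trans (by nlinarith)
    · exact (min_le_left _ _).trans (by nlinarith [hx.2])
  have h := intervalIntegral.hasDerivAt_integral_of_dominated_loc_of_deriv_le (μ := volume)
    (a := 0) (b := Real.pi / 2) (x₀ := c) (s := Metric.ball c ((1 - c) / 2))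
    (F := fun x η => Real.cos η ^ α / (1 - x * Real.cos η) ^ (1 + α))
    (F' := fun x η => (1 + α) * (Real.cos η ^ (α + 1) / (1 - x * Real.cos η) ^ (1 + (α + 1))))
    (bound := fun _ => (1 + α) * (1 / δ ^ (1 + (α + 1))))
    (Metric.ball_mem_nhds _ (by linarith)) ?_ (intervalIntegrable_kernelIntegrand (by linarith) hc)
    ?_ ?_ intervalIntegrable_const ?_
  · have h2 := h.2
    rw [intervalIntegral.integral_const_mul] at h2
    exact h2
  · exact .of_forall fun x => Measurable.aestronglyMeasurable (by fun_prop)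
  · exact Measurable.aestronglyMeasurable (by fun_prop)
  · refine .of_forall fun η hη x hx => ?_
    rw [Set.uIoc_of_le (by positivity)] at hη
    have h0 := cos_nonneg_of_mem_Icc (Set.Ioc_subset_Icc_self hη)
    have hl := hlow x hx η (Set.Ioc_subset_Icc_self hη)
    rw [norm_mul, Real.norm_of_nonneg (by linarith : 0 ≤ 1 + α), Real.norm_of_nonneg
      (div_nonneg (Real.rpow_nonneg h0 _) (Real.rpow_nonneg (hδ0.le.trans hl) _))]
    gcongr
    exact Real.rpow_le_one h0 (Real.cos_le_one _) (by linarith)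
  · refine .of_forall fun η hη x hx => ?_
    rw [Set.uIoc_of_le (by positivity)] at hη
    have h0 := cos_nonneg_of_mem_Icc (Set.Ioc_subset_Icc_self hη)
    have hX := hδ0.trans_le (hlow x hx η (Set.Ioc_subset_Icc_self hη))
    have d := (((hasDerivAt_id x).mul_const (Real.cos η)).const_sub 1).rpow_const (p := -(1 + α))
      (Or.inl hX.ne')
    have d' := d.const_mul (Real.cos η ^ α)
    refine (d'.congr_of_eventuallyEq ?_).congr_deriv ?_
    · filter_upwards [Metric.isOpen_ball.mem_nhds hx] with y hy
      have hY := hδ0.trans_le (hlow y hy η (Set.Ioc_subset_Icc_self hη))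
      simp only [id]
      rw [Real.rpow_neg hY.le, div_eq_mul_inv]
    · simp only [id]
      rw [Real.rpow_add_one' h0 (by linarith), show -(1 + α) - 1 = -(1 + (α + 1)) by ring,
        Real.rpow_neg hX.le]
      ring

/-! ### The J-functions -/

lemma cConst_pos {α : ℝ} (hα : -(1 / 2) < α) : 0 < cConst α := by
  unfold cConst
  have := Real.pi_pos
  have := Real.Gamma_pos_of_pos (show 0 < α + 1 / 2 by linarith)
  positivity

lemma cConst_add_one {α : ℝ} (hα : -(1 / 2) < α) : cConst (α + 1) = (2 * α + 1) * cConst α := by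
  unfold cConst
  rw [show α + 1 + 1 / 2 = α + 1 / 2 + 1 by ring, Real.Gamma_add_one (by linarith),
    show α + 1 - 1 = α - 1 + 1 by ring, Real.rpow_add_one two_ne_zero]
  ring

lemma kernelJ_one (α : ℝ) : kernelJ α 1 = 1 := by simp [kernelJ]

lemma kernelJ_neg_one {α : ℝ} (hα : -(1 / 2) < α) : kernelJ α (-1) = 0 := by
  have : (-1 : ℝ) ≠ 1 := by norm_num
  simp only [kernelJ, this, if_false, angularJ, Real.arccos_neg_one, Real.sin_pi]
  rw [Real.zero_rpow (by linarith)]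
  simp

/-- The definition with θ = arccos c substituted and the normalization cleared, so that relations
between J-functions become relations between `kernelIntegral`s. The point c = 1 is excluded because
the value there is set by definition. -/
lemma cConst_mul_kernelJ {α c : ℝ} (hα : -(1 / 2) < α) (h1 : -1 ≤ c) (h2 : c < 1) :
    cConst α * kernelJ α c =
      Real.Gamma (α + 1) / (2 * Real.pi) * ((1 - c ^ 2) ^ (α + 1 / 2) * kernelIntegral α c) := by
  have hc := (cConst_pos hα).ne'
  have hpi := Real.pi_pos.ne'
  have hs : Real.sin (Real.arccos c) ^ (2 * α + 1) = (1 - c ^ 2) ^ (α + 1 / 2) := by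
    rw [Real.sin_arccos, Real.sqrt_eq_rpow, ← Real.rpow_mul (by nlinarith)]
    congr 1; ring
  simp only [kernelJ, h2.ne, if_false, angularJ, hs, Real.cos_arccos h1 h2.le]
  unfold kernelIntegral
  field_simp

/-- This is `kernelIntegral_recurrence` multiplied by (1-c²)^(α+1/2) and the Gamma factors. It
serves to compute the second moment of xφ(x). -/
lemma cConst_mul_kernelJ_add_one {α c : ℝ} (hα : 1 / 2 < α) (h1 : -1 < c) (h2 : c < 1) :
    cConst (α + 1) * kernelJ (α + 1) c = (2 * α + 1) * c * (cConst α * kernelJ α c) +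
      α ^ 2 * (1 - c ^ 2) * (cConst (α - 1) * kernelJ (α - 1) c) := by
  have hs : 0 < 1 - c ^ 2 := by nlinarith
  rw [cConst_mul_kernelJ (by linarith) h1.le h2, cConst_mul_kernelJ (by linarith) h1.le h2,
    cConst_mul_kernelJ (by linarith) h1.le h2, Real.Gamma_add_one (by linarith : α + 1 ≠ 0),
    show α - 1 + 1 = α by ring, Real.Gamma_add_one (by linarith : α ≠ 0),
    show α + 1 + 1 / 2 = α - 1 / 2 + 1 + 1 by ring, show α + 1 / 2 = α - 1 / 2 + 1 by ring,
    show α - 1 + 1 / 2 = α - 1 / 2 by ring, Real.rpow_add_one hs.ne', Real.rpow_add_one hs.ne']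
  linear_combination α * Real.Gamma α / (2 * Real.pi) * (1 - c ^ 2) ^ (α - 1 / 2) * (1 - c ^ 2) *
    kernelIntegral_recurrence (by linarith : 0 < α) h2

/-- The product rule for (1-c²)^(α+1/2) times the integral produces exactly the combination
(1-c²)(1+α)I_(α+1) - (2α+1)c I_α, which the recurrence collapses to α I_(α-1). The bound α > 1/2
keeps α - 1 in the range where the J-function is defined. -/
lemma hasDerivAt_kernelJ {α c : ℝ} (hα : 1 / 2 < α) (h1 : -1 < c) (h2 : c < 1) :
    HasDerivAt (kernelJ α) (α ^ 2 / (2 * α - 1) * kernelJ (α - 1) c) c := by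
  have hs : 0 < 1 - c ^ 2 := by nlinarith
  have hc0 := cConst_pos (by linarith : -(1 / 2) < α)
  have hc1 := cConst_pos (by linarith : -(1 / 2) < α - 1)
  have hcc : cConst α = (2 * α - 1) * cConst (α - 1) := by
    have := cConst_add_one (by linarith : -(1 / 2) < α - 1)
    rw [sub_add_cancel] at this
    rw [this]; ring
  have e : kernelJ α =ᶠ[𝓝 c] fun x => Real.Gamma (α + 1) / (2 * Real.pi) / cConst α *
      ((1 - x ^ 2) ^ (α + 1 / 2) * kernelIntegral α x) := by
    filter_upwards [Ioo_mem_nhds h1 h2] with x hx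
    rw [div_mul_eq_mul_div, eq_div_iff hc0.ne', mul_comm,
      cConst_mul_kernelJ (by linarith) hx.1.le hx.2]
  have d1 := (((hasDerivAt_id c).pow 2).const_sub 1).rpow_const (p := α + 1 / 2)
    (Or.inl (by simpa using hs.ne'))
  have d := (d1.mul (hasDerivAt_kernelIntegral (by linarith : 0 < α) h2)).const_mul
    (Real.Gamma (α + 1) / (2 * Real.pi) / cConst α)
  refine (d.congr_of_eventuallyEq e).congr_deriv ?_
  have hk := cConst_mul_kernelJ (α := α - 1) (by linarith) h1.le h2
  rw [show α - 1 + 1 = α by ring, show α - 1 + 1 / 2 = α - 1 / 2 by ring] at hk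
  have hk' : kernelJ (α - 1) c = Real.Gamma α / (2 * Real.pi) *
      ((1 - c ^ 2) ^ (α - 1 / 2) * kernelIntegral (α - 1) c) / cConst (α - 1) := by
    rw [eq_div_iff hc1.ne', ← hk]; ring
  have h2a : (2 * α - 1) ≠ 0 := by linarith
  rw [hk', hcc, Real.Gamma_add_one (by linarith : α ≠ 0)]
  simp only [id, Pi.pow_apply]
  rw [show α + 1 / 2 - 1 = α - 1 / 2 by ring, show α + 1 / 2 = α - 1 / 2 + 1 by ring,
    Real.rpow_add_one hs.ne']
  have hc1' := hc1.ne'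
  have hpi := Real.pi_pos.ne'
  have hrec := kernelIntegral_recurrence (by linarith : 0 < α) h2
  have : (2 * α - 1) * cConst (α - 1) * (2 * Real.pi) ≠ 0 := by positivity
  field_simp
  push_cast
  linear_combination 2 / (2 * α - 1) * hrec

end BatchNorm

/-! ### The angular integral of two one-sided powers -/

namespace BatchNorm

/-- Substitute cos t = (cos η - cos θ)/(1 - cos θ cos η), a bijection of (0, π/2) onto (0, π-θ).
Then cos θ + cos t = sin²θ cos η/(1 - cos θ cos η) and dt = sin θ/(1 - cos θ cos η) dη. The change
of variables for sets avoids any discussion of the endpoints, where β may be negative. -/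
lemma integral_cos_add_cos_rpow (β : ℝ) {θ : ℝ} (h0 : 0 < θ) (h1 : θ < Real.pi) :
    ∫ t in (0 : ℝ)..(Real.pi - θ), (Real.cos θ + Real.cos t) ^ β =
      Real.sin θ ^ (2 * β + 1) * kernelIntegral β (Real.cos θ) := by
  have hpi := Real.pi_pos
  have hs : 0 < Real.sin θ := Real.sin_pos_of_pos_of_lt_pi h0 h1
  have hs2 := Real.sin_sq_add_cos_sq θ
  set C := Real.cos θ with hC
  have hC1 : C < 1 := by nlinarith [Real.cos_le_one θ]
  have hC2 : -1 < C := by nlinarith [Real.neg_one_le_cos θ]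
  have hang : Real.arccos (-C) = Real.pi - θ := by
    rw [Real.arccos_neg, hC, Real.arccos_cos h0.le h1.le]
  have hX : ∀ η ∈ Set.Ioo 0 (Real.pi / 2), 0 < 1 - C * Real.cos η := fun η hη =>
    one_sub_mul_cos_pos hC1 (cos_pos_of_mem_Ioo' hη).le
  have hq1 : ∀ η ∈ Set.Ioo 0 (Real.pi / 2), Real.cos η < 1 := fun η hη => by
    have := Real.strictAntiOn_cos ⟨le_rfl, hpi.le⟩ ⟨hη.1.le, by linarith [hη.2]⟩ hη.1
    simpa using this
  set w : ℝ → ℝ := fun η => (Real.cos η - C) / (1 - C * Real.cos η) with hw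
  have hw1 : ∀ η ∈ Set.Ioo 0 (Real.pi / 2), w η < 1 := fun η hη => by
    rw [hw, div_lt_one (hX η hη)]; nlinarith [hq1 η hη]
  have hw2 : ∀ η ∈ Set.Ioo 0 (Real.pi / 2), -C < w η := fun η hη => by
    rw [hw, lt_div_iff₀ (hX η hη)]
    nlinarith [cos_pos_of_mem_Ioo' hη, mul_pos (cos_pos_of_mem_Ioo' hη) (pow_pos hs 2)]
  have hcosm : ∀ τ ∈ Set.Ioo 0 (Real.pi - θ), -C < Real.cos τ ∧ Real.cos τ < 1 := fun τ hτ => by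
    constructor
    · rw [hC, ← Real.cos_pi_sub]
      exact Real.strictAntiOn_cos ⟨hτ.1.le, by linarith [hτ.2]⟩ ⟨by linarith, by linarith⟩ hτ.2
    · have := Real.strictAntiOn_cos ⟨le_rfl, hpi.le⟩ ⟨hτ.1.le, by linarith [hτ.2]⟩ hτ.1
      simpa using this
  have himg : (fun η => Real.arccos (w η)) '' Set.Ioo 0 (Real.pi / 2) =
      Set.Ioo 0 (Real.pi - θ) := by
    ext τ
    constructor
    · rintro ⟨η, hη, rfl⟩
      refine ⟨Real.arccos_pos.2 (hw1 η hη), ?_⟩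
      rw [← hang]
      exact Real.strictAntiOn_arccos ⟨by linarith, by linarith⟩
        ⟨by linarith [hw2 η hη], (hw1 η hη).le⟩ (hw2 η hη)
    · intro hτ
      obtain ⟨ha, hb⟩ := hcosm τ hτ
      have hY : 0 < 1 + C * Real.cos τ := by
        nlinarith [mul_pos (sub_pos.2 hC1) (sub_pos.2 hb)]
      have hv0 : 0 < (C + Real.cos τ) / (1 + C * Real.cos τ) := div_pos (by linarith) hY
      have hv1 : (C + Real.cos τ) / (1 + C * Real.cos τ) < 1 := by
        rw [div_lt_one hY]; nlinarith
      -- The inverse of the Möbius map w, obtained by replacing C by -C.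
      refine ⟨Real.arccos ((C + Real.cos τ) / (1 + C * Real.cos τ)),
        ⟨Real.arccos_pos.2 hv1, Real.arccos_lt_pi_div_two.2 hv0⟩, ?_⟩
      simp only [hw]
      rw [Real.cos_arccos (by linarith) hv1.le]
      have : ((C + Real.cos τ) / (1 + C * Real.cos τ) - C) /
          (1 - C * ((C + Real.cos τ) / (1 + C * Real.cos τ))) = Real.cos τ := by
        have h3 : (1 - C ^ 2) ≠ 0 := by nlinarith [pow_pos hs 2]
        have h4 : 1 - C * ((C + Real.cos τ) / (1 + C * Real.cos τ)) =
          (1 - C ^ 2) / (1 + C * Real.cos τ) := by field_simp; ring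
        rw [h4]
        field_simp
        ring
      rw [this, Real.arccos_cos hτ.1.le (by linarith [hτ.2])]
  have hinj : Set.InjOn (fun η => Real.arccos (w η)) (Set.Ioo 0 (Real.pi / 2)) := by
    intro x hx y hy hxy
    have h3 := Real.arccos_injOn ⟨by linarith [hw2 x hx], (hw1 x hx).le⟩
      ⟨by linarith [hw2 y hy], (hw1 y hy).le⟩ hxy
    simp only [hw] at h3
    rw [div_eq_div_iff (hX x hx).ne' (hX y hy).ne'] at h3
    have h4 : Real.cos x = Real.cos y := by
      have : (1 - C ^ 2) * (Real.cos x - Real.cos y) = 0 := by linear_combination h3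
      rcases mul_eq_zero.1 this with h | h
      · nlinarith [pow_pos hs 2]
      · linarith
    exact Real.injOn_cos ⟨hx.1.le, by linarith [hx.2]⟩ ⟨hy.1.le, by linarith [hy.2]⟩ h4
  have hder : ∀ η ∈ Set.Ioo 0 (Real.pi / 2), HasDerivWithinAt (fun η => Real.arccos (w η))
      (Real.sin θ / (1 - C * Real.cos η)) (Set.Ioo 0 (Real.pi / 2)) η := by
    intro η hη
    have hXη := hX η hη
    have hsη : 0 < Real.sin η := Real.sin_pos_of_pos_of_lt_pi hη.1 (by linarith [hη.2])
    have hse := Real.sin_sq_add_cos_sq η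
    have d1 : HasDerivAt w _ η := ((Real.hasDerivAt_cos η).sub_const C).div
      (((Real.hasDerivAt_cos η).const_mul C).const_sub 1) hXη.ne'
    have d2 := (Real.hasDerivAt_arccos (x := w η) (by linarith [hw2 η hη])
      (hw1 η hη).ne).comp η d1
    refine (d2.congr_deriv ?_).hasDerivWithinAt
    have e1 : 1 - w η ^ 2 = (Real.sin θ * Real.sin η / (1 - C * Real.cos η)) ^ 2 := by
      simp only [hw]
      rw [div_pow, div_pow, eq_div_iff (by positivity), sub_mul, div_mul_cancel₀ _ (by positivity)]
      linear_combination (-Real.sin η ^ 2) * hs2 + (C ^ 2 - 1) * hse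
    rw [e1, Real.sqrt_sq (by positivity)]
    field_simp
    linear_combination -hs2
  have h := integral_image_eq_integral_abs_deriv_smul measurableSet_Ioo hder hinj
    (fun t => (C + Real.cos t) ^ β)
  rw [himg] at h
  rw [intervalIntegral.integral_of_le (by linarith), integral_Ioc_eq_integral_Ioo, h]
  unfold kernelIntegral
  rw [intervalIntegral.integral_of_le (by positivity), integral_Ioc_eq_integral_Ioo,
    ← integral_const_mul]
  refine setIntegral_congr_fun measurableSet_Ioo fun η hη => ?_
  have hXη := hX η hη
  have hq := cos_pos_of_mem_Ioo' hη
  have e2 : C + w η = Real.sin θ ^ 2 * (Real.cos η / (1 - C * Real.cos η)) := by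
    simp only [hw]
    field_simp
    linear_combination Real.cos η * (-hs2)
  simp only [smul_eq_mul]
  rw [Real.cos_arccos (by linarith [hw2 η hη]) (hw1 η hη).le, e2, abs_of_pos (by positivity),
    Real.mul_rpow (by positivity) (by positivity), Real.div_rpow hq.le hXη.le,
    Real.rpow_add hs, Real.rpow_add hXη, Real.rpow_one, Real.rpow_one, Real.rpow_mul hs.le]
  norm_num
  have := (Real.rpow_pos_of_pos hXη β).ne'
  field_simp

/-- `x^β` on the positive half-line, extended by zero. -/
noncomputable def posPow (β x : ℝ) : ℝ := if 0 < x then x ^ β else 0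

lemma posPow_of_pos {x : ℝ} (β : ℝ) (hx : 0 < x) : posPow β x = x ^ β := if_pos hx

lemma posPow_of_nonpos {x : ℝ} (β : ℝ) (hx : x ≤ 0) : posPow β x = 0 := if_neg hx.not_gt

lemma posPow_nonneg (β x : ℝ) : 0 ≤ posPow β x := by
  unfold posPow; split_ifs with h
  · exact Real.rpow_nonneg h.le _
  · exact le_rfl

lemma posPow_mul (β x : ℝ) {r : ℝ} (hr : 0 < r) : posPow β (r * x) = r ^ β * posPow β x := by
  rcases le_or_gt x 0 with h | h
  · rw [posPow_of_nonpos _ h, posPow_of_nonpos _ (by nlinarith), mul_zero]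
  · rw [posPow_of_pos _ h, posPow_of_pos _ (by positivity), Real.mul_rpow hr.le h.le]

lemma measurable_posPow (β : ℝ) : Measurable (posPow β) :=
  Measurable.ite measurableSet_Ioi (by fun_prop) measurable_const

/-- With angles measured from the bisector of the two directions, both cosines are positive exactly
for |τ| < (π-θ)/2 within a period, and 2 cos(τ+θ/2) cos(τ-θ/2) = cos θ + cos 2τ. -/
lemma posPow_cos_mul_posPow_cos (β : ℝ) {θ τ : ℝ} (h0 : 0 < θ)
    (hτ : τ ∈ Set.Ioo (-((Real.pi - θ) / 2)) ((Real.pi - θ) / 2)) :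
    posPow β (Real.cos (τ + θ / 2)) * posPow β (Real.cos (τ + θ / 2 - θ)) =
      2 ^ (-β) * (Real.cos θ + Real.cos (2 * τ)) ^ β := by
  have hp1 : 0 < Real.cos (τ + θ / 2) :=
    Real.cos_pos_of_mem_Ioo ⟨by linarith [hτ.1], by linarith [hτ.2]⟩
  have hp2 : 0 < Real.cos (τ + θ / 2 - θ) :=
    Real.cos_pos_of_mem_Ioo ⟨by linarith [hτ.1], by linarith [hτ.2]⟩
  have e : Real.cos θ + Real.cos (2 * τ) =
      2 * (Real.cos (τ + θ / 2) * Real.cos (τ + θ / 2 - θ)) := by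
    rw [Real.cos_add_cos]
    rw [show (θ + 2 * τ) / 2 = τ + θ / 2 by ring, ← Real.cos_neg ((θ - 2 * τ) / 2),
      show -((θ - 2 * τ) / 2) = τ + θ / 2 - θ by ring]
    ring
  rw [posPow_of_pos _ hp1, posPow_of_pos _ hp2, ← Real.mul_rpow hp1.le hp2.le, e,
    Real.mul_rpow zero_le_two (by positivity), ← mul_assoc, ← Real.rpow_add two_pos]
  simp

lemma posPow_cos_mul_posPow_cos_eq_zero (β : ℝ) {θ τ : ℝ} (h1 : θ < Real.pi)
    (hτ : τ ∈ Set.Icc (-Real.pi) Real.pi)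
    (hτ' : τ ∉ Set.Ioo (-((Real.pi - θ) / 2)) ((Real.pi - θ) / 2)) :
    posPow β (Real.cos (τ + θ / 2)) * posPow β (Real.cos (τ + θ / 2 - θ)) = 0 := by
  rcases le_or_gt τ (-((Real.pi - θ) / 2)) with h | h
  · rw [posPow_of_nonpos (x := Real.cos (τ + θ / 2 - θ)), mul_zero]
    rw [← Real.cos_neg]
    exact Real.cos_nonpos_of_pi_div_two_le_of_le (by linarith) (by linarith [hτ.1])
  · have h' : (Real.pi - θ) / 2 ≤ τ := by
      by_contra hc
      exact hτ' ⟨h, not_le.1 hc⟩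
    rw [posPow_of_nonpos (x := Real.cos (τ + θ / 2)), zero_mul]
    exact Real.cos_nonpos_of_pi_div_two_le_of_le (by linarith) (by linarith [hτ.2])

lemma integral_posPow_cos_mul_posPow_cos (β : ℝ) {θ : ℝ} (h0 : 0 < θ) (h1 : θ < Real.pi) :
    ∫ ω in -Real.pi..Real.pi, posPow β (Real.cos ω) * posPow β (Real.cos (ω - θ)) =
      2 ^ (-β) * (Real.sin θ ^ (2 * β + 1) * kernelIntegral β (Real.cos θ)) := by
  have hpi := Real.pi_pos
  have hper : Function.Periodic
      (fun ω => posPow β (Real.cos ω) * posPow β (Real.cos (ω - θ))) (2 * Real.pi) := by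
    intro ω
    simp only [Real.cos_add_two_pi, add_sub_right_comm]
  -- Periodicity allows the window to be centred at the bisector θ/2.
  have e1 := hper.intervalIntegral_add_eq (-Real.pi) (-Real.pi + θ / 2)
  rw [show -Real.pi + 2 * Real.pi = Real.pi by ring,
    show -Real.pi + θ / 2 + 2 * Real.pi = Real.pi + θ / 2 by ring,
    ← intervalIntegral.integral_comp_add_right
      (fun ω => posPow β (Real.cos ω) * posPow β (Real.cos (ω - θ)))] at e1
  rw [e1, intervalIntegral.integral_of_le (by linarith), ← integral_Icc_eq_integral_Ioc,
    setIntegral_eq_of_subset_of_forall_sdiff_eq_zero measurableSet_Icc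
      (s := Set.Ioo (-((Real.pi - θ) / 2)) ((Real.pi - θ) / 2))
      (fun x hx => ⟨by linarith [hx.1], by linarith [hx.2]⟩)
      (fun x hx => posPow_cos_mul_posPow_cos_eq_zero β h1 hx.1 hx.2),
    setIntegral_congr_fun measurableSet_Ioo
      (fun x hx => posPow_cos_mul_posPow_cos β h0 hx),
    ← integral_Ioc_eq_integral_Ioo, ← intervalIntegral.integral_of_le (by linarith),
    intervalIntegral.integral_const_mul, ← integral_cos_add_cos_rpow β h0 h1]
  congr 1
  rw [intervalIntegral.integral_comp_mul_left (fun t => (Real.cos θ + Real.cos t) ^ β) two_ne_zero]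
  set a := Real.pi - θ with ha
  -- The integrand is even in t, so the symmetric interval counts the half interval twice; this
  -- cancels the factor 1/2 from t = 2τ.
  have h := integral_comp_abs (f := (Set.Iio a).indicator fun t => (Real.cos θ + Real.cos t) ^ β)
  rw [setIntegral_indicator measurableSet_Iio, Set.Ioi_inter_Iio] at h
  have h' : (fun x : ℝ => (Set.Iio a).indicator (fun t => (Real.cos θ + Real.cos t) ^ β) |x|) =
      (Set.Ioo (-a) a).indicator fun t => (Real.cos θ + Real.cos t) ^ β := by
    ext x
    simp only [Set.indicator, Set.mem_Iio, Set.mem_Ioo, abs_lt, Real.cos_abs]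
  rw [h', integral_indicator measurableSet_Ioo] at h
  rw [show 2 * -(a / 2) = -a by ring, show 2 * (a / 2) = a by ring,
    intervalIntegral.integral_of_le (by linarith), intervalIntegral.integral_of_le (by linarith),
    integral_Ioc_eq_integral_Ioo, integral_Ioc_eq_integral_Ioo, h, smul_eq_mul]
  ring

end BatchNorm

namespace BatchNorm

/-! ### The standard Gaussian measure: density, coisometries, polar coordinates -/

section Gaussian

variable {V W : Type*} [NormedAddCommGroup V] [InnerProductSpace ℝ V] [FiniteDimensional ℝ V]
  [MeasurableSpace V] [BorelSpace V] [NormedAddCommGroup W] [InnerProductSpace ℝ W]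
  [FiniteDimensional ℝ W] [MeasurableSpace W] [BorelSpace W]

/-- The density of the standard Gaussian measure. -/
noncomputable def gaussianDensity (n : ℕ) (r : ℝ) : ℝ :=
  (2 * Real.pi) ^ (-(n / 2 : ℝ)) * Real.exp (-(1 / 2) * r ^ 2)

lemma gaussianDensity_pos (n : ℕ) (r : ℝ) : 0 < gaussianDensity n r := by
  have := Real.pi_pos
  unfold gaussianDensity
  positivity

/-- Both finite measures have characteristic function exp(-‖t‖²/2). An explicit density is what
makes polar coordinates available. -/
lemma stdGaussian_eq_withDensity : stdGaussian V = volume.withDensity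
    fun x : V => ENNReal.ofReal (gaussianDensity (Module.finrank ℝ V) ‖x‖) := by
  have hint : Integrable (fun x : V => gaussianDensity (Module.finrank ℝ V) ‖x‖) := by
    have := (GaussianFourier.integrable_cexp_neg_mul_sq_norm_add (V := V) (b := 1 / 2) (by norm_num)
      0 0).norm
    refine Integrable.const_mul (this.congr (.of_forall fun x => ?_)) _
    simp [Complex.norm_exp, ← Complex.ofReal_pow]
  have : IsFiniteMeasure (volume.withDensity
      fun x : V => ENNReal.ofReal (gaussianDensity (Module.finrank ℝ V) ‖x‖)) :=
    isFiniteMeasure_withDensity_ofReal hint.2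
  refine Measure.ext_of_charFun ?_
  ext t
  rw [charFun_stdGaussian, charFun_apply, integral_withDensity_eq_integral_toReal_smul
    (by unfold gaussianDensity; fun_prop) (.of_forall fun x => ENNReal.ofReal_lt_top)]
  have h := GaussianFourier.integral_cexp_neg_mul_sq_norm_add (V := V) (b := 1 / 2) (by norm_num)
    Complex.I t
  have hpi := Real.pi_pos
  have e : ∀ x : V, (ENNReal.ofReal (gaussianDensity (Module.finrank ℝ V) ‖x‖)).toReal •
      Complex.exp (inner ℝ x t * Complex.I) =
      ((2 * Real.pi) ^ (-(Module.finrank ℝ V / 2 : ℝ)) : ℝ) *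
        Complex.exp (-(1 / 2) * ‖x‖ ^ 2 + Complex.I * inner ℝ t x) := by
    intro x
    rw [ENNReal.toReal_ofReal (gaussianDensity_pos _ _).le, gaussianDensity, Complex.exp_add,
      real_inner_comm, mul_comm Complex.I]
    simp only [Complex.real_smul, Complex.ofReal_mul, Complex.ofReal_exp]
    push_cast
    ring
  simp_rw [e]
  rw [integral_const_mul, h, Complex.ofReal_cpow (by positivity), ← mul_assoc]
  have h2 : ((2 * Real.pi : ℝ) : ℂ) ^ ((-(Module.finrank ℝ V / 2 : ℝ) : ℝ) : ℂ) *
      ((Real.pi : ℂ) / (1 / 2)) ^ (Module.finrank ℝ V / 2 : ℂ) = 1 := by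
    have h3 : ((2 * Real.pi : ℝ) : ℂ) ≠ 0 := by exact_mod_cast (by positivity : 2 * Real.pi ≠ 0)
    rw [show (Real.pi : ℂ) / (1 / 2) = ((2 * Real.pi : ℝ) : ℂ) by push_cast; ring,
      ← Complex.cpow_add _ _ h3]
    push_cast
    simp
  rw [h2, one_mul]
  congr 1
  rw [Complex.I_sq]
  ring

lemma integral_stdGaussian (f : V → ℝ) : ∫ x, f x ∂(stdGaussian V) =
    ∫ x, gaussianDensity (Module.finrank ℝ V) ‖x‖ * f x := by
  rw [stdGaussian_eq_withDensity, integral_withDensity_eq_integral_toReal_smul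
    (by unfold gaussianDensity; fun_prop) (.of_forall fun x => ENNReal.ofReal_lt_top)]
  simp_rw [ENNReal.toReal_ofReal (gaussianDensity_pos _ _).le, smul_eq_mul]

lemma integrable_stdGaussian_iff (f : V → ℝ) : Integrable f (stdGaussian V) ↔
    Integrable fun x => gaussianDensity (Module.finrank ℝ V) ‖x‖ * f x := by
  rw [stdGaussian_eq_withDensity, integrable_withDensity_iff_integrable_smul'
    (by unfold gaussianDensity; fun_prop) (.of_forall fun x => ENNReal.ofReal_lt_top)]
  simp_rw [ENNReal.toReal_ofReal (gaussianDensity_pos _ _).le, smul_eq_mul]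

/-- A coisometry maps the standard Gaussian measure to the standard Gaussian measure. -/
lemma map_stdGaussian_of_norm_adjoint (A : V →L[ℝ] W)
    (hA : ∀ t, ‖ContinuousLinearMap.adjoint A t‖ = ‖t‖) :
    (stdGaussian V).map A = stdGaussian W := by
  have : IsProbabilityMeasure ((stdGaussian V).map A) :=
    Measure.isProbabilityMeasure_map (by fun_prop)
  refine Measure.ext_of_charFun ?_
  ext t
  rw [charFun_stdGaussian, charFun_apply, integral_map (by fun_prop)
    (Measurable.aestronglyMeasurable (by fun_prop)), ← hA t, ← charFun_stdGaussian, charFun_apply]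
  simp_rw [ContinuousLinearMap.adjoint_inner_right]

/-- `F` is positive-homogeneous of degree `k`. -/
def IsHomogeneousOn (k : ℝ) (F : V → ℝ) : Prop :=
  ∀ r : ℝ, 0 < r → ∀ x, F (r • x) = r ^ k * F x

/-- `∫₀^∞ r^(m-1) e^(-r²/2) dr`. -/
noncomputable def radialMoment (m : ℝ) : ℝ := (1 / 2) ^ (-m / 2) * (1 / 2) * Real.Gamma (m / 2)

lemma radialMoment_pos {m : ℝ} (hm : 0 < m) : 0 < radialMoment m := by
  have := Real.Gamma_pos_of_pos (show 0 < m / 2 by linarith)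
  unfold radialMoment
  positivity

lemma radialMoment_add_two {m : ℝ} (hm : 0 < m) : radialMoment (m + 2) = m * radialMoment m := by
  unfold radialMoment
  rw [show (m + 2) / 2 = m / 2 + 1 by ring, Real.Gamma_add_one (by linarith),
    show -(m + 2) / 2 = -m / 2 - 1 by ring, Real.rpow_sub_one (by norm_num)]
  ring

lemma integral_radialMoment {m : ℝ} (hm : 0 < m) :
    ∫ r in Set.Ioi (0 : ℝ), r ^ (m - 1) * Real.exp (-(1 / 2) * r ^ 2) = radialMoment m := by
  have := integral_rpow_mul_exp_neg_mul_rpow (p := 2) (q := m - 1) (b := 1 / 2) (by norm_num)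
    (by linarith) (by norm_num)
  simp only [sub_add_cancel, Real.rpow_two] at this
  rw [this, radialMoment]

lemma integrableOn_radialMoment {m : ℝ} (hm : 0 < m) :
    IntegrableOn (fun r : ℝ => r ^ (m - 1) * Real.exp (-(1 / 2) * r ^ 2)) (Set.Ioi 0) := by
  have := integrableOn_rpow_mul_exp_neg_mul_rpow (p := 2) (s := m - 1) (b := 1 / 2)
    (by linarith) (by norm_num) (by norm_num)
  simpa only [Real.rpow_two] using this

end Gaussian

end BatchNorm

/-! ### Homogeneous functions in polar coordinates -/

namespace BatchNorm

lemma IsHomogeneousOn.comp_homeomorphUnitSphereProd {V : Type*}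
    [NormedAddCommGroup V] [InnerProductSpace ℝ V] {k : ℝ} {F : V → ℝ}
    (hF : IsHomogeneousOn k F) (w : ℝ → ℝ) (x : ({(0)}ᶜ : Set V)) :
    w ‖x.1‖ * F x.1 = F (homeomorphUnitSphereProd V x).1 *
      (w (homeomorphUnitSphereProd V x).2 * ((homeomorphUnitSphereProd V x).2 : ℝ) ^ k) := by
  have hx : 0 < ‖x.1‖ := norm_pos_iff.2 x.2
  have h := hF ‖x.1‖ hx (‖x.1‖⁻¹ • x.1)
  rw [smul_smul, mul_inv_cancel₀ hx.ne', one_smul] at h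
  simp only [homeomorphUnitSphereProd_apply_fst_coe, homeomorphUnitSphereProd_apply_snd_coe]
  nth_rewrite 1 [h]
  ring

section Gaussian

variable {V W : Type*} [NormedAddCommGroup V] [InnerProductSpace ℝ V] [FiniteDimensional ℝ V]
  [MeasurableSpace V] [BorelSpace V] [NormedAddCommGroup W] [InnerProductSpace ℝ W]
  [FiniteDimensional ℝ W] [MeasurableSpace W] [BorelSpace W]

variable [Nontrivial V]

/-- On the product of sphere and half-line the integrand is a product of a function of the direction
and a function of the radius. The integral of such a product splits without any integrability
hypothesis, so none is imposed on F. -/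
lemma IsHomogeneousOn.integral_polar {k : ℝ} {F : V → ℝ} (hF : IsHomogeneousOn k F)
    (w : ℝ → ℝ) :
    ∫ x, w ‖x‖ * F x = (∫ u, F u ∂(volume : Measure V).toSphere) *
      ∫ r in Set.Ioi (0 : ℝ), r ^ (Module.finrank ℝ V - 1) * (w r * r ^ k) := by
  have h1 : ∫ x, w ‖x‖ * F x = ∫ x : ({(0)}ᶜ : Set V), w ‖x.1‖ * F x.1
      ∂((volume : Measure V).comap (↑)) := by
    rw [integral_subtype_comap (measurableSet_singleton _).compl fun x => w ‖x‖ * F x,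
      restrict_compl_singleton]
  simp_rw [h1, hF.comp_homeomorphUnitSphereProd w]
  rw [(volume : Measure V).measurePreserving_homeomorphUnitSphereProd.integral_comp
    (Homeomorph.measurableEmbedding _)
    (fun p => F p.1 * (w p.2 * ((p.2 : Set.Ioi (0 : ℝ)) : ℝ) ^ k)),
    integral_prod_mul (fun u : Metric.sphere (0 : V) 1 => F u)
      (fun r : Set.Ioi (0 : ℝ) => w r * (r : ℝ) ^ k)]
  congr 1
  simp only [Measure.volumeIoiPow, ENNReal.ofReal]
  rw [integral_withDensity_eq_integral_smul
      (measurable_subtype_coe.pow_const _).real_toNNReal,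
    integral_subtype_comap measurableSet_Ioi
      fun a => Real.toNNReal (a ^ (Module.finrank ℝ V - 1)) • (w a * a ^ k),
    setIntegral_congr_fun measurableSet_Ioi fun x hx => ?_]
  rw [NNReal.smul_def, Real.coe_toNNReal _ (pow_nonneg hx.out.le _), smul_eq_mul]

lemma IsHomogeneousOn.integrable_polar_iff {k : ℝ} {F : V → ℝ} (hF : IsHomogeneousOn k F)
    (w : ℝ → ℝ) :
    Integrable (fun x => w ‖x‖ * F x) ↔
      Integrable (fun p : Metric.sphere (0 : V) 1 × Set.Ioi (0 : ℝ) =>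
        F p.1 * (w p.2 * (p.2 : ℝ) ^ k))
        ((volume : Measure V).toSphere.prod (.volumeIoiPow (Module.finrank ℝ V - 1))) := by
  have h : Integrable (fun x => w ‖x‖ * F x) ↔
      Integrable (fun x : ({(0)}ᶜ : Set V) => w ‖x.1‖ * F x.1)
        ((volume : Measure V).comap (↑)) := by
    nth_rewrite 1 [← restrict_compl_singleton (μ := (volume : Measure V)) 0]
    rw [← IntegrableOn, integrableOn_iff_comap_subtypeVal (by measurability)]
    rfl
  rw [h, ← (volume : Measure V).measurePreserving_homeomorphUnitSphereProd.integrable_comp_emb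
    (Homeomorph.measurableEmbedding _)]
  exact integrable_congr (.of_forall fun x => hF.comp_homeomorphUnitSphereProd w x)

lemma integrable_volumeIoiPow_iff (n : ℕ) (f : ℝ → ℝ) :
    Integrable (fun r : Set.Ioi (0 : ℝ) => f r) (.volumeIoiPow n) ↔
      IntegrableOn (fun r => r ^ n * f r) (Set.Ioi 0) := by
  rw [integrableOn_iff_comap_subtypeVal measurableSet_Ioi, Measure.volumeIoiPow,
    integrable_withDensity_iff_integrable_smul' (by fun_prop) (by simp)]
  refine integrable_congr (.of_forall ?_)
  rintro ⟨x, hx : 0 < x⟩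
  simp (disch := positivity) [ENNReal.toReal_ofReal]

/-- Multiplying a homogeneous function by a power of the norm changes its Gaussian integral by a
quotient of radial moments. -/
lemma IsHomogeneousOn.integral_norm_rpow_mul {k p : ℝ} {F : V → ℝ} (hF : IsHomogeneousOn k F)
    (h1 : 0 < Module.finrank ℝ V + k) (h2 : 0 < Module.finrank ℝ V + k + p) :
    radialMoment (Module.finrank ℝ V + k) * ∫ x, ‖x‖ ^ p * F x ∂(stdGaussian V) =
      radialMoment (Module.finrank ℝ V + k + p) * ∫ x, F x ∂(stdGaussian V) := by
  set n := Module.finrank ℝ V with hn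
  have hn0 : 0 < n := Module.finrank_pos (R := ℝ) (M := V)
  -- The spherical factor is the same for all q; only the radial moment depends on the power. The
  -- cases q = 0 and q = p are compared.
  have key : ∀ q : ℝ, 0 < n + k + q → ∫ x, ‖x‖ ^ q * F x ∂(stdGaussian V) =
      (∫ u, F u ∂(volume : Measure V).toSphere) *
        ((2 * Real.pi) ^ (-(n / 2 : ℝ)) * radialMoment (n + k + q)) := by
    intro q hq
    rw [integral_stdGaussian]
    simp_rw [← mul_assoc]
    rw [hF.integral_polar (fun r => gaussianDensity (Module.finrank ℝ V) r * r ^ q), ← hn,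
      ← integral_radialMoment hq]
    simp only [mul_assoc]
    congr 1
    rw [← integral_const_mul]
    refine setIntegral_congr_fun measurableSet_Ioi fun r hr => ?_
    have hr' : 0 < r := hr
    simp only [gaussianDensity]
    rw [show (n : ℝ) + k + q - 1 = ((n - 1 : ℕ) : ℝ) + k + q by rw [Nat.cast_pred hn0]; ring,
      Real.rpow_add hr', Real.rpow_add hr', Real.rpow_natCast]
    ring
  have e0 := key 0 (by linarith)
  have e1 := key p h2
  simp only [Real.rpow_zero, one_mul, add_zero] at e0
  rw [e0, e1]
  ring

/-- Fubini at a single radius shows that F is integrable on the sphere. After that, every power of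
the norm with a convergent radial integral is allowed, negative ones included. -/
lemma IsHomogeneousOn.integrable_norm_rpow_mul {k p : ℝ} {F : V → ℝ} (hF : IsHomogeneousOn k F)
    (hi : Integrable F (stdGaussian V)) (h2 : 0 < Module.finrank ℝ V + k + p) :
    Integrable (fun x => ‖x‖ ^ p * F x) (stdGaussian V) := by
  set n := Module.finrank ℝ V with hn
  have hn0 : 0 < n := Module.finrank_pos (R := ℝ) (M := V)
  rw [integrable_stdGaussian_iff, hF.integrable_polar_iff] at hi
  rw [integrable_stdGaussian_iff]
  simp_rw [← mul_assoc]
  rw [hF.integrable_polar_iff (fun r => gaussianDensity (Module.finrank ℝ V) r * r ^ p)]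
  refine Integrable.mul_prod (f := fun u : Metric.sphere (0 : V) 1 => F u)
    (g := fun r : Set.Ioi (0 : ℝ) => gaussianDensity n r * (r : ℝ) ^ p * (r : ℝ) ^ k) ?_ ?_
  · have hne : (Measure.volumeIoiPow (n - 1)) ≠ 0 := by
      intro h
      have h3 := Measure.volumeIoiPow_apply_Iio (n - 1) ⟨1, Set.mem_Ioi.2 one_pos⟩
      rw [h] at h3
      simp only [Measure.coe_zero, Pi.zero_apply, one_pow] at h3
      exact (ENNReal.ofReal_pos.2 (by positivity)).ne h3
    have := ae_neBot.2 hne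
    obtain ⟨r, hr⟩ := hi.prod_left_ae.exists
    have hc : gaussianDensity (Module.finrank ℝ V) r * (r : ℝ) ^ k ≠ 0 :=
      (mul_pos (gaussianDensity_pos _ _) (Real.rpow_pos_of_pos r.2 _)).ne'
    exact (integrable_mul_const_iff (IsUnit.mk0 _ hc) _).1 hr
  · rw [integrable_volumeIoiPow_iff (n - 1) (fun r => gaussianDensity n r * r ^ p * r ^ k)]
    refine IntegrableOn.congr_fun ((integrableOn_radialMoment h2).const_mul
      ((2 * Real.pi) ^ (-(n / 2 : ℝ)))) (fun r hr => ?_) measurableSet_Ioi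
    have hr' : 0 < r := hr
    simp only [gaussianDensity]
    rw [show (n : ℝ) + k + p - 1 = ((n - 1 : ℕ) : ℝ) + k + p by rw [Nat.cast_pred hn0]; ring,
      Real.rpow_add hr', Real.rpow_add hr', Real.rpow_natCast]
    ring

end Gaussian

end BatchNorm

namespace BatchNorm

/-! ### Gaussian moments of homogeneous functions of one or two linear functionals -/

section PairCoord

variable {V : Type*} [NormedAddCommGroup V] [InnerProductSpace ℝ V] [FiniteDimensional ℝ V]

/-- The coordinates of `x` along the orthonormal pair `u, w`. -/
noncomputable def pairCoord (u w : V) : V →L[ℝ] EuclideanSpace ℝ (Fin 2) :=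
  ContinuousLinearMap.adjoint
    ((EuclideanSpace.proj (0 : Fin 2)).smulRight u + (EuclideanSpace.proj (1 : Fin 2)).smulRight w)

lemma pairCoord_zero (u w x : V) : pairCoord u w x 0 = inner ℝ u x := by
  have := ContinuousLinearMap.adjoint_inner_left
    ((EuclideanSpace.proj (𝕜 := ℝ) (0 : Fin 2)).smulRight u +
      (EuclideanSpace.proj (1 : Fin 2)).smulRight w) (EuclideanSpace.single 0 1) x
  rw [EuclideanSpace.inner_single_right] at this
  simpa [pairCoord, real_inner_comm] using this

lemma pairCoord_one (u w x : V) : pairCoord u w x 1 = inner ℝ w x := by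
  have := ContinuousLinearMap.adjoint_inner_left
    ((EuclideanSpace.proj (𝕜 := ℝ) (0 : Fin 2)).smulRight u +
      (EuclideanSpace.proj (1 : Fin 2)).smulRight w) (EuclideanSpace.single 1 1) x
  rw [EuclideanSpace.inner_single_right] at this
  simpa [pairCoord, real_inner_comm] using this

end PairCoord

section Moments

variable {V : Type*} [NormedAddCommGroup V] [InnerProductSpace ℝ V] [FiniteDimensional ℝ V]
  [MeasurableSpace V] [BorelSpace V]

lemma map_inner_stdGaussian {u : V} (hu : ‖u‖ = 1) :
    (stdGaussian V).map (fun x => inner ℝ u x) = stdGaussian ℝ := by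
  refine map_stdGaussian_of_norm_adjoint (innerSL ℝ u) fun t => ?_
  have : ContinuousLinearMap.adjoint (innerSL ℝ u) t = t • u := by
    refine ext_inner_right ℝ fun y => ?_
    rw [ContinuousLinearMap.adjoint_inner_left, real_inner_smul_left]
    simp [mul_comm]
  rw [this, norm_smul, hu, mul_one]

lemma map_pairCoord_stdGaussian {u w : V} (hu : ‖u‖ = 1) (hw : ‖w‖ = 1) (huw : inner ℝ u w = 0) :
    (stdGaussian V).map (pairCoord u w) = stdGaussian (EuclideanSpace ℝ (Fin 2)) := by
  refine map_stdGaussian_of_norm_adjoint _ fun t => ?_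
  rw [pairCoord, ContinuousLinearMap.adjoint_adjoint, EuclideanSpace.norm_eq,
    ← Real.sqrt_sq (norm_nonneg _)]
  congr 1
  simp only [add_apply, ContinuousLinearMap.smulRight_apply]
  rw [norm_add_sq_real, real_inner_smul_left, real_inner_smul_right, huw, norm_smul, norm_smul,
    hu, hw]
  simp

/-- The law of a pair of standard Gaussian variables with correlation `c`. -/
lemma integral_comp_inner_inner {u v : V} {c : ℝ} (hu : ‖u‖ = 1) (hv : ‖v‖ = 1)
    (huv : inner ℝ u v = c) (hc : c ^ 2 < 1) {F : ℝ × ℝ → ℝ} (hF : Measurable F) :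
    ∫ x, F (inner ℝ u x, inner ℝ v x) ∂(stdGaussian V) =
      ∫ y, F (y 0, c * y 0 + √(1 - c ^ 2) * y 1) ∂(stdGaussian (EuclideanSpace ℝ (Fin 2))) := by
  have hs : 0 < √(1 - c ^ 2) := Real.sqrt_pos.2 (by linarith)
  have hss : √(1 - c ^ 2) ^ 2 = 1 - c ^ 2 := Real.sq_sqrt (by linarith)
  -- Gram–Schmidt: w is the unit vector completing u to an orthonormal pair with v = c u + √(1-c²)
  -- w.
  set w : V := (√(1 - c ^ 2))⁻¹ • (v - c • u) with hw
  have hvw : v = c • u + √(1 - c ^ 2) • w := by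
    rw [hw, smul_smul, mul_inv_cancel₀ hs.ne', one_smul]; abel
  have huu : inner ℝ u u = 1 := by rw [real_inner_self_eq_norm_sq, hu]; norm_num
  have h1 : inner ℝ u w = 0 := by
    rw [hw, real_inner_smul_right, inner_sub_right, real_inner_smul_right, huv, huu]; ring
  have h2 : ‖w‖ = 1 := by
    have : ‖v‖ ^ 2 = c ^ 2 + (1 - c ^ 2) * ‖w‖ ^ 2 := by
      conv_lhs => rw [hvw]
      rw [norm_add_sq_real, real_inner_smul_left, real_inner_smul_right, h1, norm_smul, norm_smul,
        mul_pow, mul_pow, hu, Real.norm_eq_abs, Real.norm_eq_abs, sq_abs, sq_abs, hss]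
      ring
    rw [hv] at this
    have h3 : (1 - c ^ 2) * (‖w‖ ^ 2 - 1) = 0 := by linarith
    rcases mul_eq_zero.1 h3 with h | h
    · linarith
    · nlinarith [norm_nonneg w]
  rw [← map_pairCoord_stdGaussian hu h2 h1, integral_map (by fun_prop)
    (Measurable.aestronglyMeasurable (by fun_prop))]
  refine integral_congr_ae (.of_forall fun x => ?_)
  simp only [pairCoord_zero, pairCoord_one]
  congr 2
  conv_lhs => rw [hvw]
  rw [inner_add_left, real_inner_smul_left, real_inner_smul_left]

lemma integral_stdGaussian_real (f : ℝ → ℝ) :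
    ∫ x, f x ∂(stdGaussian ℝ) = ∫ x, gaussianDensity 1 x * f x := by
  rw [integral_stdGaussian]
  simp [gaussianDensity]

lemma integrable_stdGaussian_real_iff (f : ℝ → ℝ) :
    Integrable f (stdGaussian ℝ) ↔ Integrable fun x => gaussianDensity 1 x * f x := by
  rw [integrable_stdGaussian_iff]
  simp [gaussianDensity]

lemma gaussianDensity_mul_posPow_sq (β : ℝ) :
    (fun x => gaussianDensity 1 x * posPow β x ^ 2) = (Set.Ioi 0).indicator fun x =>
      (2 * Real.pi) ^ (-(1 / 2 : ℝ)) *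
        (x ^ ((2 * β + 1) - 1) * Real.exp (-(1 / 2) * x ^ 2)) := by
  ext x
  rcases le_or_gt x 0 with h | h
  · rw [posPow_of_nonpos _ h, Set.indicator_of_notMem (by simpa using h)]; ring
  · rw [posPow_of_pos _ h, Set.indicator_of_mem (by simpa using h), ← Real.rpow_mul_natCast h.le]
    simp only [gaussianDensity, Nat.cast_one]
    rw [show 2 * β + 1 - 1 = β * (2 : ℕ) by push_cast; ring]
    ring

lemma integral_posPow_sq_stdGaussian_real {β : ℝ} (hβ : -(1 / 2) < β) :
    ∫ x, posPow β x ^ 2 ∂(stdGaussian ℝ) = cConst β := by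
  rw [integral_stdGaussian_real, gaussianDensity_mul_posPow_sq, integral_indicator measurableSet_Ioi,
    integral_const_mul, integral_radialMoment (by linarith), radialMoment, cConst]
  have hpi := Real.pi_pos
  rw [Real.mul_rpow zero_le_two hpi.le, show (2 * β + 1) / 2 = β + 1 / 2 by ring,
    Real.sqrt_eq_rpow, one_div (Real.pi ^ _), ← Real.rpow_neg hpi.le, one_div (2 : ℝ),
    Real.inv_rpow zero_le_two, ← Real.rpow_neg zero_le_two,
    show β - 1 = -(2⁻¹ : ℝ) + -(-(2 * β + 1) / 2) + -1 by ring, Real.rpow_add two_pos,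
    Real.rpow_add two_pos, Real.rpow_neg_one]
  ring

lemma integrable_posPow_sq_stdGaussian_real {β : ℝ} (hβ : -(1 / 2) < β) :
    Integrable (fun x => posPow β x ^ 2) (stdGaussian ℝ) := by
  rw [integrable_stdGaussian_real_iff, gaussianDensity_mul_posPow_sq,
    integrable_indicator_iff measurableSet_Ioi]
  exact (integrableOn_radialMoment (by linarith)).const_mul _

lemma integral_euclideanSpace_fin_two (f : ℝ × ℝ → ℝ) :
    ∫ y : EuclideanSpace ℝ (Fin 2), f (y 0, y 1) = ∫ p, f p := by
  rw [← (volume_preserving_finTwoArrow ℝ).integral_comp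
    (MeasurableEquiv.measurableEmbedding _) f,
    ← (PiLp.volume_preserving_toLp (Fin 2)).integral_comp
    (MeasurableEquiv.toLp 2 _).measurableEmbedding]
  rfl

/-- In the plane of u and v the two functionals are r cos ω and r cos(ω - arccos c). The radial
integral is a Gamma value and the angular integral is the one computed by
`integral_posPow_cos_mul_posPow_cos`. -/
lemma integral_posPow_mul_posPow {u v : V} {c β : ℝ} (hu : ‖u‖ = 1) (hv : ‖v‖ = 1)
    (huv : inner ℝ u v = c) (hc : c ^ 2 < 1) (hβ : -(1 / 2) < β) :
    ∫ x, posPow β (inner ℝ u x) * posPow β (inner ℝ v x) ∂(stdGaussian V) =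
      cConst β * kernelJ β c := by
  have hpi := Real.pi_pos
  have hc1 : -1 < c := by nlinarith
  have hc2 : c < 1 := by nlinarith
  rw [integral_comp_inner_inner hu hv huv hc (F := fun p => posPow β p.1 * posPow β p.2)
    ((measurable_posPow β).comp measurable_fst |>.mul ((measurable_posPow β).comp measurable_snd)),
    integral_stdGaussian]
  have e : ∀ y : EuclideanSpace ℝ (Fin 2),
      gaussianDensity (Module.finrank ℝ (EuclideanSpace ℝ (Fin 2))) ‖y‖ *
        (posPow β (y 0) * posPow β (c * y 0 + √(1 - c ^ 2) * y 1)) =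
      (fun p : ℝ × ℝ => (2 * Real.pi)⁻¹ * Real.exp (-(1 / 2) * (p.1 ^ 2 + p.2 ^ 2)) *
        (posPow β p.1 * posPow β (c * p.1 + √(1 - c ^ 2) * p.2))) (y 0, y 1) := by
    intro y
    simp [gaussianDensity, EuclideanSpace.real_norm_sq_eq, Real.rpow_neg_one]
  simp_rw [e]
  rw [integral_euclideanSpace_fin_two (fun p : ℝ × ℝ => (2 * Real.pi)⁻¹ *
    Real.exp (-(1 / 2) * (p.1 ^ 2 + p.2 ^ 2)) *
        (posPow β p.1 * posPow β (c * p.1 + √(1 - c ^ 2) * p.2))),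
    ← integral_comp_polarCoord_symm]
  have e2 : ∀ p ∈ polarCoord.target, p.1 • ((2 * Real.pi)⁻¹ *
      Real.exp (-(1 / 2) * ((polarCoord.symm p).1 ^ 2 + (polarCoord.symm p).2 ^ 2)) *
        (posPow β (polarCoord.symm p).1 *
          posPow β (c * (polarCoord.symm p).1 + √(1 - c ^ 2) * (polarCoord.symm p).2))) =
      ((2 * Real.pi)⁻¹ * (p.1 ^ ((2 * β + 2) - 1) * Real.exp (-(1 / 2) * p.1 ^ 2))) *
        (posPow β (Real.cos p.2) * posPow β (Real.cos (p.2 - Real.arccos c))) := by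
    rintro ⟨r, ω⟩ hp
    have hr : 0 < r := hp.1
    simp only [polarCoord_symm_apply]
    have h1 : c * (r * Real.cos ω) + √(1 - c ^ 2) * (r * Real.sin ω) =
        r * Real.cos (ω - Real.arccos c) := by
      rw [Real.cos_sub, Real.cos_arccos hc1.le hc2.le, Real.sin_arccos]; ring
    have h2 : (r * Real.cos ω) ^ 2 + (r * Real.sin ω) ^ 2 = r ^ 2 := by
      linear_combination r ^ 2 * Real.sin_sq_add_cos_sq ω
    rw [h1, h2, posPow_mul _ _ hr, posPow_mul _ _ hr, show 2 * β + 2 - 1 = β + β + 1 by ring,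
      Real.rpow_add hr, Real.rpow_add hr, Real.rpow_one, smul_eq_mul]
    ring
  rw [setIntegral_congr_fun polarCoord.open_target.measurableSet e2, polarCoord_target,
    Measure.volume_eq_prod, setIntegral_prod_mul
      (fun r : ℝ => (2 * Real.pi)⁻¹ * (r ^ ((2 * β + 2) - 1) * Real.exp (-(1 / 2) * r ^ 2)))
      (fun ω => posPow β (Real.cos ω) * posPow β (Real.cos (ω - Real.arccos c))),
    integral_const_mul, integral_radialMoment (by linarith), ← integral_Ioc_eq_integral_Ioo,
    ← intervalIntegral.integral_of_le (by linarith), integral_posPow_cos_mul_posPow_cos β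
      (Real.arccos_pos.2 hc2) (Real.arccos_lt_pi.2 hc1),
    cConst_mul_kernelJ hβ hc1.le hc2, Real.cos_arccos hc1.le hc2.le, Real.sin_arccos,
    Real.sqrt_eq_rpow, ← Real.rpow_mul (by linarith), radialMoment, one_div (2 : ℝ),
    Real.inv_rpow zero_le_two, ← Real.rpow_neg zero_le_two,
    show -(-(2 * β + 2) / 2) = β + 1 by ring, Real.rpow_add_one two_ne_zero,
    show (2 * β + 2) / 2 = β + 1 by ring, show (2⁻¹ * (2 * β + 1)) = β + 2⁻¹ by ring,
    Real.rpow_neg zero_le_two]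
  have := (Real.rpow_pos_of_pos two_pos β).ne'
  field_simp

end Moments

end BatchNorm

/-! ### Gaussian second moments of positive-homogeneous functions -/

namespace BatchNorm

section Moments

variable {V : Type*} [NormedAddCommGroup V] [InnerProductSpace ℝ V] [FiniteDimensional ℝ V]
  [MeasurableSpace V] [BorelSpace V]

/-- The origin is excluded because in degree 0 the value ψ(0) is arbitrary, whereas `posPow`
vanishes there. This is harmless, since no linear functional in use has an atom at 0. -/
lemma IsPosHomogeneous.eq_posPow {β : ℝ} {ψ : ℝ → ℝ} (h : IsPosHomogeneous β ψ) {x : ℝ}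
    (hx : x ≠ 0) : ψ x = ψ 1 * posPow β x + ψ (-1) * posPow β (-x) := by
  rcases lt_or_gt_of_ne hx with h0 | h0
  · have := h (-x) (by linarith) (-1)
    rw [mul_neg, mul_one, neg_neg] at this
    rw [posPow_of_nonpos _ h0.le, posPow_of_pos _ (by linarith), this]
    ring
  · have := h x h0 1
    rw [mul_one] at this
    rw [posPow_of_pos _ h0, posPow_of_nonpos _ (by linarith), this]
    ring

lemma IsPosHomogeneous.measurable {β : ℝ} {ψ : ℝ → ℝ} (h : IsPosHomogeneous β ψ) :
    Measurable ψ := by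
  have e : ψ = fun x => if x = 0 then ψ 0 else ψ 1 * posPow β x + ψ (-1) * posPow β (-x) := by
    ext x
    split_ifs with hx
    · rw [hx]
    · exact h.eq_posPow hx
  rw [e]
  refine Measurable.ite (measurableSet_singleton 0) measurable_const ?_
  exact ((measurable_posPow β).const_mul _).add
    (((measurable_posPow β).comp measurable_neg).const_mul _)

lemma ae_ne_zero_stdGaussian_real : ∀ᵐ x ∂(stdGaussian ℝ), x ≠ 0 := by
  rw [stdGaussian_eq_withDensity]
  refine (withDensity_absolutelyContinuous _ _).ae_le ?_
  exact compl_mem_ae_iff.2 (measure_singleton 0)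

lemma ae_inner_ne_zero {u : V} (hu : u ≠ 0) :
    ∀ᵐ x ∂(stdGaussian V), inner ℝ u x ≠ 0 := by
  have hu' : ‖‖u‖⁻¹ • u‖ = 1 := by
    rw [norm_smul, norm_inv, norm_norm, inv_mul_cancel₀ (norm_ne_zero_iff.2 hu)]
  have h := ae_ne_zero_stdGaussian_real
  rw [← map_inner_stdGaussian hu'] at h
  filter_upwards [ae_of_ae_map (by fun_prop) h] with x hx h0
  rw [real_inner_smul_left, h0, mul_zero] at hx
  exact hx rfl

lemma integral_comp_inner {u : V} (hu : ‖u‖ = 1) {f : ℝ → ℝ} (hf : Measurable f) :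
    ∫ x, f (inner ℝ u x) ∂(stdGaussian V) = ∫ x, f x ∂(stdGaussian ℝ) := by
  rw [← map_inner_stdGaussian hu, integral_map (by fun_prop) hf.aestronglyMeasurable]

lemma integrable_comp_inner {u : V} (hu : ‖u‖ = 1) {f : ℝ → ℝ}
    (hi : Integrable f (stdGaussian ℝ)) :
    Integrable (fun x => f (inner ℝ u x)) (stdGaussian V) := by
  rw [← map_inner_stdGaussian hu] at hi
  exact hi.comp_measurable (by fun_prop)

lemma integrable_posPow_sq {u : V} (hu : ‖u‖ = 1) {β : ℝ} (hβ : -(1 / 2) < β) :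
    Integrable (fun x => posPow β (inner ℝ u x) ^ 2) (stdGaussian V) :=
  integrable_comp_inner hu (integrable_posPow_sq_stdGaussian_real hβ)

lemma integral_posPow_sq {u : V} (hu : ‖u‖ = 1) {β : ℝ} (hβ : -(1 / 2) < β) :
    ∫ x, posPow β (inner ℝ u x) ^ 2 ∂(stdGaussian V) = cConst β := by
  rw [integral_comp_inner hu ((measurable_posPow β).pow_const 2),
    integral_posPow_sq_stdGaussian_real hβ]

lemma integrable_posPow_mul_posPow {u v : V} (hu : ‖u‖ = 1) (hv : ‖v‖ = 1) {β : ℝ}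
    (hβ : -(1 / 2) < β) :
    Integrable (fun x => posPow β (inner ℝ u x) * posPow β (inner ℝ v x)) (stdGaussian V) := by
  refine ((integrable_posPow_sq hu hβ).add (integrable_posPow_sq hv hβ)).mono'
    (Measurable.aestronglyMeasurable (((measurable_posPow β).comp (by fun_prop)).mul
      ((measurable_posPow β).comp (by fun_prop)))) (.of_forall fun x => ?_)
  simp only [Pi.add_apply]
  rw [Real.norm_of_nonneg (mul_nonneg (posPow_nonneg _ _) (posPow_nonneg _ _))]
  nlinarith [sq_nonneg (posPow β (inner ℝ u x) - posPow β (inner ℝ v x)),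
    sq_nonneg (posPow β (inner ℝ u x)), sq_nonneg (posPow β (inner ℝ v x))]

lemma posPow_mul_posPow_neg (β x : ℝ) : posPow β x * posPow β (-x) = 0 := by
  rcases le_or_gt x 0 with h | h
  · rw [posPow_of_nonpos _ h, zero_mul]
  · rw [posPow_of_nonpos _ (by linarith : -x ≤ 0), mul_zero]

lemma IsPosHomogeneous.sq_eq {β : ℝ} {ψ : ℝ → ℝ} (h : IsPosHomogeneous β ψ) {x : ℝ}
    (hx : x ≠ 0) : ψ x ^ 2 = ψ 1 ^ 2 * posPow β x ^ 2 + ψ (-1) ^ 2 * posPow β (-x) ^ 2 := by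
  rw [h.eq_posPow hx]
  linear_combination 2 * ψ 1 * ψ (-1) * posPow_mul_posPow_neg β x

lemma IsPosHomogeneous.integrable_sq {β : ℝ} {ψ : ℝ → ℝ} (h : IsPosHomogeneous β ψ)
    (hβ : -(1 / 2) < β) {u : V} (hu : ‖u‖ = 1) :
    Integrable (fun x => ψ (inner ℝ u x) ^ 2) (stdGaussian V) := by
  have h1 := (integrable_posPow_sq hu hβ).const_mul (ψ 1 ^ 2)
  have h2 := (integrable_posPow_sq (u := -u) (by rwa [norm_neg]) hβ).const_mul (ψ (-1) ^ 2)
  refine (h1.add h2).congr ?_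
  filter_upwards [ae_inner_ne_zero (norm_ne_zero_iff.1 (by rw [hu]; exact one_ne_zero))] with x hx
  simp only [Pi.add_apply, inner_neg_left, h.sq_eq hx]

lemma IsPosHomogeneous.integral_sq {β : ℝ} {ψ : ℝ → ℝ} (h : IsPosHomogeneous β ψ)
    (hβ : -(1 / 2) < β) {u : V} (hu : ‖u‖ = 1) :
    ∫ x, ψ (inner ℝ u x) ^ 2 ∂(stdGaussian V) = cConst β * homJ β ψ 1 := by
  have hu' : ‖-u‖ = 1 := by rwa [norm_neg]
  have e : (fun x => ψ (inner ℝ u x) ^ 2) =ᵐ[stdGaussian V] fun x =>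
      ψ 1 ^ 2 * posPow β (inner ℝ u x) ^ 2 + ψ (-1) ^ 2 * posPow β (inner ℝ (-u) x) ^ 2 := by
    filter_upwards [ae_inner_ne_zero (norm_ne_zero_iff.1 (by rw [hu]; exact one_ne_zero))] with x hx
    simp only [inner_neg_left, h.sq_eq hx]
  rw [integral_congr_ae e, integral_add ((integrable_posPow_sq hu hβ).const_mul _)
    ((integrable_posPow_sq hu' hβ).const_mul _), integral_const_mul, integral_const_mul,
    integral_posPow_sq hu hβ, integral_posPow_sq hu' hβ, homJ, kernelJ_one, kernelJ_neg_one hβ]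
  ring

/-- Split ψ into its two half-line powers. Replacing one of u, v by its negative reverses the sign
of the correlation, which is the origin of the 𝕁(-c) term in `homJ`. -/
lemma IsPosHomogeneous.integral_mul {β : ℝ} {ψ : ℝ → ℝ} (h : IsPosHomogeneous β ψ)
    (hβ : -(1 / 2) < β) {u v : V} {c : ℝ} (hu : ‖u‖ = 1) (hv : ‖v‖ = 1) (huv : inner ℝ u v = c)
    (hc : c ^ 2 < 1) :
    ∫ x, ψ (inner ℝ u x) * ψ (inner ℝ v x) ∂(stdGaussian V) = cConst β * homJ β ψ c := by
  have hu' : ‖-u‖ = 1 := by rwa [norm_neg]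
  have hv' : ‖-v‖ = 1 := by rwa [norm_neg]
  have e : (fun x => ψ (inner ℝ u x) * ψ (inner ℝ v x)) =ᵐ[stdGaussian V] fun x =>
      ψ 1 ^ 2 * (posPow β (inner ℝ u x) * posPow β (inner ℝ v x)) +
      ψ 1 * ψ (-1) * (posPow β (inner ℝ u x) * posPow β (inner ℝ (-v) x)) +
      ψ 1 * ψ (-1) * (posPow β (inner ℝ (-u) x) * posPow β (inner ℝ v x)) +
      ψ (-1) ^ 2 * (posPow β (inner ℝ (-u) x) * posPow β (inner ℝ (-v) x)) := by
    filter_upwards [ae_inner_ne_zero (norm_ne_zero_iff.1 (by rw [hu]; exact one_ne_zero)),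
      ae_inner_ne_zero (norm_ne_zero_iff.1 (by rw [hv]; exact one_ne_zero))] with x hx hy
    rw [h.eq_posPow hx, h.eq_posPow hy, inner_neg_left, inner_neg_left]
    ring
  have i1 := (integrable_posPow_mul_posPow hu hv hβ).const_mul (ψ 1 ^ 2)
  have i2 := (integrable_posPow_mul_posPow hu hv' hβ).const_mul (ψ 1 * ψ (-1))
  have i3 := (integrable_posPow_mul_posPow hu' hv hβ).const_mul (ψ 1 * ψ (-1))
  have i4 := (integrable_posPow_mul_posPow hu' hv' hβ).const_mul (ψ (-1) ^ 2)
  rw [integral_congr_ae e, integral_add ((i1.fun_add i2).fun_add i3) i4, integral_add (i1.fun_add i2) i3,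
    integral_add i1 i2]
  simp only [integral_const_mul]
  rw [integral_posPow_mul_posPow hu hv huv hc hβ,
    integral_posPow_mul_posPow (c := -c) hu hv' (by rw [inner_neg_right, huv]) (by rwa [neg_sq]) hβ,
    integral_posPow_mul_posPow (c := -c) hu' hv (by rw [inner_neg_left, huv]) (by rwa [neg_sq]) hβ,
    integral_posPow_mul_posPow (c := c) hu' hv' (by rw [inner_neg_neg, huv]) hc hβ, homJ]
  ring

/-- A quadratic form in the arguments of a homogeneous function of two linear functionals. -/
lemma integral_quadratic_mul {u v : V} {c k : ℝ} (hu : ‖u‖ = 1) (hv : ‖v‖ = 1)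
    (huv : inner ℝ u v = c) (hc : c ^ 2 < 1) {F : ℝ × ℝ → ℝ} (hF : Measurable F)
    (hk : -2 < k) (hom : ∀ r : ℝ, 0 < r → ∀ p, F (r • p) = r ^ k * F p) :
    ∫ x, (inner ℝ u x ^ 2 - 2 * c * (inner ℝ u x * inner ℝ v x) + inner ℝ v x ^ 2) *
        F (inner ℝ u x, inner ℝ v x) ∂(stdGaussian V) =
      (1 - c ^ 2) * (k + 2) * ∫ x, F (inner ℝ u x, inner ℝ v x) ∂(stdGaussian V) := by
  have hss : √(1 - c ^ 2) ^ 2 = 1 - c ^ 2 := Real.sq_sqrt (by linarith)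
  rw [integral_comp_inner_inner hu hv huv hc hF, integral_comp_inner_inner hu hv huv hc
    (F := fun p => (p.1 ^ 2 - 2 * c * (p.1 * p.2) + p.2 ^ 2) * F p) (by fun_prop)]
  set F' : EuclideanSpace ℝ (Fin 2) → ℝ :=
    fun y => F (y 0, c * y 0 + √(1 - c ^ 2) * y 1) with hF'
  have hF'k : IsHomogeneousOn k F' := by
    intro r hr y
    simp only [hF']
    rw [← hom r hr]
    congr 1
    ext
    · simp
    · simp; ring
  have h := hF'k.integral_norm_rpow_mul (p := 2) (by simp; linarith) (by simp; linarith)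
  have hf : ((Module.finrank ℝ (EuclideanSpace ℝ (Fin 2)) : ℕ) : ℝ) = 2 := by simp
  rw [hf, radialMoment_add_two (by linarith), mul_assoc, mul_left_comm] at h
  have h' := mul_left_cancel₀ (radialMoment_pos (by linarith : 0 < 2 + k)).ne' h
  -- In orthonormal coordinates the quadratic form is (1-c²)‖y‖², and the weight ‖y‖² multiplies the
  -- integral of a degree-k function on the plane by 2 + k.
  have e : ∀ y : EuclideanSpace ℝ (Fin 2),
      (y 0 ^ 2 - 2 * c * (y 0 * (c * y 0 + √(1 - c ^ 2) * y 1)) +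
        (c * y 0 + √(1 - c ^ 2) * y 1) ^ 2) * F' y =
      (1 - c ^ 2) * (‖y‖ ^ (2 : ℝ) * F' y) := by
    intro y
    rw [Real.rpow_two, EuclideanSpace.real_norm_sq_eq, Fin.sum_univ_two]
    linear_combination y 1 ^ 2 * F' y * hss
  simp only [hF'] at e h'
  simp_rw [e]
  rw [integral_const_mul, h']
  ring

end Moments

end BatchNorm

namespace BatchNorm

/-! ### The law of a centred standard Gaussian batch -/

variable {B : ℕ}

lemma center_apply (h : EuclideanSpace ℝ (Fin B)) (i : Fin B) :
    center h i = h i - (∑ j, h j) / B := by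
  simp only [center, centering, Matrix.toLpLin_apply, Matrix.sub_mulVec, Matrix.one_mulVec,
    Matrix.smul_mulVec]
  simp [Matrix.mulVec, dotProduct]
  ring

lemma centering_apply (i j : Fin B) :
    centering B i j = (if i = j then 1 else 0) - 1 / (B : ℝ) := by
  simp [centering, Matrix.one_apply]

lemma continuous_center : Continuous (center (B := B)) :=
  LinearMap.continuous_of_finiteDimensional _

@[fun_prop]
lemma measurable_center : Measurable (center (B := B)) := continuous_center.measurable

lemma sum_center (hB : B ≠ 0) (h : EuclideanSpace ℝ (Fin B)) : ∑ i, center h i = 0 := by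
  have : (B : ℝ) ≠ 0 := by exact_mod_cast hB
  simp only [center_apply, Finset.sum_sub_distrib, Finset.sum_const, Finset.card_univ,
    Fintype.card_fin, nsmul_eq_mul]
  field_simp
  ring

lemma center_of_sum_eq_zero {h : EuclideanSpace ℝ (Fin B)} (hh : ∑ i, h i = 0) :
    center h = h := by
  ext i
  rw [center_apply, hh, zero_div, sub_zero]

lemma inner_center_left (x y : EuclideanSpace ℝ (Fin B)) :
    inner ℝ (center x) y = inner ℝ x (center y) := by
  simp only [PiLp.inner_apply, center_apply, RCLike.inner_apply, conj_trivial, mul_sub, sub_mul,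
    Finset.sum_sub_distrib, ← Finset.sum_mul, ← Finset.mul_sum]
  ring

/-- The law of `G ξ` for a standard Gaussian `ξ`. -/
noncomputable def centeredLaw (B : ℕ) : Measure (EuclideanSpace ℝ (Fin B)) :=
  (stdGaussian (EuclideanSpace ℝ (Fin B))).map center

instance : IsProbabilityMeasure (centeredLaw B) :=
  Measure.isProbabilityMeasure_map (by fun_prop)

/-- The hyperplane of vectors with vanishing coordinate sum. -/
noncomputable def sumZero (B : ℕ) : Submodule ℝ (EuclideanSpace ℝ (Fin B)) :=
  (ℝ ∙ (WithLp.toLp 2 (fun _ => 1) : EuclideanSpace ℝ (Fin B)))ᗮ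

lemma mem_sumZero {x : EuclideanSpace ℝ (Fin B)} : x ∈ sumZero B ↔ ∑ i, x i = 0 := by
  rw [sumZero, Submodule.mem_orthogonal_singleton_iff_inner_right]
  simp [PiLp.inner_apply]

lemma finrank_sumZero (hB : 2 ≤ B) : Module.finrank ℝ (sumZero B) = B - 1 := by
  have : Fact (Module.finrank ℝ (EuclideanSpace ℝ (Fin B)) = (B - 1) + 1) :=
    ⟨by rw [finrank_euclideanSpace_fin]; omega⟩
  refine Submodule.finrank_orthogonal_span_singleton fun h => ?_
  have := congrArg (fun x : EuclideanSpace ℝ (Fin B) => x ⟨0, by omega⟩) h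
  simp at this

lemma starProjection_sumZero (hB : B ≠ 0) (x : EuclideanSpace ℝ (Fin B)) :
    (sumZero B).starProjection x = center x := by
  refine Submodule.eq_starProjection_of_mem_of_inner_eq_zero (mem_sumZero.2 (sum_center hB x))
    fun w hw => ?_
  rw [inner_sub_left, inner_center_left, center_of_sum_eq_zero (mem_sumZero.1 hw), sub_self]

/-- G is the orthogonal projection onto the hyperplane, and a projection is a coisometry. This
places the polar-coordinate results in dimension B - 1. -/
lemma centeredLaw_eq_map_subtype (hB : B ≠ 0) :
    centeredLaw B = (stdGaussian (sumZero B)).map (Subtype.val : sumZero B → EuclideanSpace ℝ (Fin B)) := by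
  rw [← map_stdGaussian_of_norm_adjoint ((sumZero B).orthogonalProjectionOnto) fun t => ?_,
    Measure.map_map (by fun_prop) (by fun_prop), centeredLaw]
  · congr 1
    ext1 x
    rw [← starProjection_sumZero hB]
    rfl
  · rw [Submodule.adjoint_orthogonalProjectionOnto]
    rfl

lemma measurableEmbedding_sumZero :
    MeasurableEmbedding (Subtype.val : sumZero B → EuclideanSpace ℝ (Fin B)) :=
  MeasurableEmbedding.subtype_coe (sumZero B).closed_of_finiteDimensional.measurableSet

lemma nontrivial_sumZero (hB : 2 ≤ B) : Nontrivial (sumZero B) :=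
  Module.nontrivial_of_finrank_pos (R := ℝ) (by rw [finrank_sumZero hB]; omega)

lemma IsHomogeneousOn.integral_centeredLaw {k p : ℝ} {F : EuclideanSpace ℝ (Fin B) → ℝ}
    (hF : IsHomogeneousOn k F) (hB : 2 ≤ B) (h1 : 0 < (B - 1 : ℝ) + k)
    (h2 : 0 < (B - 1 : ℝ) + k + p) :
    radialMoment ((B - 1 : ℝ) + k) * ∫ x, ‖x‖ ^ p * F x ∂(centeredLaw B) =
      radialMoment ((B - 1 : ℝ) + k + p) * ∫ x, F x ∂(centeredLaw B) := by
  have := nontrivial_sumZero hB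
  have hn : ((Module.finrank ℝ (sumZero B) : ℕ) : ℝ) = B - 1 := by
    rw [finrank_sumZero hB]; push_cast [show 1 ≤ B by omega]; ring
  have hF' : IsHomogeneousOn k fun x : sumZero B => F x := fun r hr x => hF r hr x
  have h := hF'.integral_norm_rpow_mul (p := p) (by rwa [hn]) (by rwa [hn])
  rw [hn] at h
  rw [centeredLaw_eq_map_subtype (by omega), measurableEmbedding_sumZero.integral_map,
    measurableEmbedding_sumZero.integral_map]
  exact h

lemma IsHomogeneousOn.integrable_centeredLaw {k p : ℝ} {F : EuclideanSpace ℝ (Fin B) → ℝ}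
    (hF : IsHomogeneousOn k F) (hB : 2 ≤ B) (hi : Integrable F (centeredLaw B))
    (h2 : 0 < (B - 1 : ℝ) + k + p) :
    Integrable (fun x => ‖x‖ ^ p * F x) (centeredLaw B) := by
  have := nontrivial_sumZero hB
  have hn : ((Module.finrank ℝ (sumZero B) : ℕ) : ℝ) = B - 1 := by
    rw [finrank_sumZero hB]; push_cast [show 1 ≤ B by omega]; ring
  have hF' : IsHomogeneousOn k fun x : sumZero B => F x := fun r hr x => hF r hr x
  rw [centeredLaw_eq_map_subtype (by omega), measurableEmbedding_sumZero.integrable_map_iff]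
    at hi ⊢
  exact hF'.integrable_norm_rpow_mul (p := p) hi (by rwa [hn])

lemma ae_sum_eq_zero (hB : B ≠ 0) : ∀ᵐ x ∂(centeredLaw B), ∑ i, x i = 0 := by
  rw [centeredLaw, ae_map_iff (by fun_prop) (measurableSet_eq_fun (by fun_prop) (by fun_prop))]
  exact .of_forall fun x => sum_center hB x

/-- Relabelling the batch. -/
noncomputable def permBatch (σ : Equiv.Perm (Fin B)) :
    EuclideanSpace ℝ (Fin B) ≃ₗᵢ[ℝ] EuclideanSpace ℝ (Fin B) :=
  LinearIsometryEquiv.piLpCongrLeft 2 ℝ ℝ σ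

lemma permBatch_apply (σ : Equiv.Perm (Fin B)) (x : EuclideanSpace ℝ (Fin B)) (i : Fin B) :
    permBatch σ x i = x (σ.symm i) := by
  simp [permBatch, LinearIsometryEquiv.piLpCongrLeft_apply, Equiv.piCongrLeft'_apply]

lemma center_permBatch (σ : Equiv.Perm (Fin B)) (x : EuclideanSpace ℝ (Fin B)) :
    center (permBatch σ x) = permBatch σ (center x) := by
  ext i
  rw [permBatch_apply, center_apply, center_apply, permBatch_apply]
  simp only [permBatch_apply]
  rw [Equiv.sum_comp σ.symm]

lemma map_permBatch_centeredLaw (σ : Equiv.Perm (Fin B)) :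
    (centeredLaw B).map (permBatch σ) = centeredLaw B := by
  conv_rhs => rw [centeredLaw, ← stdGaussian_map (permBatch σ),
    Measure.map_map (by fun_prop) (permBatch σ).continuous.measurable]
  rw [centeredLaw, Measure.map_map (permBatch σ).continuous.measurable (by fun_prop)]
  congr 1
  ext1 x
  exact (center_permBatch σ x).symm

lemma integral_permBatch (σ : Equiv.Perm (Fin B)) (F : EuclideanSpace ℝ (Fin B) → ℝ) :
    ∫ x, F (permBatch σ x) ∂(centeredLaw B) = ∫ x, F x ∂(centeredLaw B) := by
  conv_rhs => rw [← map_permBatch_centeredLaw σ]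
  exact ((permBatch σ).toHomeomorph.measurableEmbedding.integral_map _).symm

/-! ### Reduction of the Gaussian law of a BSB1 covariance -/

/-- A BSB1 matrix acts on sum-zero vectors as the scalar a - b, so both characteristic functions at
t equal exp(-(a-b)‖Gt‖²/2). -/
lemma map_center_gaussianLaw (hB : B ≠ 0) {a b : ℝ}
    (hS : (Matrix.of fun i j : Fin B => if i = j then a else b).PosSemidef) (hab : 0 ≤ a - b) :
    (gaussianLaw (Matrix.of fun i j : Fin B => if i = j then a else b)).map center =
      (centeredLaw B).map (fun x => √(a - b) • x) := by
  have h1 : IsProbabilityMeasure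
      (gaussianLaw (Matrix.of fun i j : Fin B => if i = j then a else b)) := by
    unfold gaussianLaw; infer_instance
  have := Measure.isProbabilityMeasure_map
    (μ := gaussianLaw (Matrix.of fun i j : Fin B => if i = j then a else b)) (f := center)
    (by fun_prop)
  have := Measure.isProbabilityMeasure_map (μ := centeredLaw B) (f := fun x => √(a - b) • x)
    (by fun_prop)
  refine Measure.ext_of_charFun ?_
  ext t
  rw [centeredLaw, Measure.map_map (by fun_prop) (by fun_prop), charFun_apply, charFun_apply,
    integral_map (by fun_prop) (Measurable.aestronglyMeasurable (by fun_prop)),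
    integral_map (by fun_prop) (Measurable.aestronglyMeasurable (by fun_prop))]
  simp only [Function.comp_apply, real_inner_smul_left, inner_center_left]
  rw [← charFun_apply]
  simp only [← real_inner_smul_right]
  rw [← charFun_apply, charFun_stdGaussian, gaussianLaw, charFun_multivariateGaussian hS]
  congr 1
  have e : (center t).ofLp ⬝ᵥ (Matrix.of fun i j : Fin B => if i = j then a else b).mulVec
      (center t).ofLp = (a - b) * ‖center t‖ ^ 2 := by
    have hrow : (Matrix.of fun i j : Fin B => if i = j then a else b).mulVec (center t).ofLp =
        (a - b) • (center t).ofLp := by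
      ext i
      have : ∀ j, (if i = j then a else b) * center t j =
          (if i = j then (a - b) * center t j else 0) + b * center t j := by
        intro j; split_ifs <;> ring
      simp only [Matrix.mulVec, dotProduct, Matrix.of_apply, this, Finset.sum_add_distrib,
        ← Finset.mul_sum, sum_center hB]
      simp
    rw [hrow, dotProduct_smul, EuclideanSpace.real_norm_sq_eq]
    simp [dotProduct, sq]
  rw [e, norm_smul, Real.norm_of_nonneg (Real.sqrt_nonneg _)]
  simp only [inner_zero_right, Complex.ofReal_zero, zero_mul, zero_sub]
  rw [← Complex.ofReal_pow, mul_pow, Real.sq_sqrt hab]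
  push_cast
  ring

end BatchNorm

namespace BatchNorm

/-! ### Calculus of positive-homogeneous functions -/

lemma IsPosHomogeneous.map_zero {α : ℝ} {φ : ℝ → ℝ} (h : IsPosHomogeneous α φ) (hα : 0 < α) :
    φ 0 = 0 := by
  have h2 := h 2 two_pos 0
  rw [mul_zero] at h2
  have : (1 : ℝ) < 2 ^ α := Real.one_lt_rpow one_lt_two hα
  by_contra hne
  have : (2 : ℝ) ^ α = 1 := by
    field_simp at h2
    linarith
  linarith

lemma IsPosHomogeneous.hasDerivAt {α : ℝ} {φ : ℝ → ℝ} (h : IsPosHomogeneous α φ) {x : ℝ}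
    (hx : x ≠ 0) : HasDerivAt φ (α * φ x / x) x := by
  rcases lt_or_gt_of_ne hx with h0 | h0
  · have e : φ =ᶠ[𝓝 x] fun y => φ (-1) * (-y) ^ α := by
      filter_upwards [Iio_mem_nhds h0] with y hy
      have hy' : y < 0 := hy
      rw [h.eq_posPow hy'.ne, posPow_of_nonpos _ hy'.le, posPow_of_pos _ (by linarith)]
      ring
    have d := (((hasDerivAt_id x).neg).rpow_const (p := α)
      (Or.inl (neg_ne_zero.2 hx))).const_mul (φ (-1))
    refine (d.congr_of_eventuallyEq e).congr_deriv ?_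
    rw [e.eq_of_nhds]
    simp only [Pi.neg_apply, id]
    rw [Real.rpow_sub_one (neg_ne_zero.2 hx)]
    field_simp
  · have e : φ =ᶠ[𝓝 x] fun y => φ 1 * y ^ α := by
      filter_upwards [Ioi_mem_nhds h0] with y hy
      have hy' : 0 < y := hy
      rw [h.eq_posPow hy'.ne', posPow_of_nonpos (x := -y) _ (by linarith), posPow_of_pos _ hy']
      ring
    have d := ((hasDerivAt_id x).rpow_const (p := α) (Or.inl hx)).const_mul (φ 1)
    refine (d.congr_of_eventuallyEq e).congr_deriv ?_
    rw [e.eq_of_nhds]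
    simp only [id]
    rw [Real.rpow_sub_one hx]
    field_simp

lemma IsPosHomogeneous.mul_deriv {α : ℝ} {φ : ℝ → ℝ} (h : IsPosHomogeneous α φ) (hα : 0 < α)
    (x : ℝ) : x * deriv φ x = α * φ x := by
  rcases eq_or_ne x 0 with rfl | hx
  · rw [h.map_zero hα]; ring
  · rw [(h.hasDerivAt hx).deriv]; field_simp

/-- The scaling rule for `deriv` of y ↦ φ(ry) requires no differentiability, so the identity also
holds at x = 0. -/
lemma IsPosHomogeneous.derivative {α : ℝ} {φ : ℝ → ℝ} (h : IsPosHomogeneous α φ) :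
    IsPosHomogeneous (α - 1) (deriv φ) := by
  intro r hr x
  have e : (fun y => φ (r * y)) = fun y => r ^ α * φ y := funext fun y => h r hr y
  have h1 := deriv_comp_mul_left r φ x
  rw [e, deriv_const_mul_field, smul_eq_mul] at h1
  rw [Real.rpow_sub_one hr.ne']
  field_simp
  linarith

lemma IsPosHomogeneous.id_mul {α : ℝ} {φ : ℝ → ℝ} (h : IsPosHomogeneous α φ) :
    IsPosHomogeneous (α + 1) (fun x => x * φ x) := by
  intro r hr x
  simp only
  rw [h r hr, Real.rpow_add_one hr.ne']
  ring

lemma IsPosHomogeneous.abs_le {α : ℝ} {φ : ℝ → ℝ} (h : IsPosHomogeneous α φ) (hα : 0 < α)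
    (x : ℝ) : |φ x| ≤ (|φ 1| + |φ (-1)|) * |x| ^ α := by
  rcases lt_trichotomy x 0 with h0 | rfl | h0
  · have := h (-x) (by linarith) (-1)
    rw [mul_neg, mul_one, neg_neg] at this
    rw [this, abs_mul, abs_of_neg h0, abs_of_nonneg (Real.rpow_nonneg (by linarith) _), mul_comm]
    exact mul_le_mul_of_nonneg_right (by linarith [abs_nonneg (φ 1)])
      (Real.rpow_nonneg (by linarith) _)
  · rw [h.map_zero hα]
    simp [hα.ne']
  · have := h x h0 1
    rw [mul_one] at this
    rw [this, abs_mul, abs_of_pos h0, abs_of_nonneg (Real.rpow_nonneg h0.le _), mul_comm]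
    exact mul_le_mul_of_nonneg_right (by linarith [abs_nonneg (φ (-1))])
      (Real.rpow_nonneg h0.le _)

lemma IsPosHomogeneous.deriv_one {α : ℝ} {φ : ℝ → ℝ} (h : IsPosHomogeneous α φ) :
    deriv φ 1 = α * φ 1 := by
  rw [(h.hasDerivAt one_ne_zero).deriv, div_one]

lemma IsPosHomogeneous.deriv_neg_one {α : ℝ} {φ : ℝ → ℝ} (h : IsPosHomogeneous α φ) :
    deriv φ (-1) = -(α * φ (-1)) := by
  rw [(h.hasDerivAt (by norm_num)).deriv, div_neg, div_one]

/-! ### The functions `𝕁_φ` -/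

lemma homJ_const_mul (α m : ℝ) (φ : ℝ → ℝ) (c : ℝ) :
    homJ α (fun x => m * φ x) c = m ^ 2 * homJ α φ c := by
  simp only [homJ]; ring

lemma homJ_one {α : ℝ} (hα : -(1 / 2) < α) (φ : ℝ → ℝ) :
    homJ α φ 1 = φ 1 ^ 2 + φ (-1) ^ 2 := by
  rw [homJ, kernelJ_one, kernelJ_neg_one hα]; ring

variable {α : ℝ} {φ : ℝ → ℝ}

lemma homJ_deriv (hα : α ≠ 0) (c : ℝ) :
    homJ (α - 1) (deriv φ) c =
      α ^ 2 * homJ (α - 1) (fun x => α⁻¹ * deriv φ x) c := by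
  rw [homJ_const_mul]; field_simp

/-- Since φ'(1) = αφ(1) and φ'(-1) = -αφ(-1), the change of sign at -1 matches the sign produced by
the chain rule in 𝕁_α(-c). -/
lemma IsPosHomogeneous.hasDerivAt_homJ (h : IsPosHomogeneous α φ) (hα : 1 / 2 < α) {c : ℝ}
    (h1 : -1 < c) (h2 : c < 1) :
    HasDerivAt (homJ α φ) (1 / (2 * α - 1) * homJ (α - 1) (deriv φ) c) c := by
  have d1 := (hasDerivAt_kernelJ hα h1 h2).const_mul (φ 1 ^ 2 + (-φ (-1)) ^ 2)
  have d2 := ((hasDerivAt_kernelJ (c := -c) hα (by linarith) (by linarith)).comp c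
    (hasDerivAt_neg c)).const_mul (2 * φ 1 * (-φ (-1)))
  refine (d1.sub d2).congr_deriv ?_
  simp only [homJ, h.deriv_one, h.deriv_neg_one]
  ring

/-- The factor 1/(2α-1) is absorbed by c_α = (2α-1)c_(α-1). In probabilistic terms, E[φ'(u)φ'(v)] is
the derivative of E[φ(u)φ(v)] in the correlation. -/
lemma IsPosHomogeneous.cConst_mul_homJ_deriv (h : IsPosHomogeneous α φ) (hα : 1 / 2 < α) {c : ℝ}
    (h1 : -1 < c) (h2 : c < 1) :
    cConst (α - 1) * homJ (α - 1) (deriv φ) c =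
      cConst α * deriv (homJ α φ) c := by
  have := cConst_add_one (by linarith : -(1 / 2) < α - 1)
  rw [sub_add_cancel] at this
  rw [(h.hasDerivAt_homJ hα h1 h2).deriv, this, show 2 * (α - 1) + 1 = 2 * α - 1 by ring]
  rw [mul_comm (2 * α - 1), mul_assoc, ← mul_assoc (2 * α - 1),
    mul_one_div_cancel (by linarith : 2 * α - 1 ≠ 0), one_mul]

lemma IsPosHomogeneous.cConst_mul_homJ_deriv_one (h : IsPosHomogeneous α φ) (hα : 1 / 2 < α) :
    (2 * α - 1) * (cConst (α - 1) * homJ (α - 1) (deriv φ) 1) =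
      α ^ 2 * (cConst α * homJ α φ 1) := by
  have := cConst_add_one (by linarith : -(1 / 2) < α - 1)
  rw [sub_add_cancel] at this
  rw [homJ_one (by linarith), homJ_one (by linarith), h.deriv_one, h.deriv_neg_one, this]
  ring

lemma cConst_mul_homJ_id_mul_one (hα : 1 / 2 < α) :
    cConst (α + 1) * homJ (α + 1) (fun x => x * φ x) 1 =
      (2 * α + 1) * (cConst α * homJ α φ 1) := by
  rw [homJ_one (by linarith), homJ_one (by linarith), cConst_add_one (by linarith)]
  ring

lemma IsPosHomogeneous.cConst_mul_homJ_id_mul (h : IsPosHomogeneous α φ) (hα : 1 / 2 < α) {c : ℝ}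
    (h1 : -1 < c) (h2 : c < 1) :
    cConst (α + 1) * homJ (α + 1) (fun x => x * φ x) c =
      (2 * α + 1) * c * (cConst α * homJ α φ c) +
        (1 - c ^ 2) * (cConst α * deriv (homJ α φ) c) := by
  rw [← h.cConst_mul_homJ_deriv hα h1 h2]
  simp only [homJ, h.deriv_one, h.deriv_neg_one]
  have e1 := cConst_mul_kernelJ_add_one hα h1 h2
  have e2 := cConst_mul_kernelJ_add_one (c := -c) hα (by linarith) (by linarith)
  linear_combination (φ 1 ^ 2 + φ (-1) ^ 2) * e1 - 2 * φ 1 * φ (-1) * e2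

end BatchNorm

namespace BatchNorm

/-! ### Second moments under the centred law -/

variable {B : ℕ}

/-- The variance `(B - 1) / B` of a coordinate of a centred standard Gaussian. -/
noncomputable def coordVar (B : ℕ) : ℝ := ((B : ℝ) - 1) / B

/-- The correlation `-1 / (B - 1)` of two coordinates of a centred standard Gaussian. -/
noncomputable def coordCorr (B : ℕ) : ℝ := -1 / ((B : ℝ) - 1)

lemma coordVar_pos (hB : 2 ≤ B) : 0 < coordVar B := by
  have : (2 : ℝ) ≤ B := by exact_mod_cast hB
  exact div_pos (by linarith) (by linarith)

lemma neg_one_lt_coordCorr (hB : 3 ≤ B) : -1 < coordCorr B := by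
  have : (3 : ℝ) ≤ B := by exact_mod_cast hB
  rw [coordCorr, lt_div_iff₀ (by linarith)]
  linarith

lemma coordCorr_neg (hB : 2 ≤ B) : coordCorr B < 0 := by
  have : (2 : ℝ) ≤ B := by exact_mod_cast hB
  exact div_neg_of_neg_of_pos (by norm_num) (by linarith)

lemma coordCorr_sq_lt_one (hB : 3 ≤ B) : coordCorr B ^ 2 < 1 := by
  nlinarith [neg_one_lt_coordCorr hB, coordCorr_neg (by omega : 2 ≤ B)]

/-- The unit vector along `G eᵢ`. -/
noncomputable def coordDir (i : Fin B) : EuclideanSpace ℝ (Fin B) :=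
  (√(coordVar B))⁻¹ • center (EuclideanSpace.single i 1)

lemma inner_center_single (i : Fin B) (x : EuclideanSpace ℝ (Fin B)) :
    inner ℝ (center (EuclideanSpace.single i 1)) x = center x i := by
  rw [inner_center_left, EuclideanSpace.inner_single_left]
  simp

lemma center_eq_inner_coordDir (hB : 2 ≤ B) (i : Fin B) (x : EuclideanSpace ℝ (Fin B)) :
    center x i = √(coordVar B) * inner ℝ (coordDir i) x := by
  have h := (Real.sqrt_pos.2 (coordVar_pos hB)).ne'
  rw [coordDir, real_inner_smul_left, inner_center_single]
  field_simp

lemma inner_coordDir (hB : 2 ≤ B) (i j : Fin B) :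
    inner ℝ (coordDir i) (coordDir j) = if i = j then 1 else coordCorr B := by
  have hB' : (2 : ℝ) ≤ B := by exact_mod_cast hB
  have h := Real.mul_self_sqrt (coordVar_pos hB).le
  have h0 := (Real.sqrt_pos.2 (coordVar_pos hB)).ne'
  have e : inner ℝ (coordDir i) (coordDir j) =
      (coordVar B)⁻¹ * center (EuclideanSpace.single j 1) i := by
    rw [coordDir, coordDir, real_inner_smul_left, real_inner_smul_right, inner_center_left,
      EuclideanSpace.inner_single_left, center_of_sum_eq_zero (sum_center (by omega) _), ← h]
    simp
    ring
  have hB1 : (B : ℝ) - 1 ≠ 0 := by linarith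
  rw [e, center_apply]
  simp only [coordVar, coordCorr, PiLp.single_apply, Finset.sum_ite_eq', Finset.mem_univ, if_true]
  split_ifs with hij <;> field_simp
  ring

lemma norm_coordDir (hB : 2 ≤ B) (i : Fin B) : ‖coordDir i‖ = 1 := by
  have h := inner_coordDir hB i i
  rw [if_pos rfl, real_inner_self_eq_norm_sq] at h
  nlinarith [norm_nonneg (coordDir i)]

lemma ae_coord_ne_zero (hB : 2 ≤ B) : ∀ᵐ x ∂(centeredLaw B), ∀ i, x i ≠ 0 := by
  rw [ae_all_iff]
  intro i
  refine (ae_map_iff (p := fun x : EuclideanSpace ℝ (Fin B) => x i ≠ 0) (by fun_prop)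
    (measurableSet_eq_fun (by fun_prop) (by fun_prop)).compl).2 ?_
  filter_upwards [ae_inner_ne_zero (norm_ne_zero_iff.1 (by
    rw [norm_coordDir hB i]; exact one_ne_zero))] with x hx
  rw [center_eq_inner_coordDir hB]
  exact mul_ne_zero (Real.sqrt_pos.2 (coordVar_pos hB)).ne' hx

lemma ae_coord_ne_coord : ∀ᵐ x ∂(centeredLaw B), ∀ i j, i ≠ j → x i ≠ x j := by
  simp_rw [ae_all_iff]
  intro i j hij
  refine (ae_map_iff (p := fun x : EuclideanSpace ℝ (Fin B) => x i ≠ x j) (by fun_prop)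
    (measurableSet_eq_fun (by fun_prop) (by fun_prop)).compl).2 ?_
  have hne : (EuclideanSpace.single i 1 - EuclideanSpace.single j 1 : EuclideanSpace ℝ (Fin B)) ≠ 0
      := by
    intro h
    have := congrArg (fun x : EuclideanSpace ℝ (Fin B) => x i) h
    simp [hij] at this
  filter_upwards [ae_inner_ne_zero hne] with x hx hc
  rw [inner_sub_left, EuclideanSpace.inner_single_left, EuclideanSpace.inner_single_left] at hx
  rw [center_apply, center_apply] at hc
  simp at hx
  exact hx (by linarith)

variable {β : ℝ} {ψ : ℝ → ℝ}

lemma IsPosHomogeneous.integrable_sq_coord (h : IsPosHomogeneous β ψ) (hβ : -(1 / 2) < β)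
    (hB : 2 ≤ B) (i : Fin B) : Integrable (fun g => ψ (g i) ^ 2) (centeredLaw B) := by
  have hm := h.measurable
  rw [centeredLaw, integrable_map_measure (Measurable.aestronglyMeasurable (by fun_prop))
    (by fun_prop)]
  refine ((h.integrable_sq hβ (norm_coordDir hB i)).const_mul
    ((√(coordVar B) ^ β) ^ 2)).congr (.of_forall fun x => ?_)
  simp only [Function.comp_apply]
  rw [center_eq_inner_coordDir hB, h _ (Real.sqrt_pos.2 (coordVar_pos hB))]
  ring

lemma sqrt_coordVar_rpow_sq (hB : 2 ≤ B) (β : ℝ) : (√(coordVar B) ^ β) ^ 2 = coordVar B ^ β := by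
  rw [← Real.rpow_mul_natCast (Real.sqrt_nonneg _), mul_comm, Real.rpow_mul (Real.sqrt_nonneg _)]
  norm_num [Real.sq_sqrt (coordVar_pos hB).le]

lemma IsPosHomogeneous.integral_sq_coord (h : IsPosHomogeneous β ψ) (hβ : -(1 / 2) < β)
    (hB : 2 ≤ B) (i : Fin B) : ∫ g, ψ (g i) ^ 2 ∂(centeredLaw B) =
      coordVar B ^ β * (cConst β * homJ β ψ 1) := by
  have hm := h.measurable
  rw [centeredLaw, integral_map (by fun_prop) (Measurable.aestronglyMeasurable (by fun_prop)),
    ← h.integral_sq hβ (norm_coordDir hB i), ← integral_const_mul, ← sqrt_coordVar_rpow_sq hB]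
  refine integral_congr_ae (.of_forall fun x => ?_)
  simp only
  rw [center_eq_inner_coordDir hB, h _ (Real.sqrt_pos.2 (coordVar_pos hB))]
  ring

lemma IsPosHomogeneous.integral_mul_coord (h : IsPosHomogeneous β ψ) (hβ : -(1 / 2) < β)
    (hB : 3 ≤ B) {k l : Fin B} (hkl : k ≠ l) : ∫ g, ψ (g k) * ψ (g l) ∂(centeredLaw B) =
      coordVar B ^ β * (cConst β * homJ β ψ (coordCorr B)) := by
  have hm := h.measurable
  have hB2 : 2 ≤ B := by omega
  rw [centeredLaw, integral_map (by fun_prop) (Measurable.aestronglyMeasurable (by fun_prop)),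
    ← h.integral_mul hβ (norm_coordDir hB2 k) (norm_coordDir hB2 l)
    ((inner_coordDir hB2 k l).trans (if_neg hkl)) (coordCorr_sq_lt_one hB), ← integral_const_mul,
    ← sqrt_coordVar_rpow_sq hB2]
  refine integral_congr_ae (.of_forall fun x => ?_)
  simp only
  rw [center_eq_inner_coordDir hB2, center_eq_inner_coordDir hB2,
    h _ (Real.sqrt_pos.2 (coordVar_pos hB2)), h _ (Real.sqrt_pos.2 (coordVar_pos hB2))]
  ring

/-- `integral_quadratic_mul` for coordinates of standard deviation √((B-1)/B): the factors √^m agree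
on both sides, and the quadratic form contributes the variance. -/
lemma integral_quadratic_mul_coord (hB : 3 ≤ B) {k l : Fin B} (hkl : k ≠ l) {F : ℝ × ℝ → ℝ}
    (hF : Measurable F) {m : ℝ} (hm : -2 < m)
    (hom : ∀ r : ℝ, 0 < r → ∀ p, F (r • p) = r ^ m * F p) :
    ∫ g, (g k ^ 2 - 2 * coordCorr B * (g k * g l) + g l ^ 2) * F (g k, g l) ∂(centeredLaw B) =
      coordVar B * (1 - coordCorr B ^ 2) * (m + 2) * ∫ g, F (g k, g l) ∂(centeredLaw B) := by
  have hB2 : 2 ≤ B := by omega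
  have hs := Real.sqrt_pos.2 (coordVar_pos hB2)
  have key := integral_quadratic_mul (norm_coordDir hB2 k) (norm_coordDir hB2 l)
    ((inner_coordDir hB2 k l).trans (if_neg hkl)) (coordCorr_sq_lt_one hB) hF hm hom
  have e : ∀ x : EuclideanSpace ℝ (Fin B), F (center x k, center x l) = √(coordVar B) ^ m *
      F (inner ℝ (coordDir k) x, inner ℝ (coordDir l) x) := by
    intro x
    rw [← hom _ hs, center_eq_inner_coordDir hB2, center_eq_inner_coordDir hB2]
    rfl
  rw [centeredLaw, integral_map (by fun_prop) (Measurable.aestronglyMeasurable (by fun_prop)),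
    integral_map (by fun_prop) (Measurable.aestronglyMeasurable (by fun_prop))]
  simp_rw [e]
  rw [integral_const_mul]
  have e2 : ∀ x : EuclideanSpace ℝ (Fin B), (center x k ^ 2 -
      2 * coordCorr B * (center x k * center x l) + center x l ^ 2) * (√(coordVar B) ^ m *
      F (inner ℝ (coordDir k) x, inner ℝ (coordDir l) x)) = coordVar B * √(coordVar B) ^ m *
      ((inner ℝ (coordDir k) x ^ 2 - 2 * coordCorr B * (inner ℝ (coordDir k) x *
        inner ℝ (coordDir l) x) + inner ℝ (coordDir l) x ^ 2) *
        F (inner ℝ (coordDir k) x, inner ℝ (coordDir l) x)) := by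
    intro x
    have hsq := Real.sq_sqrt (coordVar_pos hB2).le
    conv_rhs => rw [← hsq]
    rw [Real.sqrt_sq hs.le, center_eq_inner_coordDir hB2, center_eq_inner_coordDir hB2]
    ring
  simp_rw [e2]
  rw [integral_const_mul, key]
  ring

end BatchNorm

namespace BatchNorm

/-! ### Mixed moments of `φ`, `φ'` and coordinates -/

variable {B : ℕ} {α : ℝ} {φ : ℝ → ℝ}

/-- `E[φ(g_k) φ(g_l)]` for the centred law. -/
noncomputable def moment (φ : ℝ → ℝ) (k l : Fin B) : ℝ :=
  ∫ g, φ (g k) * φ (g l) ∂(centeredLaw B)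

/-- `E[φ(g_k) φ'(g_l) g_j]` for the centred law. -/
noncomputable def momentFD (φ : ℝ → ℝ) (k l j : Fin B) : ℝ :=
  ∫ g, φ (g k) * deriv φ (g l) * g j ∂(centeredLaw B)

/-- `E[φ(g_k) φ(g_l) g_i g_j]` for the centred law. -/
noncomputable def momentFF (φ : ℝ → ℝ) (k l i j : Fin B) : ℝ :=
  ∫ g, φ (g k) * φ (g l) * (g i * g j) ∂(centeredLaw B)

lemma IsPosHomogeneous.integrable_mul_coord {β : ℝ} {ψ : ℝ → ℝ} (h : IsPosHomogeneous β ψ)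
    (hβ : -(1 / 2) < β) (hB : 2 ≤ B) (k l : Fin B) :
    Integrable (fun g => ψ (g k) * ψ (g l)) (centeredLaw B) := by
  have hm := h.measurable
  refine ((h.integrable_sq_coord hβ hB k).add (h.integrable_sq_coord hβ hB l)).mono'
    (Measurable.aestronglyMeasurable (by fun_prop)) (.of_forall fun g => ?_)
  simp only [Pi.add_apply]
  rw [Real.norm_eq_abs, abs_mul, ← sq_abs (ψ (g k)), ← sq_abs (ψ (g l))]
  nlinarith [sq_nonneg (|ψ (g k)| - |ψ (g l)|), sq_nonneg (|ψ (g k)|), sq_nonneg (|ψ (g l)|)]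

lemma abs_coord_le_norm (g : EuclideanSpace ℝ (Fin B)) (i : Fin B) : |g i| ≤ ‖g‖ :=
  PiLp.norm_apply_le g i

lemma IsPosHomogeneous.abs_coord_le (h : IsPosHomogeneous α φ) (hα : 0 < α)
    (g : EuclideanSpace ℝ (Fin B)) (i : Fin B) :
    |φ (g i)| ≤ (|φ 1| + |φ (-1)|) * ‖g‖ ^ α := by
  refine (h.abs_le hα _).trans ?_
  have := abs_coord_le_norm g i
  gcongr

/-- For α < 1 the derivative may be unbounded near 0 and only its square integrability is available.
The other two factors are bounded by powers of the norm, so the product is dominated by a multiple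
of ‖g‖^(α+1)|φ'(g_l)|. -/
lemma IsPosHomogeneous.integrable_FD (h : IsPosHomogeneous α φ) (hα : 1 / 2 < α) (hB : 4 ≤ B)
    (k l j : Fin B) :
    Integrable (fun g => φ (g k) * deriv φ (g l) * g j) (centeredLaw B) := by
  have hm := h.measurable
  have hB' : (4 : ℝ) ≤ B := by exact_mod_cast hB
  have hint : Integrable (fun g => |deriv φ (g l)|) (centeredLaw B) := by
    refine ((integrable_const (1 : ℝ)).add
      (h.derivative.integrable_sq_coord (by linarith) (by omega) l)).mono'
      (Measurable.aestronglyMeasurable (by fun_prop)) (.of_forall fun g => ?_)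
    simp only [Pi.add_apply, Real.norm_eq_abs, abs_abs]
    nlinarith [sq_nonneg (|deriv φ (g l)| - 1), sq_abs (deriv φ (g l))]
  have hhom : IsHomogeneousOn (α - 1) (fun g : EuclideanSpace ℝ (Fin B) => |deriv φ (g l)|) := by
    intro r hr g
    simp only [PiLp.smul_apply, smul_eq_mul]
    rw [h.derivative r hr, abs_mul, abs_of_pos (Real.rpow_pos_of_pos hr _)]
  have h1 := hhom.integrable_centeredLaw (p := α + 1) (by omega) hint (by linarith)
  refine (h1.const_mul (|φ 1| + |φ (-1)|)).mono' (Measurable.aestronglyMeasurable (by fun_prop))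
    (.of_forall fun g => ?_)
  rw [Real.norm_eq_abs, abs_mul, abs_mul, Real.rpow_add_one' (norm_nonneg _) (by linarith)]
  have e1 := h.abs_coord_le (by linarith) g k
  have e2 := abs_coord_le_norm g j
  calc |φ (g k)| * |deriv φ (g l)| * |g j|
      ≤ ((|φ 1| + |φ (-1)|) * ‖g‖ ^ α) * |deriv φ (g l)| * ‖g‖ := by gcongr
    _ = _ := by ring

lemma IsPosHomogeneous.integrable_FF (h : IsPosHomogeneous α φ) (hα : 1 / 2 < α) (hB : 4 ≤ B)
    (k l i j : Fin B) :
    Integrable (fun g => φ (g k) * φ (g l) * (g i * g j)) (centeredLaw B) := by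
  have hm := h.measurable
  have hB' : (4 : ℝ) ≤ B := by exact_mod_cast hB
  have hhom : IsHomogeneousOn 0 (fun _ : EuclideanSpace ℝ (Fin B) => (1 : ℝ)) := by
    intro r hr g
    simp
  have h1 := hhom.integrable_centeredLaw (p := α + α + 1 + 1) (by omega) (integrable_const _)
    (by linarith)
  refine (h1.const_mul ((|φ 1| + |φ (-1)|) ^ 2)).mono'
    (Measurable.aestronglyMeasurable (by fun_prop)) (.of_forall fun g => ?_)
  rw [Real.norm_eq_abs, abs_mul, abs_mul, abs_mul,
    Real.rpow_add_one' (norm_nonneg _) (by linarith),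
    Real.rpow_add_one' (norm_nonneg _) (by linarith),
    Real.rpow_add' (norm_nonneg _) (by linarith)]
  have e1 := h.abs_coord_le (by linarith) g k
  have e2 := h.abs_coord_le (by linarith) g l
  have e3 := abs_coord_le_norm g i
  have e4 := abs_coord_le_norm g j
  calc |φ (g k)| * |φ (g l)| * (|g i| * |g j|)
      ≤ ((|φ 1| + |φ (-1)|) * ‖g‖ ^ α) * ((|φ 1| + |φ (-1)|) * ‖g‖ ^ α) * (‖g‖ * ‖g‖) := by
        gcongr
    _ = _ := by ring

/-! Homogeneity of the integrands. -/

lemma IsPosHomogeneous.homogeneous_mul {β : ℝ} {ψ : ℝ → ℝ} (h : IsPosHomogeneous β ψ)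
    (k l : Fin B) :
    IsHomogeneousOn (2 * β) (fun g : EuclideanSpace ℝ (Fin B) => ψ (g k) * ψ (g l)) := by
  intro r hr g
  simp only [PiLp.smul_apply, smul_eq_mul]
  rw [h r hr, h r hr, two_mul, Real.rpow_add hr]
  ring

lemma IsPosHomogeneous.homogeneous_FD (h : IsPosHomogeneous α φ) (k l j : Fin B) :
    IsHomogeneousOn (2 * α)
      (fun g : EuclideanSpace ℝ (Fin B) => φ (g k) * deriv φ (g l) * g j) := by
  intro r hr g
  simp only [PiLp.smul_apply, smul_eq_mul]
  rw [h r hr, h.derivative r hr, two_mul, Real.rpow_add hr, Real.rpow_sub_one hr.ne']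
  field_simp

lemma IsPosHomogeneous.homogeneous_FF (h : IsPosHomogeneous α φ) (k l i j : Fin B) :
    IsHomogeneousOn (2 * α + 2)
      (fun g : EuclideanSpace ℝ (Fin B) => φ (g k) * φ (g l) * (g i * g j)) := by
  intro r hr g
  simp only [PiLp.smul_apply, smul_eq_mul]
  rw [h r hr, h r hr, two_mul, Real.rpow_add hr, Real.rpow_add hr, Real.rpow_two]
  ring

/-! Linear relations between the moments. -/

lemma IsPosHomogeneous.sum_momentFD (h : IsPosHomogeneous α φ) (hα : 1 / 2 < α) (hB : 4 ≤ B)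
    (k l : Fin B) : ∑ j, momentFD φ k l j = 0 := by
  unfold momentFD
  rw [← integral_finsetSum _ fun j _ => h.integrable_FD hα hB k l j]
  refine integral_eq_zero_of_ae ?_
  filter_upwards [ae_sum_eq_zero (by omega : B ≠ 0)] with g hg
  rw [← Finset.mul_sum, hg, mul_zero]
  rfl

lemma IsPosHomogeneous.sum_momentFF (h : IsPosHomogeneous α φ) (hα : 1 / 2 < α) (hB : 4 ≤ B)
    (k l i : Fin B) : ∑ j, momentFF φ k l i j = 0 := by
  unfold momentFF
  rw [← integral_finsetSum _ fun j _ => h.integrable_FF hα hB k l i j]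
  refine integral_eq_zero_of_ae ?_
  filter_upwards [ae_sum_eq_zero (by omega : B ≠ 0)] with g hg
  rw [← Finset.mul_sum, ← Finset.mul_sum, hg, mul_zero, mul_zero]
  rfl

/-- Σ g_j² = ‖g‖² weights a function of degree 2α in dimension B - 1, so the radial moment rises by
two. -/
lemma IsPosHomogeneous.sum_momentFF_diag (h : IsPosHomogeneous α φ) (hα : 1 / 2 < α)
    (hB : 4 ≤ B) (k l : Fin B) :
    ∑ j, momentFF φ k l j j = ((B - 1 : ℝ) + 2 * α) * moment φ k l := by
  have hB' : (4 : ℝ) ≤ B := by exact_mod_cast hB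
  unfold momentFF moment
  rw [← integral_finsetSum _ fun j _ => h.integrable_FF hα hB k l j j]
  have h1 := (h.homogeneous_mul k l).integral_centeredLaw (p := 2) (by omega) (by linarith)
    (by linarith)
  rw [radialMoment_add_two (by linarith), mul_assoc, mul_left_comm] at h1
  have h2 := mul_left_cancel₀ (radialMoment_pos (by linarith : 0 < (B - 1 : ℝ) + 2 * α)).ne' h1
  rw [← h2]
  refine integral_congr_ae (.of_forall fun g => ?_)
  simp only
  rw [← Finset.mul_sum, Real.rpow_two, EuclideanSpace.real_norm_sq_eq, mul_comm]
  simp [sq]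

lemma momentFD_perm (σ : Equiv.Perm (Fin B)) (k l j : Fin B) :
    momentFD φ (σ k) (σ l) (σ j) = momentFD φ k l j := by
  unfold momentFD
  rw [← integral_permBatch σ]
  simp [permBatch_apply]

lemma momentFF_perm (σ : Equiv.Perm (Fin B)) (k l i j : Fin B) :
    momentFF φ (σ k) (σ l) (σ i) (σ j) = momentFF φ k l i j := by
  unfold momentFF
  rw [← integral_permBatch σ]
  simp [permBatch_apply]

lemma momentFF_comm (k l i j : Fin B) : momentFF φ k l i j = momentFF φ k l j i := by
  unfold momentFF
  simp_rw [mul_comm]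

lemma momentFF_comm' (k l i j : Fin B) : momentFF φ k l i j = momentFF φ l k i j := by
  unfold momentFF
  simp_rw [mul_comm (φ _) (φ _)]

/-- A function on `Fin B` that is constant off a finite set. -/
lemma sum_eq_of_const_off (s : Finset (Fin B)) (v : Fin B → ℝ) (q : ℝ)
    (hv : ∀ j, j ∉ s → v j = q) : ∑ j, v j = ∑ j ∈ s, v j + ((B : ℝ) - s.card) * q := by
  rw [← Finset.sum_add_sum_compl s, Finset.sum_congr rfl fun j hj => hv j (Finset.mem_compl.1 hj),
    Finset.sum_const, Finset.card_compl, Fintype.card_fin, nsmul_eq_mul, Nat.cast_sub]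
  simpa using Finset.card_le_univ s

lemma momentFD_eq_of_notMem {k l i j : Fin B} (hik : i ≠ k) (hil : i ≠ l) (hjk : j ≠ k)
    (hjl : j ≠ l) : momentFD φ k l j = momentFD φ k l i := by
  rw [← momentFD_perm (Equiv.swap i j) k l i, Equiv.swap_apply_left,
    Equiv.swap_apply_of_ne_of_ne hik.symm hjk.symm, Equiv.swap_apply_of_ne_of_ne hil.symm hjl.symm]

lemma momentFF_eq_of_notMem {k l m i j : Fin B} (hik : i ≠ k) (hil : i ≠ l) (hjk : j ≠ k)
    (hjl : j ≠ l) (him : i ≠ m) (hjm : j ≠ m) : momentFF φ k l m j = momentFF φ k l m i := by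
  rw [← momentFF_perm (Equiv.swap i j) k l m i, Equiv.swap_apply_left,
    Equiv.swap_apply_of_ne_of_ne hik.symm hjk.symm, Equiv.swap_apply_of_ne_of_ne hil.symm hjl.symm,
    Equiv.swap_apply_of_ne_of_ne him.symm hjm.symm]

lemma momentFF_diag_eq_of_notMem {k l i j : Fin B} (hik : i ≠ k) (hil : i ≠ l) (hjk : j ≠ k)
    (hjl : j ≠ l) : momentFF φ k l j j = momentFF φ k l i i := by
  rw [← momentFF_perm (Equiv.swap i j) k l i i, Equiv.swap_apply_left,
    Equiv.swap_apply_of_ne_of_ne hik.symm hjk.symm, Equiv.swap_apply_of_ne_of_ne hil.symm hjl.symm]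

end BatchNorm

namespace BatchNorm

/-! ### Values of the mixed moments -/

variable {B : ℕ} {α : ℝ} {φ : ℝ → ℝ}

/-- The common factor of all second-order moments. -/
noncomputable def momentScale (B : ℕ) (α : ℝ) : ℝ := coordVar B ^ α * cConst α

lemma momentScale_pos (hα : 1 / 2 < α) (hB : 4 ≤ B) : 0 < momentScale B α :=
  mul_pos (Real.rpow_pos_of_pos (coordVar_pos (by omega)) _) (cConst_pos (by linarith))

lemma IsPosHomogeneous.moment_self (h : IsPosHomogeneous α φ) (hα : 1 / 2 < α) (hB : 4 ≤ B)
    (k : Fin B) : moment φ k k = momentScale B α * homJ α φ 1 := by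
  have := h.integral_sq_coord (by linarith) (by omega) k
  rw [moment, momentScale, mul_assoc, ← this]
  simp_rw [sq]

lemma IsPosHomogeneous.moment_of_ne (h : IsPosHomogeneous α φ) (hα : 1 / 2 < α) (hB : 4 ≤ B)
    {k l : Fin B} (hkl : k ≠ l) :
    moment φ k l = momentScale B α * homJ α φ (coordCorr B) := by
  rw [moment, momentScale, mul_assoc, h.integral_mul_coord (by linarith) (by omega) hkl]

lemma IsPosHomogeneous.moment_deriv_self (h : IsPosHomogeneous α φ) (hα : 1 / 2 < α) (hB : 4 ≤ B)
    (k : Fin B) : moment (deriv φ) k k =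
      momentScale B α * (α ^ 2 * homJ α φ 1) / ((2 * α - 1) * coordVar B) := by
  have hv := coordVar_pos (by omega : 2 ≤ B)
  have h2 : 0 < 2 * α - 1 := by linarith
  have h1 := h.derivative.integral_sq_coord (by linarith) (by omega) k
  have e : moment (deriv φ) k k = ∫ g, deriv φ (g k) ^ 2 ∂(centeredLaw B) := by
    rw [moment]; simp_rw [sq]
  have h3 := h.cConst_mul_homJ_deriv_one hα
  rw [e, h1, eq_div_iff (by positivity), Real.rpow_sub_one hv.ne', momentScale,
    div_mul_eq_mul_div, div_mul_eq_mul_div, div_eq_iff hv.ne']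
  linear_combination coordVar B ^ α * coordVar B * h3

lemma IsPosHomogeneous.moment_deriv_of_ne (h : IsPosHomogeneous α φ) (hα : 1 / 2 < α)
    (hB : 4 ≤ B) {k l : Fin B} (hkl : k ≠ l) : moment (deriv φ) k l =
      momentScale B α * deriv (homJ α φ) (coordCorr B) / coordVar B := by
  have hv := coordVar_pos (by omega : 2 ≤ B)
  rw [moment, h.derivative.integral_mul_coord (by linarith) (by omega) hkl,
    h.cConst_mul_homJ_deriv hα (neg_one_lt_coordCorr (by omega))
      ((coordCorr_neg (by omega)).trans one_pos), Real.rpow_sub_one hv.ne', momentScale]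
  ring

lemma IsPosHomogeneous.momentFD_right (h : IsPosHomogeneous α φ) (hα : 1 / 2 < α)
    (k l : Fin B) : momentFD φ k l l = α * moment φ k l := by
  rw [momentFD, moment, ← integral_const_mul]
  refine integral_congr_ae (.of_forall fun g => ?_)
  simp only
  linear_combination φ (g k) * h.mul_deriv (by linarith) (g l)

lemma momentFD_swap (k l : Fin B) : momentFD φ k l k = momentFD φ l k l := by
  have := momentFD_perm (φ := φ) (Equiv.swap k l) k l k
  rwa [Equiv.swap_apply_left, Equiv.swap_apply_right, eq_comm] at this

lemma momentFF_swap (k l : Fin B) : momentFF φ k l k k = momentFF φ k l l l := by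
  have := momentFF_perm (φ := φ) (Equiv.swap k l) k l k k
  rw [Equiv.swap_apply_left, Equiv.swap_apply_right] at this
  rw [← this, momentFF_comm']

/-- Apply the quadratic form to φ'(g_k)φ'(g_l). Euler's identity xφ'(x) = αφ(x) turns the square
terms into α times the wanted moment, twice by exchangeability, and the cross term into E[φφ]. -/
lemma IsPosHomogeneous.momentFD_left (h : IsPosHomogeneous α φ) (hα : 1 / 2 < α)
    (hB : 4 ≤ B) {k l : Fin B} (hkl : k ≠ l) : momentFD φ k l k = momentScale B α *
      (coordCorr B * α * homJ α φ (coordCorr B) +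
        (1 - coordCorr B ^ 2) * deriv (homJ α φ) (coordCorr B)) := by
  have hv := coordVar_pos (by omega : 2 ≤ B)
  have hα0 : α ≠ 0 := by linarith
  have key := integral_quadratic_mul_coord (by omega : 3 ≤ B) hkl
    (F := fun p => deriv φ p.1 * deriv φ p.2) (m := 2 * (α - 1)) (by fun_prop) (by linarith)
    (fun r hr p => by
      simp only [Prod.smul_fst, Prod.smul_snd, smul_eq_mul]
      rw [h.derivative r hr, h.derivative r hr, two_mul, Real.rpow_add hr]
      ring)
  have e : ∀ g : EuclideanSpace ℝ (Fin B),
      (g k ^ 2 - 2 * coordCorr B * (g k * g l) + g l ^ 2) * (deriv φ (g k) * deriv φ (g l)) =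
      α * (φ (g k) * deriv φ (g l) * g k) - 2 * coordCorr B * α ^ 2 * (φ (g k) * φ (g l)) +
      α * (φ (g l) * deriv φ (g k) * g l) := by
    intro g
    have e1 := h.mul_deriv (by linarith) (g k)
    have e2 := h.mul_deriv (by linarith) (g l)
    linear_combination (g k * deriv φ (g l) - 2 * coordCorr B * (g l * deriv φ (g l))) * e1 +
      (g l * deriv φ (g k) - 2 * coordCorr B * α * φ (g k)) * e2
  simp only at key
  simp_rw [e] at key
  have i1 := (h.integrable_FD hα hB k l k).const_mul α
  have i2 := (h.integrable_mul_coord (by linarith) (by omega) k l).const_mul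
    (2 * coordCorr B * α ^ 2)
  have i3 := (h.integrable_FD hα hB l k l).const_mul α
  have i12 : Integrable (fun g => α * (φ (g k) * deriv φ (g l) * g k) -
      2 * coordCorr B * α ^ 2 * (φ (g k) * φ (g l))) (centeredLaw B) := i1.sub i2
  rw [integral_add i12 i3, integral_sub i1 i2, integral_const_mul, integral_const_mul,
    integral_const_mul] at key
  change α * momentFD φ k l k - 2 * coordCorr B * α ^ 2 * moment φ k l + α * momentFD φ l k l =
    coordVar B * (1 - coordCorr B ^ 2) * (2 * (α - 1) + 2) * moment (deriv φ) k l at key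
  rw [← momentFD_swap k l, h.moment_of_ne hα hB hkl, h.moment_deriv_of_ne hα hB hkl] at key
  field_simp at key
  refine mul_left_cancel₀ hα0 ?_
  linear_combination key / 2

/-- The integrand is ψ(g_k)ψ(g_l) for ψ(x) = xφ(x), which is homogeneous of degree α + 1. -/
lemma IsPosHomogeneous.momentFF_cross (h : IsPosHomogeneous α φ) (hα : 1 / 2 < α)
    (hB : 4 ≤ B) {k l : Fin B} (hkl : k ≠ l) : momentFF φ k l k l = momentScale B α *
      (coordVar B * ((2 * α + 1) * coordCorr B * homJ α φ (coordCorr B) +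
        (1 - coordCorr B ^ 2) * deriv (homJ α φ) (coordCorr B))) := by
  have hv := coordVar_pos (by omega : 2 ≤ B)
  have h1 := h.id_mul.integral_mul_coord (by linarith) (by omega) hkl
  rw [h.cConst_mul_homJ_id_mul hα (neg_one_lt_coordCorr (by omega))
      ((coordCorr_neg (by omega)).trans one_pos), Real.rpow_add_one hv.ne'] at h1
  rw [momentFF, momentScale]
  refine Eq.trans ?_ (h1.trans (by ring))
  refine integral_congr_ae (.of_forall fun g => ?_)
  simp only
  ring

lemma IsPosHomogeneous.momentFF_self (h : IsPosHomogeneous α φ) (hα : 1 / 2 < α)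
    (hB : 4 ≤ B) (k : Fin B) : momentFF φ k k k k = momentScale B α *
      (coordVar B * ((2 * α + 1) * homJ α φ 1)) := by
  have hv := coordVar_pos (by omega : 2 ≤ B)
  have h1 := h.id_mul.integral_sq_coord (by linarith) (by omega) k
  rw [cConst_mul_homJ_id_mul_one hα, Real.rpow_add_one hv.ne'] at h1
  rw [momentFF, momentScale]
  refine Eq.trans ?_ (h1.trans (by ring))
  refine integral_congr_ae (.of_forall fun g => ?_)
  simp only
  ring

/-- The quadratic form is applied to φ(g_k)φ(g_l). The two square terms agree by symmetry, and the
cross term is `momentFF_cross`. -/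
lemma IsPosHomogeneous.momentFF_left (h : IsPosHomogeneous α φ) (hα : 1 / 2 < α)
    (hB : 4 ≤ B) {k l : Fin B} (hkl : k ≠ l) : momentFF φ k l k k =
      coordCorr B * momentFF φ k l k l +
        coordVar B * (1 - coordCorr B ^ 2) * (1 + α) * moment φ k l := by
  have hm := h.measurable
  have key := integral_quadratic_mul_coord (by omega : 3 ≤ B) hkl
    (F := fun p => φ p.1 * φ p.2) (m := 2 * α) (by fun_prop) (by linarith)
    (fun r hr p => by
      simp only [Prod.smul_fst, Prod.smul_snd, smul_eq_mul]
      rw [h r hr, h r hr, two_mul, Real.rpow_add hr]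
      ring)
  have e : ∀ g : EuclideanSpace ℝ (Fin B),
      (g k ^ 2 - 2 * coordCorr B * (g k * g l) + g l ^ 2) * (φ (g k) * φ (g l)) =
      φ (g k) * φ (g l) * (g k * g k) - 2 * coordCorr B * (φ (g k) * φ (g l) * (g k * g l)) +
      φ (g k) * φ (g l) * (g l * g l) := fun g => by ring
  simp only at key
  simp_rw [e] at key
  have i1 := h.integrable_FF hα hB k l k k
  have i2 := (h.integrable_FF hα hB k l k l).const_mul (2 * coordCorr B)
  have i3 := h.integrable_FF hα hB k l l l
  have i12 : Integrable (fun g => φ (g k) * φ (g l) * (g k * g k) -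
      2 * coordCorr B * (φ (g k) * φ (g l) * (g k * g l))) (centeredLaw B) := i1.sub i2
  rw [integral_add i12 i3, integral_sub i1 i2, integral_const_mul] at key
  change momentFF φ k l k k - 2 * coordCorr B * momentFF φ k l k l + momentFF φ k l l l =
    coordVar B * (1 - coordCorr B ^ 2) * (2 * α + 2) * moment φ k l at key
  rw [← momentFF_swap k l] at key
  linear_combination key / 2

/-! Moments with an index off the arguments, from the linear relations. -/

lemma IsPosHomogeneous.momentFD_other (h : IsPosHomogeneous α φ) (hα : 1 / 2 < α) (hB : 4 ≤ B)
    {k l j : Fin B} (hkl : k ≠ l) (hjk : j ≠ k) (hjl : j ≠ l) :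
    momentFD φ k l j = -(momentFD φ k l k + momentFD φ k l l) / ((B : ℝ) - 2) := by
  have hB' : (4 : ℝ) ≤ B := by exact_mod_cast hB
  have h1 := h.sum_momentFD hα hB k l
  rw [sum_eq_of_const_off {k, l} _ (momentFD φ k l j) fun i hi => ?_] at h1
  · rw [Finset.sum_pair hkl, Finset.card_pair hkl] at h1
    rw [eq_div_iff (by linarith)]
    push_cast at h1
    linarith
  · simp only [Finset.mem_insert, Finset.mem_singleton, not_or] at hi
    exact momentFD_eq_of_notMem hjk hjl hi.1 hi.2

lemma IsPosHomogeneous.momentFD_self_other (h : IsPosHomogeneous α φ) (hα : 1 / 2 < α)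
    (hB : 4 ≤ B) {k j : Fin B} (hjk : j ≠ k) :
    momentFD φ k k j = -momentFD φ k k k / ((B : ℝ) - 1) := by
  have hB' : (4 : ℝ) ≤ B := by exact_mod_cast hB
  have h1 := h.sum_momentFD hα hB k k
  rw [sum_eq_of_const_off {k} _ (momentFD φ k k j) fun i hi => ?_] at h1
  · rw [Finset.sum_singleton, Finset.card_singleton] at h1
    rw [eq_div_iff (by linarith)]
    push_cast at h1
    linarith
  · rw [Finset.mem_singleton] at hi
    exact momentFD_eq_of_notMem hjk hjk hi hi

lemma IsPosHomogeneous.momentFF_left_other (h : IsPosHomogeneous α φ) (hα : 1 / 2 < α)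
    (hB : 4 ≤ B) {k l j : Fin B} (hkl : k ≠ l) (hjk : j ≠ k) (hjl : j ≠ l) :
    momentFF φ k l k j = -(momentFF φ k l k k + momentFF φ k l k l) / ((B : ℝ) - 2) := by
  have hB' : (4 : ℝ) ≤ B := by exact_mod_cast hB
  have h1 := h.sum_momentFF hα hB k l k
  rw [sum_eq_of_const_off {k, l} _ (momentFF φ k l k j) fun i hi => ?_] at h1
  · rw [Finset.sum_pair hkl, Finset.card_pair hkl] at h1
    rw [eq_div_iff (by linarith)]
    push_cast at h1
    linarith
  · simp only [Finset.mem_insert, Finset.mem_singleton, not_or] at hi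
    exact momentFF_eq_of_notMem hjk hjl hi.1 hi.2 hjk hi.1

lemma IsPosHomogeneous.momentFF_right_other (h : IsPosHomogeneous α φ) (hα : 1 / 2 < α)
    (hB : 4 ≤ B) {k l j : Fin B} (hkl : k ≠ l) (hjk : j ≠ k) (hjl : j ≠ l) :
    momentFF φ k l l j = -(momentFF φ k l k k + momentFF φ k l k l) / ((B : ℝ) - 2) := by
  rw [momentFF_comm', h.momentFF_left_other hα hB hkl.symm hjl hjk, momentFF_comm' l k l l,
    momentFF_comm' l k l k, momentFF_comm k l l k, ← momentFF_swap k l]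

lemma IsPosHomogeneous.momentFF_diag_other (h : IsPosHomogeneous α φ) (hα : 1 / 2 < α)
    (hB : 4 ≤ B) {k l j : Fin B} (hkl : k ≠ l) (hjk : j ≠ k) (hjl : j ≠ l) :
    momentFF φ k l j j = (((B : ℝ) - 1 + 2 * α) * moment φ k l - 2 * momentFF φ k l k k) /
      ((B : ℝ) - 2) := by
  have hB' : (4 : ℝ) ≤ B := by exact_mod_cast hB
  have h1 := h.sum_momentFF_diag hα hB k l
  rw [sum_eq_of_const_off {k, l} _ (momentFF φ k l j j) fun i hi => ?_] at h1
  · rw [Finset.sum_pair hkl, Finset.card_pair hkl, ← momentFF_swap k l] at h1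
    rw [eq_div_iff (by linarith)]
    push_cast at h1
    linarith
  · simp only [Finset.mem_insert, Finset.mem_singleton, not_or] at hi
    exact momentFF_diag_eq_of_notMem hjk hjl hi.1 hi.2

/-- In the relation Σ_j E[φ(g_k)φ(g_l)g_i g_j] = 0 the indices i, k, l are special and the remaining
B - 3 terms are equal. -/
lemma IsPosHomogeneous.momentFF_other_other (h : IsPosHomogeneous α φ) (hα : 1 / 2 < α)
    (hB : 4 ≤ B) {k l i j : Fin B} (hkl : k ≠ l) (hik : i ≠ k) (hil : i ≠ l) (hjk : j ≠ k)
    (hjl : j ≠ l) (hij : i ≠ j) :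
    momentFF φ k l i j = -(momentFF φ k l i i + momentFF φ k l k i + momentFF φ k l l i) /
      ((B : ℝ) - 3) := by
  have hB' : (4 : ℝ) ≤ B := by exact_mod_cast hB
  have h1 := h.sum_momentFF hα hB k l i
  rw [sum_eq_of_const_off {i, k, l} _ (momentFF φ k l i j) fun m hm => ?_] at h1
  · rw [Finset.sum_insert (by simp [hik, hil]), Finset.sum_pair hkl,
      Finset.card_insert_of_notMem (by simp [hik, hil]), Finset.card_pair hkl] at h1
    rw [eq_div_iff (by linarith), momentFF_comm k l k i, momentFF_comm k l l i]
    push_cast at h1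
    linarith
  · simp only [Finset.mem_insert, Finset.mem_singleton, not_or] at hm
    exact momentFF_eq_of_notMem hjk hjl hm.2.1 hm.2.2 hij.symm hm.1

lemma IsPosHomogeneous.momentFF_self_other (h : IsPosHomogeneous α φ) (hα : 1 / 2 < α)
    (hB : 4 ≤ B) {k j : Fin B} (hjk : j ≠ k) :
    momentFF φ k k k j = -momentFF φ k k k k / ((B : ℝ) - 1) := by
  have hB' : (4 : ℝ) ≤ B := by exact_mod_cast hB
  have h1 := h.sum_momentFF hα hB k k k
  rw [sum_eq_of_const_off {k} _ (momentFF φ k k k j) fun i hi => ?_] at h1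
  · rw [Finset.sum_singleton, Finset.card_singleton] at h1
    rw [eq_div_iff (by linarith)]
    push_cast at h1
    linarith
  · rw [Finset.mem_singleton] at hi
    exact momentFF_eq_of_notMem hjk hjk hi hi hjk hi

lemma IsPosHomogeneous.momentFF_self_diag_other (h : IsPosHomogeneous α φ) (hα : 1 / 2 < α)
    (hB : 4 ≤ B) {k j : Fin B} (hjk : j ≠ k) :
    momentFF φ k k j j = (((B : ℝ) - 1 + 2 * α) * moment φ k k - momentFF φ k k k k) /
      ((B : ℝ) - 1) := by
  have hB' : (4 : ℝ) ≤ B := by exact_mod_cast hB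
  have h1 := h.sum_momentFF_diag hα hB k k
  rw [sum_eq_of_const_off {k} _ (momentFF φ k k j j) fun i hi => ?_] at h1
  · rw [Finset.sum_singleton, Finset.card_singleton] at h1
    rw [eq_div_iff (by linarith)]
    push_cast at h1
    linarith
  · rw [Finset.mem_singleton] at hi
    exact momentFF_diag_eq_of_notMem hjk hjk hi hi

lemma IsPosHomogeneous.momentFF_self_other_other (h : IsPosHomogeneous α φ) (hα : 1 / 2 < α)
    (hB : 4 ≤ B) {k i j : Fin B} (hik : i ≠ k) (hjk : j ≠ k) (hij : i ≠ j) :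
    momentFF φ k k i j = -(momentFF φ k k i i + momentFF φ k k k i) / ((B : ℝ) - 2) := by
  have hB' : (4 : ℝ) ≤ B := by exact_mod_cast hB
  have h1 := h.sum_momentFF hα hB k k i
  rw [sum_eq_of_const_off {i, k} _ (momentFF φ k k i j) fun m hm => ?_] at h1
  · rw [Finset.sum_pair hik, Finset.card_pair hik] at h1
    rw [eq_div_iff (by linarith), momentFF_comm k k k i]
    push_cast at h1
    linarith
  · simp only [Finset.mem_insert, Finset.mem_singleton, not_or] at hm
    exact momentFF_eq_of_notMem hjk hjk hm.2 hm.2 hij.symm hm.1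

end BatchNorm

namespace BatchNorm

/-! ### The Jacobian of batch normalization -/

variable {B : ℕ} {α : ℝ} {φ : ℝ → ℝ}

/-- Homogeneity extracts the normalization. Writing it as a power of ‖z‖² makes the derivative
immediate. -/
lemma IsPosHomogeneous.phiNormalize_apply (h : IsPosHomogeneous α φ) (hB : B ≠ 0)
    {z : EuclideanSpace ℝ (Fin B)} (hz : z ≠ 0) (i : Fin B) :
    phiNormalize φ z i = (B : ℝ) ^ (α / 2) * ((‖z‖ ^ 2) ^ (-α / 2) * φ (z i)) := by
  have hB' : (0 : ℝ) < B := by positivity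
  have hz' : 0 < ‖z‖ := norm_pos_iff.2 hz
  simp only [phiNormalize, applyCoord, normalize, PiLp.smul_apply, smul_eq_mul]
  rw [h _ (by positivity), Real.div_rpow (Real.sqrt_nonneg _) hz'.le, ← Real.rpow_natCast,
    ← Real.rpow_mul hz'.le, Real.sqrt_eq_rpow, ← Real.rpow_mul hB'.le,
    show ((2 : ℕ) : ℝ) * (-α / 2) = -α by push_cast; ring, Real.rpow_neg hz'.le,
    show 1 / 2 * α = α / 2 by ring]
  ring

/-- The Jacobian matrix of `φ ∘ 𝗇` at a point without vanishing coordinates. -/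
noncomputable def jacobianEntry (α : ℝ) (φ : ℝ → ℝ) (z : EuclideanSpace ℝ (Fin B))
    (i k : Fin B) : ℝ :=
  (B : ℝ) ^ (α / 2) * (‖z‖ ^ (-α) * ((if i = k then deriv φ (z i) else 0) -
    α * (φ (z i) * z k / ‖z‖ ^ 2)))

lemma IsPosHomogeneous.hasFDerivAt_phiNormalize (h : IsPosHomogeneous α φ) (hB : B ≠ 0)
    {z : EuclideanSpace ℝ (Fin B)} (hz : ∀ i, z i ≠ 0) (i : Fin B) :
    ∃ f' : EuclideanSpace ℝ (Fin B) →L[ℝ] ℝ,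
      HasFDerivAt (fun z => phiNormalize φ z i) f' z ∧
      ∀ k, f' (EuclideanSpace.single k 1) = jacobianEntry α φ z i k := by
  have hz0 : z ≠ 0 := fun h0 => hz i (by rw [h0]; rfl)
  have hz' : 0 < ‖z‖ := norm_pos_iff.2 hz0
  have e : (fun z : EuclideanSpace ℝ (Fin B) => phiNormalize φ z i) =ᶠ[𝓝 z]
      fun z => (B : ℝ) ^ (α / 2) * ((‖z‖ ^ 2) ^ (-α / 2) * φ (z i)) := by
    filter_upwards [isOpen_ne.mem_nhds hz0] with y hy
    exact h.phiNormalize_apply hB hy i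
  have d1 := ((hasStrictFDerivAt_norm_sq z).hasFDerivAt).rpow_const (p := -α / 2)
    (Or.inl (by positivity))
  have d2 : HasFDerivAt (fun z : EuclideanSpace ℝ (Fin B) => φ (z i))
      (deriv φ (z i) • (EuclideanSpace.proj i : EuclideanSpace ℝ (Fin B) →L[ℝ] ℝ)) z := by
    have hd := h.hasDerivAt (hz i)
    rw [← hd.deriv] at hd
    exact hd.comp_hasFDerivAt z
      (EuclideanSpace.proj i : EuclideanSpace ℝ (Fin B) →L[ℝ] ℝ).hasFDerivAt
  refine ⟨_, ((d1.mul d2).const_mul _).congr_of_eventuallyEq e, fun k => ?_⟩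
  simp only [smul_apply, add_apply, smul_eq_mul,
    innerSL_apply_apply, PiLp.proj_apply, EuclideanSpace.inner_single_right,
    PiLp.single_apply, conj_trivial]
  have e1 : (‖z‖ ^ 2) ^ (-α / 2) = ‖z‖ ^ (-α) := by
    rw [← Real.rpow_natCast, ← Real.rpow_mul hz'.le]
    congr 1; push_cast; ring
  rw [Real.rpow_sub_one (by positivity), e1, jacobianEntry]
  split_ifs <;> simp only [nsmul_eq_mul] <;> push_cast <;> ring

lemma IsPosHomogeneous.differentiableAt_phiNormalize (h : IsPosHomogeneous α φ) (hB : B ≠ 0)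
    {z : EuclideanSpace ℝ (Fin B)} (hz : ∀ i, z i ≠ 0) :
    DifferentiableAt ℝ (phiNormalize φ) z := by
  rw [differentiableAt_euclidean]
  exact fun i => (h.hasFDerivAt_phiNormalize hB hz i).choose_spec.1.differentiableAt

lemma IsPosHomogeneous.jacobian_phiNormalize (h : IsPosHomogeneous α φ) (hB : B ≠ 0)
    {z : EuclideanSpace ℝ (Fin B)} (hz : ∀ i, z i ≠ 0) (i k : Fin B) :
    jacobian (phiNormalize φ) z i k = jacobianEntry α φ z i k := by
  obtain ⟨f', hf, hk⟩ := h.hasFDerivAt_phiNormalize hB hz i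
  rw [← hk, jacobian, Matrix.of_apply]
  have : HasFDerivAt (fun z => phiNormalize φ z i) _ z :=
    (EuclideanSpace.proj i : EuclideanSpace ℝ (Fin B) →L[ℝ] ℝ).hasFDerivAt.comp z
      (h.differentiableAt_phiNormalize hB hz).hasFDerivAt
  rw [← this.unique hf]
  rfl

lemma center_single (j k : Fin B) : center (EuclideanSpace.single j 1) k = centering B k j := by
  rw [center_apply, centering_apply]
  simp

lemma IsPosHomogeneous.jacobian_batchNorm (h : IsPosHomogeneous α φ) (hB : B ≠ 0)
    {x : EuclideanSpace ℝ (Fin B)} (hx : ∀ i, center x i ≠ 0) :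
    jacobian (batchNorm φ) x = jacobian (phiNormalize φ) (center x) * centering B := by
  have hc : HasFDerivAt (center (B := B))
      (LinearMap.toContinuousLinearMap (Matrix.toEuclideanLin (centering B))) x :=
    (LinearMap.toContinuousLinearMap (Matrix.toEuclideanLin (centering B))).hasFDerivAt
  have hd := ((h.differentiableAt_phiNormalize hB hx).hasFDerivAt.comp x hc).fderiv
  ext i j
  rw [Matrix.mul_apply]
  simp only [jacobian, Matrix.of_apply]
  have e : fderiv ℝ (batchNorm φ) x = _ := hd
  rw [e, ContinuousLinearMap.comp_apply]
  have e2 : (LinearMap.toContinuousLinearMap (Matrix.toEuclideanLin (centering B)))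
      (EuclideanSpace.single j 1) = ∑ k, centering B k j • EuclideanSpace.single k (1 : ℝ) := by
    change center (EuclideanSpace.single j 1) = _
    ext m
    rw [center_single]
    simp [Pi.single_apply]
  rw [e2, map_sum]
  simp [mul_comm]

/-! ### Second moments of the Jacobian -/

/-- The second moments of the Jacobian up to a common factor. -/
noncomputable def kernelMoment (α : ℝ) (φ : ℝ → ℝ) (i j k l : Fin B) : ℝ :=
  ((B : ℝ) - 3 + 2 * α) * (if i = k then if j = l then moment (deriv φ) i j else 0 else 0) -
    α * (if i = k then momentFD φ j i l else 0) - α * (if j = l then momentFD φ i j k else 0) +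
    α ^ 2 / ((B : ℝ) - 1 + 2 * α) * momentFF φ i j k l

/-- A product of two entries of the Jacobian as a combination of homogeneous functions. -/
noncomputable def jacobianProduct (α : ℝ) (φ : ℝ → ℝ) (i j k l : Fin B)
    (z : EuclideanSpace ℝ (Fin B)) : ℝ :=
  (B : ℝ) ^ α *
      ((if i = k then if j = l then 1 else 0 else 0) *
          (‖z‖ ^ (-(2 * α)) * (deriv φ (z i) * deriv φ (z j))) -
        α * ((if i = k then 1 else 0) *
          (‖z‖ ^ (-(2 * α) - 2) * (φ (z j) * deriv φ (z i) * z l))) -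
        α * ((if j = l then 1 else 0) *
          (‖z‖ ^ (-(2 * α) - 2) * (φ (z i) * deriv φ (z j) * z k))) +
        α ^ 2 * (‖z‖ ^ (-(2 * α) - 2 - 2) * (φ (z i) * φ (z j) * (z k * z l))))

lemma jacobianEntry_mul (hB : B ≠ 0) {z : EuclideanSpace ℝ (Fin B)} (hz : z ≠ 0)
    (i j k l : Fin B) :
    jacobianEntry α φ z i k * jacobianEntry α φ z j l = jacobianProduct α φ i j k l z := by
  have hz' : 0 < ‖z‖ := norm_pos_iff.2 hz
  have hB' : (0 : ℝ) < B := by positivity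
  have e1 : (B : ℝ) ^ α = (B : ℝ) ^ (α / 2) * (B : ℝ) ^ (α / 2) := by
    rw [← Real.rpow_add hB']; congr 1; ring
  have e2 : ‖z‖ ^ (-(2 * α)) = ‖z‖ ^ (-α) * ‖z‖ ^ (-α) := by
    rw [← Real.rpow_add hz']; congr 1; ring
  have e3 : ‖z‖ ^ (-(2 * α) - 2) = ‖z‖ ^ (-α) * ‖z‖ ^ (-α) / ‖z‖ ^ 2 := by
    rw [Real.rpow_sub hz', e2, Real.rpow_two]
  have e4 : ‖z‖ ^ (-(2 * α) - 2 - 2) = ‖z‖ ^ (-α) * ‖z‖ ^ (-α) / ‖z‖ ^ 2 / ‖z‖ ^ 2 := by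
    rw [Real.rpow_sub hz', e3, Real.rpow_two]
  rw [jacobianProduct, e4, e3, e2, e1, jacobianEntry, jacobianEntry]
  split_ifs <;> field_simp <;> ring

/-- All four terms of `jacobianProduct` have degree -2, so with their norm weights each yields the
radial moment at B - 1 - 2 = B - 3, whose positivity needs B > 3. Without the weights the degrees
are 2α-2, 2α and 2α+2; relative to the middle one the radial moments supply the factors B-3+2α and
1/(B-1+2α) of `kernelMoment`. -/
lemma IsPosHomogeneous.jacobianEntry_mul_centeredLaw (h : IsPosHomogeneous α φ) (hα : 1 / 2 < α)
    (hB : 4 ≤ B) (i j k l : Fin B) :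
    Integrable (fun z => jacobianEntry α φ z i k * jacobianEntry α φ z j l) (centeredLaw B) ∧
    ∫ z, jacobianEntry α φ z i k * jacobianEntry α φ z j l ∂(centeredLaw B) =
      (B : ℝ) ^ α * radialMoment ((B : ℝ) - 3) / radialMoment ((B : ℝ) - 1 + 2 * α) *
        kernelMoment α φ i j k l := by
  have hB' : (4 : ℝ) ≤ B := by exact_mod_cast hB
  have hae : (fun z => jacobianEntry α φ z i k * jacobianEntry α φ z j l) =ᵐ[centeredLaw B]
      jacobianProduct α φ i j k l := by
    filter_upwards [ae_coord_ne_zero (by omega : 2 ≤ B)] with z hz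
    exact jacobianEntry_mul (by omega) (fun h0 => hz i (by rw [h0]; rfl)) i j k l
  have R1 := radialMoment_pos (m := (B : ℝ) - 3) (by linarith)
  have R2 := radialMoment_pos (m := (B : ℝ) - 3 + 2 * α) (by linarith)
  have R3 := radialMoment_add_two (m := (B : ℝ) - 3 + 2 * α) (by linarith)
  have R4 := radialMoment_add_two (m := (B : ℝ) - 1 + 2 * α) (by linarith)
  have i1 := (h.derivative.homogeneous_mul i j).integrable_centeredLaw (p := -(2 * α))
    (by omega) (h.derivative.integrable_mul_coord (by linarith) (by omega) i j) (by linarith)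
  have i2 := (h.homogeneous_FD j i l).integrable_centeredLaw (p := -(2 * α) - 2)
    (by omega) (h.integrable_FD hα hB j i l) (by linarith)
  have i3 := (h.homogeneous_FD i j k).integrable_centeredLaw (p := -(2 * α) - 2)
    (by omega) (h.integrable_FD hα hB i j k) (by linarith)
  have i4 := (h.homogeneous_FF i j k l).integrable_centeredLaw (p := -(2 * α) - 2 - 2)
    (by omega) (h.integrable_FF hα hB i j k l) (by linarith)
  have m1 := (h.derivative.homogeneous_mul i j).integral_centeredLaw (p := -(2 * α))
    (by omega : 2 ≤ B) (by linarith) (by linarith)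
  have m2 := (h.homogeneous_FD j i l).integral_centeredLaw (p := -(2 * α) - 2)
    (by omega : 2 ≤ B) (by linarith) (by linarith)
  have m3 := (h.homogeneous_FD i j k).integral_centeredLaw (p := -(2 * α) - 2)
    (by omega : 2 ≤ B) (by linarith) (by linarith)
  have m4 := (h.homogeneous_FF i j k l).integral_centeredLaw (p := -(2 * α) - 2 - 2)
    (by omega : 2 ≤ B) (by linarith) (by linarith)
  rw [show (B : ℝ) - 1 + 2 * (α - 1) + -(2 * α) = B - 3 by ring,
    show (B : ℝ) - 1 + 2 * (α - 1) = B - 3 + 2 * α by ring] at m1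
  rw [show (B : ℝ) - 1 + 2 * α + (-(2 * α) - 2) = B - 3 by ring,
    show (B : ℝ) - 1 + 2 * α = B - 3 + 2 * α + 2 by ring] at m2 m3
  rw [show (B : ℝ) - 1 + (2 * α + 2) + (-(2 * α) - 2 - 2) = B - 3 by ring,
    show (B : ℝ) - 1 + (2 * α + 2) = B - 1 + 2 * α + 2 by ring] at m4
  rw [R4, show (B : ℝ) - 1 + 2 * α = B - 3 + 2 * α + 2 by ring, R3] at m4
  rw [R3] at m2 m3
  have j1 := i1.const_mul (if i = k then if j = l then 1 else 0 else 0)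
  have j2 := (i2.const_mul (if i = k then 1 else 0)).const_mul α
  have j3 := (i3.const_mul (if j = l then 1 else 0)).const_mul α
  have j4 := i4.const_mul (α ^ 2)
  refine ⟨((((j1.sub j2).sub j3).add j4).const_mul ((B : ℝ) ^ α)).congr hae.symm, ?_⟩
  rw [integral_congr_ae hae]
  simp only [jacobianProduct]
  rw [integral_const_mul, show ∀ f₁ f₂ f₃ f₄ : EuclideanSpace ℝ (Fin B) → ℝ, Integrable f₁ (centeredLaw B) →
      Integrable f₂ (centeredLaw B) → Integrable f₃ (centeredLaw B) →
      Integrable f₄ (centeredLaw B) → ∫ z, f₁ z - f₂ z - f₃ z + f₄ z ∂(centeredLaw B) =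
        ∫ z, f₁ z ∂(centeredLaw B) - ∫ z, f₂ z ∂(centeredLaw B) - ∫ z, f₃ z ∂(centeredLaw B) +
        ∫ z, f₄ z ∂(centeredLaw B) from fun f₁ f₂ f₃ f₄ h₁ h₂ h₃ h₄ => by
          have h12 : Integrable (fun z => f₁ z - f₂ z) (centeredLaw B) := h₁.sub h₂
          have h123 : Integrable (fun z => f₁ z - f₂ z - f₃ z) (centeredLaw B) := h12.sub h₃
          rw [integral_add h123 h₄, integral_sub h12 h₃, integral_sub h₁ h₂]]
  rotate_left
  · exact j1
  · exact j2
  · exact j3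
  · exact j4
  simp only [integral_const_mul]
  have p1 : (B : ℝ) - 3 + 2 * α ≠ 0 := by linarith
  have p2 : (B : ℝ) - 3 + 2 * α + 2 ≠ 0 := by linarith
  have r2 := R2.ne'
  rw [eq_div_of_mul_eq r2 ((mul_comm _ _).trans m1),
    eq_div_of_mul_eq (mul_ne_zero p1 r2) ((mul_comm _ _).trans m2),
    eq_div_of_mul_eq (mul_ne_zero p1 r2) ((mul_comm _ _).trans m3),
    eq_div_of_mul_eq (mul_ne_zero p2 (mul_ne_zero p1 r2)) ((mul_comm _ _).trans m4),
    kernelMoment, show (B : ℝ) - 1 + 2 * α = B - 3 + 2 * α + 2 by ring, R3]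
  change _ * (_ * (_ * moment (deriv φ) i j / _) - α * (_ * (_ * momentFD φ j i l / _)) -
    α * (_ * (_ * momentFD φ i j k / _)) + α ^ 2 * (_ * momentFF φ i j k l / _)) = _
  split_ifs <;> field_simp <;> ring

end BatchNorm

namespace BatchNorm

/-! ### Gaussian laws of BSB1 covariances -/

variable {B : ℕ} {α : ℝ} {φ : ℝ → ℝ}

/-- The matrix with diagonal entries `a` and off-diagonal entries `b`. -/
def bsb1 (B : ℕ) (a b : ℝ) : Matrix (Fin B) (Fin B) ℝ := Matrix.of fun i j => if i = j then a else b

lemma centerOp_apply (X : Matrix (Fin B) (Fin B) ℝ) :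
    centerOp B X = centering B * X * centering B := rfl

lemma sum_centering_row (hB : B ≠ 0) (i : Fin B) : ∑ j, centering B i j = 0 := by
  have : (B : ℝ) ≠ 0 := by exact_mod_cast hB
  simp only [centering_apply, Finset.sum_sub_distrib, Finset.sum_ite_eq, Finset.mem_univ, if_true,
    Finset.sum_const, Finset.card_univ, Fintype.card_fin, nsmul_eq_mul]
  field_simp
  ring

lemma transpose_centering : (centering B).transpose = centering B := by
  ext i j
  simp only [Matrix.transpose_apply, centering_apply, eq_comm]

lemma centering_apply_comm (i j : Fin B) : centering B i j = centering B j i := by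
  conv_lhs => rw [← transpose_centering]
  rfl

lemma centering_mul_const (hB : B ≠ 0) (b : ℝ) :
    centering B * (Matrix.of fun _ _ => b : Matrix (Fin B) (Fin B) ℝ) = 0 := by
  ext i j
  simp [Matrix.mul_apply, ← Finset.sum_mul, sum_centering_row hB]

lemma centering_mul_self (hB : B ≠ 0) : centering B * centering B = centering B := by
  conv_lhs => rw [show centering B * centering B = centering B * (1 - (1 / (B : ℝ)) •
    Matrix.of fun _ _ => 1) from rfl]
  rw [mul_sub, Matrix.mul_smul, centering_mul_const hB, mul_one, smul_zero, sub_zero]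

lemma bsb1_eq (a b : ℝ) : bsb1 B a b = (a - b) • 1 + Matrix.of fun _ _ => b := by
  ext i j
  simp only [bsb1, Matrix.of_apply, Matrix.add_apply, Matrix.smul_apply, Matrix.one_apply,
    smul_eq_mul]
  split_ifs <;> ring

lemma centerOp_bsb1 (hB : B ≠ 0) (a b : ℝ) : centerOp B (bsb1 B a b) = (a - b) • centering B := by
  rw [centerOp_apply, bsb1_eq, mul_add, centering_mul_const hB, add_zero, Matrix.mul_smul,
    Matrix.smul_mul, mul_one, centering_mul_self hB]

lemma centering_ne_zero (hB : 2 ≤ B) : centering B ≠ 0 := by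
  have hB' : (2 : ℝ) ≤ B := by exact_mod_cast hB
  intro h0
  have h := congrFun (congrFun h0 ⟨0, by omega⟩) ⟨1, by omega⟩
  rw [centering_apply, if_neg (by simp)] at h
  have : 0 < 1 / (B : ℝ) := by positivity
  simp only [Matrix.zero_apply] at h
  linarith

lemma pos_sub_of_posSemidef (hB : 2 ≤ B) {a b : ℝ} (hS : (bsb1 B a b).PosSemidef)
    (h0 : centerOp B (bsb1 B a b) ≠ 0) : 0 < a - b := by
  have hne : a - b ≠ 0 := fun h => h0 (by rw [centerOp_bsb1 (by omega), h, zero_smul])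
  refine lt_of_le_of_ne ?_ hne.symm
  -- The quadratic form at e₀ - e₁ equals 2(a - b).
  have h := hS.dotProduct_mulVec_nonneg
    (Pi.single (⟨0, by omega⟩ : Fin B) 1 - Pi.single (⟨1, by omega⟩ : Fin B) 1)
  simp [Matrix.mulVec_sub, sub_dotProduct, bsb1] at h
  linarith

lemma ae_center_ne_zero (hB : 2 ≤ B) {a b : ℝ} (hS : (bsb1 B a b).PosSemidef) (hab : 0 < a - b) :
    ∀ᵐ h ∂(gaussianLaw (bsb1 B a b)), ∀ i, center h i ≠ 0 := by
  have hm : MeasurableSet {z : EuclideanSpace ℝ (Fin B) | ∀ i, z i ≠ 0} := by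
    simp only [Set.ofPred_forall]
    exact MeasurableSet.iInter fun i => (measurableSet_eq_fun (by fun_prop) (by fun_prop)).compl
  rw [← ae_map_iff (p := fun z : EuclideanSpace ℝ (Fin B) => ∀ i, z i ≠ 0) (by fun_prop) hm, bsb1,
    map_center_gaussianLaw (by omega) hS hab.le, ae_map_iff (by fun_prop) hm]
  filter_upwards [ae_coord_ne_zero hB] with z hz i
  exact mul_ne_zero (Real.sqrt_pos.2 hab).ne' (hz i)

lemma IsHomogeneousOn.integrable_comp_center {k : ℝ} {F : EuclideanSpace ℝ (Fin B) → ℝ}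
    (hF : IsHomogeneousOn k F) (hm : Measurable F) (hi : Integrable F (centeredLaw B)) (hB : B ≠ 0)
    {a b : ℝ} (hS : (bsb1 B a b).PosSemidef) (hab : 0 < a - b) :
    Integrable (fun h => F (center h)) (gaussianLaw (bsb1 B a b)) := by
  have h1 : Integrable F ((gaussianLaw (bsb1 B a b)).map center) := by
    rw [bsb1, map_center_gaussianLaw hB hS hab.le,
      integrable_map_measure hm.aestronglyMeasurable (by fun_prop)]
    refine (hi.const_mul (√(a - b) ^ k)).congr (.of_forall fun z => ?_)
    exact (hF _ (Real.sqrt_pos.2 hab) z).symm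
  exact (integrable_map_measure hm.aestronglyMeasurable (by fun_prop)).1 h1

/-- The scale √(a-b) of the law of Gh leaves the integral as a prefactor. For degree 0 it disappears
(fixed point), for degree -2 it becomes 1/(a-b) (Jacobian). -/
lemma IsHomogeneousOn.integral_comp_center {k : ℝ} {F : EuclideanSpace ℝ (Fin B) → ℝ}
    (hF : IsHomogeneousOn k F) (hm : Measurable F) (hB : B ≠ 0)
    {a b : ℝ} (hS : (bsb1 B a b).PosSemidef) (hab : 0 < a - b) :
    ∫ h, F (center h) ∂(gaussianLaw (bsb1 B a b)) = √(a - b) ^ k * ∫ z, F z ∂(centeredLaw B) := by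
  have h1 : ∫ h, F (center h) ∂(gaussianLaw (bsb1 B a b)) =
      ∫ z, F z ∂((gaussianLaw (bsb1 B a b)).map center) :=
    (integral_map (by fun_prop) hm.aestronglyMeasurable).symm
  rw [h1, bsb1, map_center_gaussianLaw hB hS hab.le,
    integral_map (by fun_prop) hm.aestronglyMeasurable, ← integral_const_mul]
  exact integral_congr_ae (.of_forall fun z => hF _ (Real.sqrt_pos.2 hab) z)

/-! ### The fixed point -/

/-- The ratio between the entries of the BSB1 fixed point and the moments of the centred law. -/
noncomputable def fixedScale (B : ℕ) (α : ℝ) : ℝ :=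
  (B : ℝ) ^ α * radialMoment ((B : ℝ) - 1) / radialMoment ((B : ℝ) - 1 + 2 * α)

lemma fixedScale_pos (hα : 1 / 2 < α) (hB : 4 ≤ B) : 0 < fixedScale B α := by
  have hB' : (4 : ℝ) ≤ B := by exact_mod_cast hB
  have R1 := radialMoment_pos (m := (B : ℝ) - 1) (by linarith)
  have R2 := radialMoment_pos (m := (B : ℝ) - 1 + 2 * α) (by linarith)
  unfold fixedScale
  positivity

/-- The moment `E[φ(g_k)²]`. -/
noncomputable def diagMoment (B : ℕ) (α : ℝ) (φ : ℝ → ℝ) : ℝ := momentScale B α * homJ α φ 1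

/-- The moment `E[φ(g_k) φ(g_l)]`, `k ≠ l`. -/
noncomputable def offMoment (B : ℕ) (α : ℝ) (φ : ℝ → ℝ) : ℝ :=
  momentScale B α * homJ α φ (coordCorr B)

/-- The BSB1 fixed point. -/
noncomputable def fixedCov (B : ℕ) (α : ℝ) (φ : ℝ → ℝ) : Matrix (Fin B) (Fin B) ℝ :=
  bsb1 B (fixedScale B α * diagMoment B α φ) (fixedScale B α * offMoment B α φ)

lemma IsPosHomogeneous.fixedCov_apply (h : IsPosHomogeneous α φ) (hα : 1 / 2 < α) (hB : 4 ≤ B)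
    (i j : Fin B) : fixedCov B α φ i j = fixedScale B α * moment φ i j := by
  rw [fixedCov, bsb1, Matrix.of_apply]
  split_ifs with hij
  · rw [← hij, h.moment_self hα hB, diagMoment]
  · rw [h.moment_of_ne hα hB hij, offMoment]

lemma IsPosHomogeneous.posSemidef_fixedCov (h : IsPosHomogeneous α φ) (hα : 1 / 2 < α)
    (hB : 4 ≤ B) : (fixedCov B α φ).PosSemidef := by
  refine Matrix.PosSemidef.of_dotProduct_mulVec_nonneg ?_ fun x => ?_
  · ext i j
    rw [Matrix.conjTranspose_apply, star_trivial, fixedCov, bsb1, Matrix.of_apply, Matrix.of_apply]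
    simp only [eq_comm]
  · have e : star x ⬝ᵥ (fixedCov B α φ).mulVec x =
        fixedScale B α * ∫ g, (∑ i, x i * φ (g i)) ^ 2 ∂(centeredLaw B) := by
      have hi := fun i j => h.integrable_mul_coord (by linarith) (by omega : 2 ≤ B) i j
      have e1 : ∀ g : EuclideanSpace ℝ (Fin B), (∑ i, x i * φ (g i)) ^ 2 =
          ∑ i, ∑ j, x i * x j * (φ (g i) * φ (g j)) := by
        intro g
        rw [sq, Finset.sum_mul_sum]
        exact Finset.sum_congr rfl fun i _ => Finset.sum_congr rfl fun j _ => by ring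
      simp_rw [e1]
      rw [integral_finsetSum _ fun i _ => integrable_finsetSum _ fun j _ =>
        (hi i j).const_mul _, Finset.mul_sum]
      simp only [dotProduct, Matrix.mulVec, star_trivial]
      refine Finset.sum_congr rfl fun i _ => ?_
      rw [integral_finsetSum _ fun j _ => (hi i j).const_mul _, Finset.mul_sum, Finset.mul_sum]
      refine Finset.sum_congr rfl fun j _ => ?_
      rw [integral_const_mul, h.fixedCov_apply hα hB, moment]
      ring
    rw [e]
    exact mul_nonneg (fixedScale_pos hα hB).le (integral_nonneg fun g => sq_nonneg _)

lemma IsPosHomogeneous.eq_zero_of_one (h : IsPosHomogeneous α φ) (hα : 0 < α) (h1 : φ 1 = 0)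
    (h2 : φ (-1) = 0) : φ = 0 := by
  ext x
  have := h.abs_le hα x
  rw [h1, h2, abs_zero, add_zero, zero_mul] at this
  exact abs_nonpos_iff.1 this

lemma IsPosHomogeneous.apply_pos (h : IsPosHomogeneous α φ) {x : ℝ} (hx : 0 < x) :
    φ x = x ^ α * φ 1 := by
  rw [← h x hx, mul_one]

lemma IsPosHomogeneous.apply_neg (h : IsPosHomogeneous α φ) {x : ℝ} (hx : x < 0) :
    φ x = (-x) ^ α * φ (-1) := by
  rw [← h (-x) (by linarith), mul_neg, mul_one, neg_neg]

lemma exists_pos_and_neg (hB : 2 ≤ B) {g : EuclideanSpace ℝ (Fin B)} (h0 : ∀ i, g i ≠ 0)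
    (hs : ∑ i, g i = 0) : (∃ i, 0 < g i) ∧ ∃ i, g i < 0 := by
  have : Nonempty (Fin B) := ⟨⟨0, by omega⟩⟩
  constructor
  · by_contra! hneg
    have := Finset.sum_lt_sum_of_nonempty (f := fun i => g i) (g := fun _ => (0 : ℝ))
      Finset.univ_nonempty fun i _ => lt_of_le_of_ne (hneg i) (h0 i)
    simp [hs] at this
  · by_contra! hpos
    have := Finset.sum_lt_sum_of_nonempty (f := fun _ => (0 : ℝ)) (g := fun i => g i)
      Finset.univ_nonempty fun i _ => lt_of_le_of_ne (hpos i) (h0 i).symm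
    simp [hs] at this

/-- The sum is zero, so both signs occur, and a third coordinate shares its sign with one of them.
Two distinct arguments of one sign with equal values force φ to vanish on that half-line; comparison
with a coordinate of the opposite sign then kills φ on the other half-line. -/
lemma IsPosHomogeneous.eq_zero_of_coord_eq (h : IsPosHomogeneous α φ) (hα : 0 < α) (hB : 3 ≤ B)
    {g : EuclideanSpace ℝ (Fin B)} (h0 : ∀ i, g i ≠ 0) (hne : ∀ i j, i ≠ j → g i ≠ g j)
    (hs : ∑ i, g i = 0) (heq : ∀ i j, φ (g i) = φ (g j)) : φ = 0 := by
  obtain ⟨⟨i, hi⟩, ⟨j, hj⟩⟩ := exists_pos_and_neg (by omega) h0 hs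
  obtain ⟨m, hmi, hmj⟩ : ∃ m, m ≠ i ∧ m ≠ j := by
    have hc : ({i, j} : Finset (Fin B)).card < Fintype.card (Fin B) := by
      rw [Fintype.card_fin]
      exact (Finset.card_le_two).trans_lt (by omega)
    obtain ⟨m, hm⟩ := Finset.exists_mem_notMem_of_card_lt_card
      (s := {i, j}) (t := Finset.univ) (by simpa using hc)
    exact ⟨m, by simpa using hm⟩
  have eij := heq i j
  rw [h.apply_pos hi, h.apply_neg hj] at eij
  have pi := Real.rpow_pos_of_pos hi α
  have pj := Real.rpow_pos_of_pos (neg_pos.2 hj) α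
  rcases lt_or_gt_of_ne (h0 m) with hm | hm
  · have e := heq m j
    rw [h.apply_neg hm, h.apply_neg hj] at e
    have h2 : φ (-1) = 0 := by
      by_contra hcon
      have := Real.rpow_left_injOn hα.ne' (neg_pos.2 hm).le (neg_pos.2 hj).le
        (mul_right_cancel₀ hcon e)
      exact hne m j hmj (neg_injective this)
    rw [h2, mul_zero] at eij
    exact h.eq_zero_of_one hα ((mul_eq_zero.1 eij).resolve_left pi.ne') h2
  · have e := heq m i
    rw [h.apply_pos hm, h.apply_pos hi] at e
    have h2 : φ 1 = 0 := by
      by_contra hcon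
      exact hne m i hmi (Real.rpow_left_injOn hα.ne' hm.le hi.le (mul_right_cancel₀ hcon e))
    rw [h2, mul_zero] at eij
    exact h.eq_zero_of_one hα h2 ((mul_eq_zero.1 eij.symm).resolve_left pj.ne')

/-- The difference is half of E[(φ(g_i) - φ(g_j))²]. If it were not positive, all φ(g_i) would
almost surely coincide, and a single generic sample would give φ = 0. -/
lemma IsPosHomogeneous.offMoment_lt_diagMoment (h : IsPosHomogeneous α φ) (hα : 1 / 2 < α)
    (hB : 4 ≤ B) (hφ : φ ≠ 0) : offMoment B α φ < diagMoment B α φ := by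
  have hi := fun i j => h.integrable_mul_coord (by linarith) (by omega : 2 ≤ B) i j
  have key : ∀ i j : Fin B, i ≠ j → ∫ g, (φ (g i) - φ (g j)) ^ 2 ∂(centeredLaw B) =
      2 * (diagMoment B α φ - offMoment B α φ) := by
    intro i j hij
    have e1 : ∀ g : EuclideanSpace ℝ (Fin B), (φ (g i) - φ (g j)) ^ 2 =
        φ (g i) * φ (g i) - 2 * (φ (g i) * φ (g j)) + φ (g j) * φ (g j) := fun g => by ring
    have h12 : Integrable (fun g => φ (g i) * φ (g i) - 2 * (φ (g i) * φ (g j)))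
      (centeredLaw B) := (hi i i).sub ((hi i j).const_mul 2)
    simp_rw [e1]
    rw [integral_add h12 (hi j j), integral_sub (hi i i) ((hi i j).const_mul 2),
      integral_const_mul]
    change moment φ i i - 2 * moment φ i j + moment φ j j = _
    rw [h.moment_self hα hB, h.moment_self hα hB, h.moment_of_ne hα hB hij, diagMoment, offMoment]
    ring
  by_contra! hle
  refine hφ ?_
  have hae : ∀ᵐ g ∂(centeredLaw B), ∀ i j, φ (g i) = φ (g j) := by
    rw [ae_all_iff]; intro i
    rw [ae_all_iff]; intro j
    rcases eq_or_ne i j with rfl | hij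
    · exact .of_forall fun g => rfl
    have hint : Integrable (fun g => (φ (g i) - φ (g j)) ^ 2) (centeredLaw B) := by
      refine (((hi i i).sub ((hi i j).const_mul 2)).add (hi j j)).congr (.of_forall fun g => ?_)
      simp only [Pi.add_apply, Pi.sub_apply]
      ring
    have h0 : ∫ g, (φ (g i) - φ (g j)) ^ 2 ∂(centeredLaw B) = 0 :=
      le_antisymm (by rw [key i j hij]; linarith) (integral_nonneg fun g => sq_nonneg _)
    filter_upwards [(integral_eq_zero_iff_of_nonneg (fun g => sq_nonneg _) hint).1 h0] with g hg
    exact sub_eq_zero.1 (pow_eq_zero_iff two_ne_zero |>.1 hg)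
  obtain ⟨g, ⟨⟨h1, h2⟩, h3⟩, h4⟩ := (((hae.and (ae_coord_ne_zero (by omega))).and
    ae_coord_ne_coord).and (ae_sum_eq_zero (by omega))).exists
  exact h.eq_zero_of_coord_eq (by linarith) (by omega) h2 h3 h4 h1

lemma IsPosHomogeneous.homJ_one_sub_pos (h : IsPosHomogeneous α φ) (hα : 1 / 2 < α)
    (hB : 4 ≤ B) (hφ : φ ≠ 0) : 0 < homJ α φ 1 - homJ α φ (coordCorr B) := by
  have := h.offMoment_lt_diagMoment hα hB hφ
  have := lt_of_mul_lt_mul_left this (momentScale_pos hα hB).le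
  linarith

/-- The integrand has degree 0 in Gh, so the result depends on neither a nor b. This constancy of
the forward map gives both existence and uniqueness of the fixed point. -/
lemma IsPosHomogeneous.secondMoment_batchNorm (h : IsPosHomogeneous α φ) (hα : 1 / 2 < α)
    (hB : 4 ≤ B) {a b : ℝ} (hS : (bsb1 B a b).PosSemidef) (hab : 0 < a - b) :
    secondMoment (batchNorm φ) (bsb1 B a b) = fixedCov B α φ := by
  have hB' : (4 : ℝ) ≤ B := by exact_mod_cast hB
  have hm := h.measurable
  ext i j
  rw [h.fixedCov_apply hα hB, secondMoment, Matrix.of_apply]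
  have hae : (fun x => batchNorm φ x i * batchNorm φ x j) =ᵐ[gaussianLaw (bsb1 B a b)]
      fun x => (fun z : EuclideanSpace ℝ (Fin B) =>
        (B : ℝ) ^ α * (‖z‖ ^ (-(2 * α)) * (φ (z i) * φ (z j)))) (center x) := by
    filter_upwards [ae_center_ne_zero (by omega) hS hab] with x hx
    have hx0 : center x ≠ 0 := fun h0 => hx i (by rw [h0]; rfl)
    have hx1 := norm_pos_iff.2 hx0
    have e1 : (B : ℝ) ^ α = (B : ℝ) ^ (α / 2) * (B : ℝ) ^ (α / 2) := by
      rw [← Real.rpow_add (by linarith)]; congr 1; ring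
    have e2 : ‖center x‖ ^ (-(2 * α)) =
        (‖center x‖ ^ 2) ^ (-α / 2) * (‖center x‖ ^ 2) ^ (-α / 2) := by
      rw [← Real.rpow_natCast, ← Real.rpow_mul hx1.le, ← Real.rpow_add hx1]
      congr 1; push_cast; ring
    simp only [batchNorm]
    rw [h.phiNormalize_apply (by omega) hx0, h.phiNormalize_apply (by omega) hx0, e1, e2]
    ring
  have hom : IsHomogeneousOn 0 (fun z : EuclideanSpace ℝ (Fin B) =>
        (B : ℝ) ^ α * (‖z‖ ^ (-(2 * α)) * (φ (z i) * φ (z j)))) := by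
    intro r hr z
    simp only
    rw [norm_smul, Real.norm_of_nonneg hr.le, Real.mul_rpow hr.le (norm_nonneg _)]
    have := h.homogeneous_mul i j r hr z
    simp only at this
    rw [this, Real.rpow_neg hr.le, Real.rpow_zero]
    have := (Real.rpow_pos_of_pos hr (2 * α)).ne'
    field_simp
  rw [integral_congr_ae hae, hom.integral_comp_center (by fun_prop) (by omega) hS hab,
    Real.rpow_zero, one_mul, integral_const_mul]
  have m1 := (h.homogeneous_mul i j).integral_centeredLaw (p := -(2 * α))
    (by omega : 2 ≤ B) (by linarith) (by linarith)
  rw [show (B : ℝ) - 1 + 2 * α + -(2 * α) = B - 1 by ring] at m1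
  have R2 := (radialMoment_pos (m := (B : ℝ) - 1 + 2 * α) (by linarith)).ne'
  rw [eq_div_of_mul_eq R2 ((mul_comm _ _).trans m1), fixedScale, moment]
  ring

lemma IsPosHomogeneous.isBSB1FixedPoint_iff (h : IsPosHomogeneous α φ) (hα : 1 / 2 < α)
    (hB : 4 ≤ B) (hφ : φ ≠ 0) (S : Matrix (Fin B) (Fin B) ℝ) :
    IsBSB1FixedPoint φ S ↔ S = fixedCov B α φ := by
  constructor
  · rintro ⟨hS, ⟨a, b, rfl⟩, h0, hf⟩
    change secondMoment (batchNorm φ) (bsb1 B a b) = bsb1 B a b at hf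
    rw [h.secondMoment_batchNorm hα hB hS (pos_sub_of_posSemidef (by omega) hS h0)] at hf
    exact hf.symm
  · rintro rfl
    have hpos : 0 < fixedScale B α * diagMoment B α φ - fixedScale B α * offMoment B α φ := by
      rw [← mul_sub]
      exact mul_pos (fixedScale_pos hα hB) (by linarith [h.offMoment_lt_diagMoment hα hB hφ])
    refine ⟨h.posSemidef_fixedCov hα hB, ⟨_, _, rfl⟩, ?_,
      h.secondMoment_batchNorm hα hB (h.posSemidef_fixedCov hα hB) hpos⟩
    rw [fixedCov, centerOp_bsb1 (by omega)]
    exact smul_ne_zero hpos.ne' (centering_ne_zero (by omega))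

/-! ### The kernel of `𝓕` at the fixed point -/

lemma IsPosHomogeneous.homogeneous_jacobianEntry (h : IsPosHomogeneous α φ) (i k : Fin B) :
    IsHomogeneousOn (-1) (fun z => jacobianEntry α φ z i k) := by
  intro r hr z
  rcases eq_or_ne z 0 with rfl | hz
  -- At the origin: for α ≠ 0 both sides vanish because 0^(-α) = 0 by convention; for α = 0
  -- homogeneity gives φ'(0) = r⁻¹φ'(0), which is the claim.
  · have e : φ 0 = r ^ α * φ 0 := by rw [← h r hr, mul_zero]
    have e' : deriv φ 0 = r ^ (α - 1) * deriv φ 0 := by rw [← h.derivative r hr, mul_zero]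
    simp only [jacobianEntry, smul_zero, PiLp.zero_apply, norm_zero]
    rcases eq_or_ne α 0 with rfl | hα
    · rw [zero_sub, Real.rpow_neg_one] at e'
      rw [Real.rpow_neg_one]
      split_ifs
      · simp
        tauto
      · simp
    · rw [Real.zero_rpow (neg_ne_zero.2 hα)]; ring
  have hz' := norm_pos_iff.2 hz
  simp only [jacobianEntry, PiLp.smul_apply, smul_eq_mul]
  rw [h r hr, h.derivative r hr, norm_smul, Real.norm_of_nonneg hr.le,
    Real.mul_rpow hr.le hz'.le, Real.rpow_sub_one hr.ne', Real.rpow_neg hr.le, Real.rpow_neg_one]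
  have := (Real.rpow_pos_of_pos hr α).ne'
  split_ifs
  · field_simp
  · field_simp
    ring

lemma IsPosHomogeneous.measurable_jacobianEntry (h : IsPosHomogeneous α φ) (i k : Fin B) :
    Measurable (fun z => jacobianEntry α φ z i k) := by
  have hm := h.measurable
  have hm' := h.derivative.measurable
  unfold jacobianEntry
  split_ifs <;> fun_prop

/-- Degree -2 gives the factor 1/(a-b) with a - b equal to `fixedScale` times the moment gap. The
powers of B cancel, and the quotient of radial moments at B - 3 and B - 1 leaves 1/(B-3). -/
lemma IsPosHomogeneous.jacobian_mul_fixedCov (h : IsPosHomogeneous α φ) (hα : 1 / 2 < α)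
    (hB : 4 ≤ B) (hφ : φ ≠ 0) (i j k l : Fin B) :
    Integrable (fun x => jacobian (phiNormalize φ) (center x) i k *
      jacobian (phiNormalize φ) (center x) j l) (gaussianLaw (fixedCov B α φ)) ∧
    ∫ x, jacobian (phiNormalize φ) (center x) i k * jacobian (phiNormalize φ) (center x) j l
      ∂(gaussianLaw (fixedCov B α φ)) =
      kernelMoment α φ i j k l / (((B : ℝ) - 3) * (diagMoment B α φ - offMoment B α φ)) := by
  have hB' : (4 : ℝ) ≤ B := by exact_mod_cast hB
  have hS := h.posSemidef_fixedCov hα hB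
  have hd : 0 < diagMoment B α φ - offMoment B α φ := by
    linarith [h.offMoment_lt_diagMoment hα hB hφ]
  have hab : 0 < fixedScale B α * diagMoment B α φ - fixedScale B α * offMoment B α φ := by
    rw [← mul_sub]
    exact mul_pos (fixedScale_pos hα hB) hd
  have hae : (fun x => jacobian (phiNormalize φ) (center x) i k *
      jacobian (phiNormalize φ) (center x) j l) =ᵐ[gaussianLaw (fixedCov B α φ)]
      fun x => (fun z => jacobianEntry α φ z i k * jacobianEntry α φ z j l) (center x) := by
    filter_upwards [ae_center_ne_zero (by omega) hS hab] with x hx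
    rw [h.jacobian_phiNormalize (by omega) hx, h.jacobian_phiNormalize (by omega) hx]
  have hm := (h.measurable_jacobianEntry i k).mul (h.measurable_jacobianEntry j l)
  have hom : IsHomogeneousOn (-2)
      (fun z : EuclideanSpace ℝ (Fin B) => jacobianEntry α φ z i k * jacobianEntry α φ z j l) := by
    intro r hr z
    have e1 := h.homogeneous_jacobianEntry i k r hr z
    have e2 := h.homogeneous_jacobianEntry j l r hr z
    simp only at e1 e2 ⊢
    rw [e1, e2, show (-2 : ℝ) = -1 + -1 by norm_num, Real.rpow_add hr]
    ring
  obtain ⟨hi, hv⟩ := h.jacobianEntry_mul_centeredLaw hα hB i j k l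
  refine ⟨(hom.integrable_comp_center hm hi (by omega) hS hab).congr hae.symm, ?_⟩
  have e := hom.integral_comp_center hm (by omega) hS hab
  change ∫ x, jacobianEntry α φ (center x) i k * jacobianEntry α φ (center x) j l
    ∂(gaussianLaw (fixedCov B α φ)) = _ at e
  rw [integral_congr_ae hae, e, hv, Real.rpow_neg (Real.sqrt_nonneg _), Real.rpow_two,
    Real.sq_sqrt hab.le, ← mul_sub, fixedScale]
  have R0 := radialMoment_pos (m := (B : ℝ) - 3) (by linarith)
  have R1 := radialMoment_add_two (m := (B : ℝ) - 3) (by linarith)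
  rw [show (B : ℝ) - 3 + 2 = B - 1 by ring] at R1
  have R2 := radialMoment_pos (m := (B : ℝ) - 1 + 2 * α) (by linarith)
  have hBα : 0 < (B : ℝ) ^ α := by positivity
  have p1 : (B : ℝ) - 3 ≠ 0 := by linarith
  have := hd.ne'
  rw [R1]
  field_simp

end BatchNorm

namespace BatchNorm

/-! ### The values of the moments as rational functions of `𝕁_φ(1)`, `𝕁_φ(c)`, `𝕁_φ'(c)` -/

/-- `E[φ(g_k) φ'(g_l) g_k]` in units of `momentScale`. -/
noncomputable def crossFD (b α J D : ℝ) : ℝ :=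
  -(α * J) / (b - 1) + b * (b - 2) / (b - 1) ^ 2 * D

/-- `E[φ(g_k) φ'(g_l) g_j]` in units of `momentScale`. -/
noncomputable def otherFD (b α J D : ℝ) : ℝ := -(crossFD b α J D + α * J) / (b - 2)

/-- `E[φ(g_k) φ(g_l) g_k g_l]` in units of `momentScale`. -/
noncomputable def crossFF (b α J D : ℝ) : ℝ :=
  (b - 1) / b * (-((2 * α + 1) * J) / (b - 1) + b * (b - 2) / (b - 1) ^ 2 * D)

/-- `E[φ(g_k) φ(g_l) g_k²]` in units of `momentScale`. -/
noncomputable def leftFF (b α J D : ℝ) : ℝ :=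
  -crossFF b α J D / (b - 1) + (b - 2) / (b - 1) * ((1 + α) * J)

/-- `E[φ(g_k) φ(g_l) g_k g_j]` in units of `momentScale`. -/
noncomputable def mixedFF (b α J D : ℝ) : ℝ := -(leftFF b α J D + crossFF b α J D) / (b - 2)

/-- `E[φ(g_k) φ(g_l) g_j²]` in units of `momentScale`. -/
noncomputable def squareFF (b α J D : ℝ) : ℝ := ((b - 1 + 2 * α) * J - 2 * leftFF b α J D) / (b - 2)

/-- `E[φ(g_k) φ(g_l) g_i g_j]` in units of `momentScale`. -/
noncomputable def otherFF (b α J D : ℝ) : ℝ :=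
  -(squareFF b α J D + 2 * mixedFF b α J D) / (b - 3)

/-- `E[φ(g_k)² g_k²]` in units of `momentScale`. -/
noncomputable def selfFF (b α J₁ : ℝ) : ℝ := (b - 1) / b * ((2 * α + 1) * J₁)

/-- `E[φ(g_k)² g_k g_j]` in units of `momentScale`. -/
noncomputable def selfMixedFF (b α J₁ : ℝ) : ℝ := -selfFF b α J₁ / (b - 1)

/-- `E[φ(g_k)² g_j²]` in units of `momentScale`. -/
noncomputable def selfSquareFF (b α J₁ : ℝ) : ℝ := ((b - 1 + 2 * α) * J₁ - selfFF b α J₁) / (b - 1)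

/-- `E[φ(g_k)² g_i g_j]` in units of `momentScale`. -/
noncomputable def selfOtherFF (b α J₁ : ℝ) : ℝ :=
  -(selfSquareFF b α J₁ + selfMixedFF b α J₁) / (b - 2)

variable {B : ℕ} {α : ℝ} {φ : ℝ → ℝ}

lemma one_sub_coordCorr_sq (hB : 4 ≤ B) :
    1 - coordCorr B ^ 2 = (B : ℝ) * (B - 2) / (B - 1) ^ 2 := by
  have hB' : (4 : ℝ) ≤ B := by exact_mod_cast hB
  have : (B : ℝ) - 1 ≠ 0 := by linarith
  rw [coordCorr]
  field_simp
  ring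

lemma IsPosHomogeneous.momentFD_off (h : IsPosHomogeneous α φ) (hα : 1 / 2 < α) (hB : 4 ≤ B)
    {J D : ℝ} (hJ : J = homJ α φ (coordCorr B)) (hD : D = deriv (homJ α φ) (coordCorr B))
    {k l : Fin B} (hkl : k ≠ l) (j : Fin B) :
    momentFD φ k l j = momentScale B α * (otherFD B α J D +
      (crossFD B α J D - otherFD B α J D) * (if k = j then 1 else 0) +
      (α * J - otherFD B α J D) * (if l = j then 1 else 0)) := by
  have hB' : (4 : ℝ) ≤ B := by exact_mod_cast hB
  have e1 : momentFD φ k l k = momentScale B α * crossFD B α J D := by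
    rw [h.momentFD_left hα hB hkl, one_sub_coordCorr_sq hB, crossFD, hJ, hD, coordCorr]
    ring
  have e2 : momentFD φ k l l = momentScale B α * (α * J) := by
    rw [h.momentFD_right hα, h.moment_of_ne hα hB hkl, hJ]
    ring
  by_cases hk : k = j
  · subst hk
    rw [e1, if_pos rfl, if_neg hkl.symm]
    ring
  by_cases hl : l = j
  · subst hl
    rw [e2, if_pos rfl, if_neg hk]
    ring
  rw [h.momentFD_other hα hB hkl (Ne.symm hk) (Ne.symm hl), e1, e2, if_neg hk, if_neg hl, otherFD]
  ring

lemma IsPosHomogeneous.momentFD_self (h : IsPosHomogeneous α φ) (hα : 1 / 2 < α) (hB : 4 ≤ B)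
    {J₁ : ℝ} (hJ : J₁ = homJ α φ 1) (k j : Fin B) :
    momentFD φ k k j = momentScale B α * (-(α * J₁) / ((B : ℝ) - 1) +
      (α * J₁ - -(α * J₁) / ((B : ℝ) - 1)) * (if k = j then 1 else 0)) := by
  have e1 : momentFD φ k k k = momentScale B α * (α * J₁) := by
    rw [h.momentFD_right hα, h.moment_self hα hB, hJ]
    ring
  by_cases hk : k = j
  · subst hk
    rw [e1, if_pos rfl]
    ring
  rw [h.momentFD_self_other hα hB (Ne.symm hk), e1, if_neg hk]
  ring

/-- A matrix that is constant on the orbits of the pairs under relabelling the indices other than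
`k` and `l`, symmetric in `k` and `l`. -/
def orbitMatrix (q p z x y : ℝ) (k l i j : Fin B) : ℝ :=
  q + (p - q) * (if i = j then 1 else 0) +
    (z - q) * ((if k = i then 1 else 0) + (if k = j then 1 else 0) + (if l = i then 1 else 0) +
      (if l = j then 1 else 0)) +
    (x - p - 2 * z + 2 * q) * ((if k = i then if k = j then 1 else 0 else 0) +
      (if l = i then if l = j then 1 else 0 else 0)) +
    (y - 2 * z + q) * ((if k = i then if l = j then 1 else 0 else 0) +
      (if l = i then if k = j then 1 else 0 else 0))

/-- A matrix that is constant on the orbits of the pairs under relabelling the indices other than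
`k`. -/
def selfOrbitMatrix (q p z x : ℝ) (k i j : Fin B) : ℝ :=
  q + (p - q) * (if i = j then 1 else 0) +
    (z - q) * ((if k = i then 1 else 0) + (if k = j then 1 else 0)) +
    (x - p - 2 * z + 2 * q) * (if k = i then if k = j then 1 else 0 else 0)

lemma IsPosHomogeneous.momentFF_off (h : IsPosHomogeneous α φ) (hα : 1 / 2 < α) (hB : 4 ≤ B)
    {J D : ℝ} (hJ : J = homJ α φ (coordCorr B)) (hD : D = deriv (homJ α φ) (coordCorr B))
    {k l : Fin B} (hkl : k ≠ l) (i j : Fin B) :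
    momentFF φ k l i j = momentScale B α * orbitMatrix (otherFF B α J D) (squareFF B α J D)
      (mixedFF B α J D) (leftFF B α J D) (crossFF B α J D) k l i j := by
  have hB' : (4 : ℝ) ≤ B := by exact_mod_cast hB
  have hb0 : (B : ℝ) ≠ 0 := by linarith
  have hb1 : (B : ℝ) - 1 ≠ 0 := by linarith
  have e0 : moment φ k l = momentScale B α * J := by rw [h.moment_of_ne hα hB hkl, hJ]
  have e1 : momentFF φ k l k l = momentScale B α * crossFF B α J D := by
    rw [h.momentFF_cross hα hB hkl, one_sub_coordCorr_sq hB, crossFF, hJ, hD, coordCorr, coordVar]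
    ring
  have e2 : momentFF φ k l k k = momentScale B α * leftFF B α J D := by
    rw [h.momentFF_left hα hB hkl, e0, e1, leftFF, one_sub_coordCorr_sq hB, coordCorr, coordVar]
    field_simp
  have e3 : ∀ j, k ≠ j → l ≠ j → momentFF φ k l k j = momentScale B α * mixedFF B α J D := by
    intro j h1 h2
    rw [h.momentFF_left_other hα hB hkl h1.symm h2.symm, e1, e2, mixedFF]
    ring
  have e4 : ∀ j, k ≠ j → l ≠ j → momentFF φ k l l j = momentScale B α * mixedFF B α J D := by
    intro j h1 h2
    rw [h.momentFF_right_other hα hB hkl h1.symm h2.symm, e1, e2, mixedFF]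
    ring
  have e5 : ∀ j, k ≠ j → l ≠ j → momentFF φ k l j j = momentScale B α * squareFF B α J D := by
    intro j h1 h2
    rw [h.momentFF_diag_other hα hB hkl h1.symm h2.symm, e0, e2, squareFF]
    ring
  unfold orbitMatrix
  by_cases hki : k = i
  · subst hki
    by_cases hkj : k = j
    · subst hkj
      simp only [if_true, hkl.symm, if_false, e2]
      ring
    by_cases hlj : l = j
    · subst hlj
      simp only [if_true, hkl.symm, hkl, if_false, e1]
      ring
    simp only [if_true, hkl.symm, hkj, hlj, if_false, e3 j hkj hlj]
    ring
  by_cases hli : l = i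
  · subst hli
    by_cases hkj : k = j
    · subst hkj
      rw [momentFF_comm]
      simp only [if_true, hkl.symm, hkl, if_false, e1]
      ring
    by_cases hlj : l = j
    · subst hlj
      rw [← momentFF_swap]
      simp only [if_true, hkl, if_false, e2]
      ring
    simp only [if_true, hkl, hkj, hlj, if_false, e4 j hkj hlj]
    ring
  by_cases hkj : k = j
  · subst hkj
    rw [momentFF_comm]
    simp only [if_true, hkl.symm, hki, hli, Ne.symm hki, if_false, e3 i hki hli]
    ring
  by_cases hlj : l = j
  · subst hlj
    rw [momentFF_comm]
    simp only [if_true, hkl, hki, hli, Ne.symm hli, if_false, e4 i hki hli]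
    ring
  by_cases hij : i = j
  · subst hij
    simp only [if_true, hki, hli, if_false, e5 i hki hli]
    ring
  rw [h.momentFF_other_other hα hB hkl (Ne.symm hki) (Ne.symm hli) (Ne.symm hkj) (Ne.symm hlj) hij,
    e5 i hki hli, e3 i hki hli, e4 i hki hli]
  simp only [hki, hli, hkj, hlj, hij, if_false, otherFF]
  ring

lemma IsPosHomogeneous.momentFF_diag (h : IsPosHomogeneous α φ) (hα : 1 / 2 < α) (hB : 4 ≤ B)
    {J₁ : ℝ} (hJ : J₁ = homJ α φ 1) (k i j : Fin B) :
    momentFF φ k k i j = momentScale B α * selfOrbitMatrix (selfOtherFF B α J₁)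
      (selfSquareFF B α J₁) (selfMixedFF B α J₁) (selfFF B α J₁) k i j := by
  have e0 : moment φ k k = momentScale B α * J₁ := by rw [h.moment_self hα hB, hJ]
  have e1 : momentFF φ k k k k = momentScale B α * selfFF B α J₁ := by
    rw [h.momentFF_self hα hB, selfFF, hJ, coordVar]
  have e3 : ∀ j, k ≠ j → momentFF φ k k k j = momentScale B α * selfMixedFF B α J₁ := by
    intro j h1
    rw [h.momentFF_self_other hα hB h1.symm, e1, selfMixedFF]
    ring
  have e5 : ∀ j, k ≠ j → momentFF φ k k j j = momentScale B α * selfSquareFF B α J₁ := by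
    intro j h1
    rw [h.momentFF_self_diag_other hα hB h1.symm, e0, e1, selfSquareFF]
    ring
  unfold selfOrbitMatrix
  by_cases hki : k = i
  · subst hki
    by_cases hkj : k = j
    · subst hkj
      simp only [if_true, e1]
      ring
    simp only [if_true, hkj, if_false, e3 j hkj]
    ring
  by_cases hkj : k = j
  · subst hkj
    rw [momentFF_comm]
    simp only [if_true, hki, Ne.symm hki, if_false, e3 i hki]
    ring
  by_cases hij : i = j
  · subst hij
    simp only [if_true, hki, if_false, e5 i hki]
    ring
  rw [h.momentFF_self_other_other hα hB (Ne.symm hki) (Ne.symm hkj) hij, e5 i hki, e3 i hki]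
  simp only [hki, hkj, hij, if_false, selfOtherFF]
  ring

/-! ### The operator `𝓕` on matrices with vanishing row sums -/

/-- Zero row and column sums annihilate the constant part and the parts that fix only one of i, j.
What survives are the indicators of i = j, of i and j at the same special index, and of {i, j} = {k,
l}. -/
lemma sum_orbitMatrix_mul (q p z x y : ℝ) (k l : Fin B) {Λ : Matrix (Fin B) (Fin B) ℝ}
    (hs : Λ.IsSymm) (hr : ∀ i, ∑ j, Λ i j = 0) :
    ∑ i, ∑ j, orbitMatrix q p z x y k l i j * Λ i j =
      (p - q) * Λ.trace + (x - p - 2 * z + 2 * q) * (Λ k k + Λ l l) +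
        2 * (y - 2 * z + q) * Λ k l := by
  have hc : ∀ j, ∑ i, Λ i j = 0 := fun j => by
    rw [← hr j]; exact Finset.sum_congr rfl fun i _ => hs.apply j i
  have e : ∀ i j, orbitMatrix q p z x y k l i j * Λ i j =
      q * Λ i j + (p - q) * (if i = j then Λ i j else 0) +
      (z - q) * (((if k = i then Λ i j else 0) + (if k = j then Λ i j else 0)) +
        ((if l = i then Λ i j else 0) + (if l = j then Λ i j else 0))) +
      (x - p - 2 * z + 2 * q) * ((if k = i then if k = j then Λ i j else 0 else 0) +
        (if l = i then if l = j then Λ i j else 0 else 0)) +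
      (y - 2 * z + q) * ((if k = i then if l = j then Λ i j else 0 else 0) +
        (if l = i then if k = j then Λ i j else 0 else 0)) := by
    intro i j
    unfold orbitMatrix
    simp only [add_mul, mul_add, mul_assoc, ite_mul, one_mul, zero_mul]
    ring
  have s1 : ∀ k : Fin B, ∑ i, ∑ j, (if k = i then Λ i j else 0) = 0 := fun k => by
    rw [Finset.sum_comm]; simp [hr]
  have s2 : ∀ k : Fin B, ∑ i, ∑ j, (if k = j then Λ i j else 0) = 0 := fun k => by simp [hc]
  have s3 : ∀ k l : Fin B, ∑ i, ∑ j, (if k = i then if l = j then Λ i j else 0 else 0) = Λ k l :=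
    fun k l => by
      rw [Finset.sum_eq_single k (fun i _ hi => by simp [hi.symm]) (by simp)]; simp
  have s4 : ∑ i, ∑ j, (if i = j then Λ i j else 0) = Λ.trace := by simp [Matrix.trace]
  simp_rw [e, Finset.sum_add_distrib, ← Finset.mul_sum, Finset.sum_add_distrib, s1, s2, s3, s4, hr,
    hs.apply k l]
  simp
  ring

lemma sum_selfOrbitMatrix_mul (q p z x : ℝ) (k : Fin B) {Λ : Matrix (Fin B) (Fin B) ℝ}
    (hs : Λ.IsSymm) (hr : ∀ i, ∑ j, Λ i j = 0) :
    ∑ i, ∑ j, selfOrbitMatrix q p z x k i j * Λ i j =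
      (p - q) * Λ.trace + (x - p - 2 * z + 2 * q) * Λ k k := by
  have hc : ∀ j, ∑ i, Λ i j = 0 := fun j => by
    rw [← hr j]; exact Finset.sum_congr rfl fun i _ => hs.apply j i
  have e : ∀ i j, selfOrbitMatrix q p z x k i j * Λ i j =
      q * Λ i j + (p - q) * (if i = j then Λ i j else 0) +
      (z - q) * ((if k = i then Λ i j else 0) + (if k = j then Λ i j else 0)) +
      (x - p - 2 * z + 2 * q) * (if k = i then if k = j then Λ i j else 0 else 0) := by
    intro i j
    unfold selfOrbitMatrix
    simp only [add_mul, mul_add, mul_assoc, ite_mul, one_mul, zero_mul]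
  have s1 : ∑ i, ∑ j, (if k = i then Λ i j else 0) = 0 := by
    rw [Finset.sum_comm]; simp [hr]
  have s2 : ∑ i, ∑ j, (if k = j then Λ i j else 0) = 0 := by simp [hc]
  have s3 : ∑ i, ∑ j, (if k = i then if k = j then Λ i j else 0 else 0) = Λ k k := by
    rw [Finset.sum_eq_single k (fun i _ hi => by simp [hi.symm]) (by simp)]; simp
  have s4 : ∑ i, ∑ j, (if i = j then Λ i j else 0) = Λ.trace := by simp [Matrix.trace]
  simp_rw [e, Finset.sum_add_distrib, ← Finset.mul_sum, Finset.sum_add_distrib, s1, s2, s3, s4, hr]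
  simp

/-- The coefficient of `Λ k l` in the entry `k ≠ l` of `𝓕 Λ`, up to a factor. -/
noncomputable def coeffOff (b α J D : ℝ) : ℝ :=
  (b - 3 + 2 * α) * (b / (b - 1) * D) - 2 * α * (crossFD b α J D - otherFD b α J D) +
    α ^ 2 / (b - 1 + 2 * α) * (2 * (crossFF b α J D - 2 * mixedFF b α J D + otherFF b α J D))

/-- The coefficient of `Λ k k + Λ l l` in the entry `k ≠ l` of `𝓕 Λ`, up to a factor. -/
noncomputable def coeffOffDiag (b α J D : ℝ) : ℝ :=
  -(α * (α * J - otherFD b α J D)) + α ^ 2 / (b - 1 + 2 * α) *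
    (leftFF b α J D - squareFF b α J D - 2 * mixedFF b α J D + 2 * otherFF b α J D)

/-- The coefficient of the trace in the entry `k ≠ l` of `𝓕 Λ`, up to a factor. -/
noncomputable def coeffOffTrace (b α J D : ℝ) : ℝ :=
  α ^ 2 / (b - 1 + 2 * α) * (squareFF b α J D - otherFF b α J D)

/-- The coefficient of `Λ k k` in the entry `k, k` of `𝓕 Λ`, up to a factor. -/
noncomputable def coeffDiag (b α J₁ : ℝ) : ℝ :=
  (b - 3 + 2 * α) * (α ^ 2 * J₁ * b / ((2 * α - 1) * (b - 1))) -
    2 * α * (α * J₁ + α * J₁ / (b - 1)) + α ^ 2 / (b - 1 + 2 * α) *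
    (selfFF b α J₁ - selfSquareFF b α J₁ - 2 * selfMixedFF b α J₁ + 2 * selfOtherFF b α J₁)

/-- The coefficient of the trace in the entry `k, k` of `𝓕 Λ`, up to a factor. -/
noncomputable def coeffDiagTrace (b α J₁ : ℝ) : ℝ :=
  α ^ 2 / (b - 1 + 2 * α) * (selfSquareFF b α J₁ - selfOtherFF b α J₁)

lemma sum_kernelMoment_mul (i j : Fin B) (Λ : Matrix (Fin B) (Fin B) ℝ) :
    ∑ k, ∑ l, kernelMoment α φ i j k l * Λ k l =
      ((B : ℝ) - 3 + 2 * α) * (moment (deriv φ) i j * Λ i j) -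
        α * ∑ l, momentFD φ j i l * Λ i l - α * ∑ k, momentFD φ i j k * Λ k j +
        α ^ 2 / ((B : ℝ) - 1 + 2 * α) * ∑ k, ∑ l, momentFF φ i j k l * Λ k l := by
  have e : ∀ k l, kernelMoment α φ i j k l * Λ k l =
      ((B : ℝ) - 3 + 2 * α) * (if i = k then if j = l then moment (deriv φ) i j * Λ k l else 0 else 0)
      - α * (if i = k then momentFD φ j i l * Λ k l else 0)
      - α * (if j = l then momentFD φ i j k * Λ k l else 0) +
      α ^ 2 / ((B : ℝ) - 1 + 2 * α) * (momentFF φ i j k l * Λ k l) := by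
    intro k l
    unfold kernelMoment
    split_ifs <;> ring
  simp_rw [e, Finset.sum_add_distrib, Finset.sum_sub_distrib, ← Finset.mul_sum]
  congr 3
  · congr 2
    rw [Finset.sum_eq_single i (fun k _ hk => by simp [hk.symm]) (by simp)]; simp
  · congr 1
    rw [Finset.sum_comm]; simp
  · simp

/-- In each sum of E[φφ'g] moments the constant part drops out with the row sum, leaving Λ_ij with
weight `crossFD` - `otherFD` and a diagonal entry with weight αJ - `otherFD`. -/
lemma IsPosHomogeneous.sum_kernelMoment_off (h : IsPosHomogeneous α φ) (hα : 1 / 2 < α)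
    (hB : 4 ≤ B) {J D : ℝ} (hJ : J = homJ α φ (coordCorr B))
    (hD : D = deriv (homJ α φ) (coordCorr B)) {i j : Fin B} (hij : i ≠ j)
    {Λ : Matrix (Fin B) (Fin B) ℝ} (hs : Λ.IsSymm) (hr : ∀ i, ∑ j, Λ i j = 0) :
    ∑ k, ∑ l, kernelMoment α φ i j k l * Λ k l = momentScale B α *
      (coeffOff B α J D * Λ i j + coeffOffDiag B α J D * (Λ i i + Λ j j) +
        coeffOffTrace B α J D * Λ.trace) := by
  have hc : ∀ j, ∑ i, Λ i j = 0 := fun j => by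
    rw [← hr j]; exact Finset.sum_congr rfl fun i _ => hs.apply j i
  rw [sum_kernelMoment_mul]
  simp_rw [h.momentFF_off hα hB hJ hD hij, h.momentFD_off hα hB hJ hD hij,
    h.momentFD_off hα hB hJ hD hij.symm, mul_assoc, ← Finset.mul_sum,
    sum_orbitMatrix_mul _ _ _ _ _ i j hs hr, add_mul, Finset.sum_add_distrib, mul_assoc,
    ← Finset.mul_sum, hr, hc, ite_mul, zero_mul, one_mul]
  simp only [Finset.sum_ite_eq, Finset.mem_univ, if_true]
  have hm := h.moment_deriv_of_ne hα hB hij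
  rw [← hD, coordVar, div_div_eq_mul_div] at hm
  rw [hm, coeffOff, coeffOffDiag, coeffOffTrace]
  ring

lemma IsPosHomogeneous.sum_kernelMoment_diag (h : IsPosHomogeneous α φ) (hα : 1 / 2 < α)
    (hB : 4 ≤ B) {J₁ : ℝ} (hJ : J₁ = homJ α φ 1) (i : Fin B)
    {Λ : Matrix (Fin B) (Fin B) ℝ} (hs : Λ.IsSymm) (hr : ∀ i, ∑ j, Λ i j = 0) :
    ∑ k, ∑ l, kernelMoment α φ i i k l * Λ k l = momentScale B α *
      (coeffDiag B α J₁ * Λ i i + coeffDiagTrace B α J₁ * Λ.trace) := by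
  have hB' : (4 : ℝ) ≤ B := by exact_mod_cast hB
  have hb0 : (B : ℝ) ≠ 0 := by linarith
  have hb1 : (B : ℝ) - 1 ≠ 0 := by linarith
  have h2 : 2 * α - 1 ≠ 0 := by linarith
  have hc : ∀ j, ∑ i, Λ i j = 0 := fun j => by
    rw [← hr j]; exact Finset.sum_congr rfl fun i _ => hs.apply j i
  rw [sum_kernelMoment_mul]
  simp_rw [h.momentFF_diag hα hB hJ, h.momentFD_self hα hB hJ, mul_assoc, ← Finset.mul_sum,
    sum_selfOrbitMatrix_mul _ _ _ _ i hs hr, add_mul, Finset.sum_add_distrib, mul_assoc,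
    ← Finset.mul_sum, hr, hc, ite_mul, zero_mul, one_mul]
  simp only [Finset.sum_ite_eq, Finset.mem_univ, if_true]
  have hm : moment (deriv φ) i i =
      momentScale B α * (α ^ 2 * J₁ * B / ((2 * α - 1) * (B - 1))) := by
    rw [h.moment_deriv_self hα hB i, ← hJ, coordVar]
    field_simp
  rw [hm, coeffDiag, coeffDiagTrace]
  ring

end BatchNorm

namespace BatchNorm

/-! ### Closed forms of the eigenvalues -/

section ClosedForms

variable {b α J₁ J D : ℝ}

lemma crossFF_eq (hb : 4 ≤ b) :
    crossFF b α J D = (b - 2) / (b - 1) * D - (2 * α + 1) / b * J := by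
  have h0 : b ≠ 0 := by linarith
  have h1 : b - 1 ≠ 0 := by linarith
  unfold crossFF
  field_simp
  ring

lemma leftFF_eq (hb : 4 ≤ b) : leftFF b α J D =
    -((b - 2) / (b - 1) ^ 2 * D) + ((2 * α + 1) / (b * (b - 1)) + (b - 2) * (1 + α) / (b - 1)) * J := by
  have h0 : b ≠ 0 := by linarith
  have h1 : b - 1 ≠ 0 := by linarith
  rw [leftFF, crossFF_eq hb]
  field_simp
  ring

lemma mixedFF_eq (hb : 4 ≤ b) : mixedFF b α J D =
    -((b - 2) / (b - 1) ^ 2 * D) + (2 * α - b * (1 + α) + 1) / (b * (b - 1)) * J := by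
  have h0 : b ≠ 0 := by linarith
  have h1 : b - 1 ≠ 0 := by linarith
  have h2 : b - 2 ≠ 0 := by linarith
  rw [mixedFF, leftFF_eq hb, crossFF_eq hb]
  field_simp
  ring

lemma squareFF_eq (hb : 4 ≤ b) : squareFF b α J D =
    2 / (b - 1) ^ 2 * D + (b ^ 2 - b + 2 * α + 1 - b) / (b * (b - 1)) * J := by
  have h0 : b ≠ 0 := by linarith
  have h1 : b - 1 ≠ 0 := by linarith
  have h2 : b - 2 ≠ 0 := by linarith
  rw [squareFF, leftFF_eq hb]
  field_simp
  ring

lemma otherFF_eq (hb : 4 ≤ b) : otherFF b α J D =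
    2 / (b - 1) ^ 2 * D + (2 * α + 1 - b) / (b * (b - 1)) * J := by
  have h0 : b ≠ 0 := by linarith
  have h1 : b - 1 ≠ 0 := by linarith
  have h2 : b - 2 ≠ 0 := by linarith
  have h3 : b - 3 ≠ 0 := by linarith
  rw [otherFF, squareFF_eq hb, mixedFF_eq hb]
  field_simp
  ring

lemma otherFD_eq (hb : 4 ≤ b) : otherFD b α J D =
    -(b / (b - 1) ^ 2 * D) - α / (b - 1) * J := by
  have h1 : b - 1 ≠ 0 := by linarith
  have h2 : b - 2 ≠ 0 := by linarith
  rw [otherFD, crossFD]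
  field_simp
  ring

/-- The contributions of J cancel. For this reason 𝕁_φ(c) enters λ_𝕄 only through Δ. -/
lemma coeffOff_eq (hb : 4 ≤ b) (hα : 1 / 2 < α) : coeffOff b α J D =
    b * (b ^ 2 + 2 * (α - 2) * b + 2 * (α - 3) * α + 3) / ((b - 1) * (b - 1 + 2 * α)) * D := by
  have h0 : b ≠ 0 := by linarith
  have h1 : b - 1 ≠ 0 := by linarith
  have h4 : b - 1 + 2 * α ≠ 0 := by linarith
  rw [coeffOff, otherFD_eq hb, crossFF_eq hb, mixedFF_eq hb, otherFF_eq hb, crossFD]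
  field_simp
  ring

lemma eigenvalueM_eq (hb : 4 ≤ b) (hα : 1 / 2 < α) (hJ : J₁ - J ≠ 0) :
    coeffOff b α J D / ((b - 3) * (J₁ - J)) = eigenvalueM α b J₁ J D := by
  have h1 : b - 1 ≠ 0 := by linarith
  have h3 : b - 3 ≠ 0 := by linarith
  have h4 : b - 1 + 2 * α ≠ 0 := by linarith
  rw [coeffOff_eq hb hα, eigenvalueM]
  field_simp

lemma selfMixedFF_eq (hb : 4 ≤ b) : selfMixedFF b α J₁ = -((2 * α + 1) / b * J₁) := by
  have h0 : b ≠ 0 := by linarith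
  have h1 : b - 1 ≠ 0 := by linarith
  rw [selfMixedFF, selfFF]
  field_simp

lemma selfSquareFF_eq (hb : 4 ≤ b) : selfSquareFF b α J₁ =
    (b ^ 2 - 2 * b + 1 + 2 * α) / (b * (b - 1)) * J₁ := by
  have h0 : b ≠ 0 := by linarith
  have h1 : b - 1 ≠ 0 := by linarith
  rw [selfSquareFF, selfFF]
  field_simp
  ring

lemma selfOtherFF_eq (hb : 4 ≤ b) : selfOtherFF b α J₁ =
    (2 * α + 1 - b) / (b * (b - 1)) * J₁ := by
  have h0 : b ≠ 0 := by linarith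
  have h1 : b - 1 ≠ 0 := by linarith
  have h2 : b - 2 ≠ 0 := by linarith
  rw [selfOtherFF, selfSquareFF_eq hb, selfMixedFF_eq hb]
  field_simp
  ring

/-- For Λ = GDG the diagonal is (1-2/B)d_i and the off-diagonal entries are -(d_i+d_j)/B, so 𝓕Λ is
u_i + u_j off the diagonal with u proportional to d. The left side is the diagonal coefficient minus
2u_i/d_i. -/
lemma eigenvalueL_eq (hb : 4 ≤ b) (hα : 1 / 2 < α) (hJ : J₁ - J ≠ 0) :
    (coeffDiag b α J₁ * (1 - 2 / b) + 2 * (coeffOff b α J D / b) -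
      2 * (coeffOffDiag b α J D * (1 - 2 / b))) / ((b - 3) * (J₁ - J)) =
      eigenvalueL α b J₁ J D := by
  have h0 : b ≠ 0 := by linarith
  have h1 : b - 1 ≠ 0 := by linarith
  have h3 : b - 3 ≠ 0 := by linarith
  have h4 : b - 1 + 2 * α ≠ 0 := by linarith
  have h5 : 2 * α - 1 ≠ 0 := by linarith
  rw [coeffOff_eq hb hα, coeffDiag, coeffOffDiag, otherFD_eq hb, leftFF_eq hb, squareFF_eq hb,
    mixedFF_eq hb, otherFF_eq hb, selfMixedFF_eq hb, selfSquareFF_eq hb, selfOtherFF_eq hb,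
    selfFF, eigenvalueL]
  field_simp
  ring

/-- The left side is the diagonal minus the off-diagonal entry of 𝓕(G), computed from G_ii = 1 -
1/B, G_ij = -1/B and tr G = B - 1. -/
lemma eigenvalueG_eq (hb : 4 ≤ b) (hα : 1 / 2 < α) (hJ : J₁ - J ≠ 0) :
    (coeffDiag b α J₁ * (1 - 1 / b) + coeffDiagTrace b α J₁ * (b - 1) -
      (-(coeffOff b α J D / b) + 2 * (coeffOffDiag b α J D * (1 - 1 / b)) +
        coeffOffTrace b α J D * (b - 1))) / ((b - 3) * (J₁ - J)) =
      eigenvalueG α b J₁ J D := by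
  have h0 : b ≠ 0 := by linarith
  have h1 : b - 1 ≠ 0 := by linarith
  have h3 : b - 3 ≠ 0 := by linarith
  have h4 : b - 1 + 2 * α ≠ 0 := by linarith
  have h5 : 2 * α - 1 ≠ 0 := by linarith
  rw [coeffOff_eq hb hα, coeffDiag, coeffOffDiag, coeffOffTrace, coeffDiagTrace, otherFD_eq hb,
    leftFF_eq hb, squareFF_eq hb,
    mixedFF_eq hb, otherFF_eq hb, selfMixedFF_eq hb, selfSquareFF_eq hb, selfOtherFF_eq hb,
    selfFF, eigenvalueG]
  field_simp
  ring

/-- The hypothesis `hD` is the rule 𝕁_φ' = α²/(2α-1) 𝕁_(φ'/α), supplied by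
`IsPosHomogeneous.hasDerivAt_homJ`. -/
lemma eigenvalueG_eq_eigenvalueG' (hb : 4 ≤ b) (hα : 1 / 2 < α) (hJ : J₁ - J ≠ 0) {jd : ℝ}
    (hD : D = α ^ 2 / (2 * α - 1) * jd) :
    eigenvalueG α b J₁ J D = eigenvalueG' α b J₁ J jd := by
  have h1 : b - 1 ≠ 0 := by linarith
  have h3 : b - 3 ≠ 0 := by linarith
  have h5 : 2 * α - 1 ≠ 0 := by linarith
  rw [eigenvalueG, eigenvalueG', hD]
  field_simp
  ring

lemma eigenvalueG_eq_eigenvalueG'' (hb : 4 ≤ b) (hα : 1 / 2 < α) (hJ : J₁ - J ≠ 0) {jd : ℝ}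
    (hD : D = α ^ 2 / (2 * α - 1) * jd) :
    eigenvalueG α b J₁ J D = eigenvalueG'' α b J₁ J jd := by
  have h1 : b - 1 ≠ 0 := by linarith
  have h3 : b - 3 ≠ 0 := by linarith
  have h5 : 2 * α - 1 ≠ 0 := by linarith
  rw [eigenvalueG, eigenvalueG'', hD]
  field_simp
  ring

end ClosedForms

end BatchNorm

namespace BatchNorm

/-! ### The invariant subspaces -/

variable {B : ℕ}

lemma centering_mul_of_sum_eq_zero {M : Matrix (Fin B) (Fin B) ℝ} (h : ∀ j, ∑ i, M i j = 0) :
    centering B * M = M := by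
  ext i j
  simp [Matrix.mul_apply, centering_apply, sub_mul, Finset.sum_sub_distrib, ← Finset.mul_sum, h]

lemma mul_centering_of_sum_eq_zero {M : Matrix (Fin B) (Fin B) ℝ} (h : ∀ i, ∑ j, M i j = 0) :
    M * centering B = M := by
  ext i j
  simp [Matrix.mul_apply, centering_apply, mul_sub, Finset.sum_sub_distrib, ← Finset.sum_mul, h]

lemma sum_row_of_mem_spaceH (hB : B ≠ 0) {Λ : Matrix (Fin B) (Fin B) ℝ} (h : Λ ∈ spaceH B)
    (i : Fin B) : ∑ j, Λ i j = 0 := by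
  rw [← h.2, centerOp_apply]
  simp_rw [Matrix.mul_apply (M := centering B * Λ)]
  rw [Finset.sum_comm]
  simp [← Finset.mul_sum, sum_centering_row hB]

lemma mem_spaceH_of_sum_eq_zero {Λ : Matrix (Fin B) (Fin B) ℝ} (hs : Λ.IsSymm)
    (hr : ∀ i, ∑ j, Λ i j = 0) : Λ ∈ spaceH B := by
  refine ⟨hs, ?_⟩
  rw [centerOp_apply, centering_mul_of_sum_eq_zero fun j => ?_, mul_centering_of_sum_eq_zero hr]
  rw [← hr j]
  exact Finset.sum_congr rfl fun i _ => hs.apply j i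

lemma centerOp_diagonal_apply {d : Fin B → ℝ} (hd : ∑ i, d i = 0) (i j : Fin B) :
    centerOp B (Matrix.diagonal d) i j =
      (if i = j then d i else 0) - (d i + d j) / B := by
  have e : ∀ k, centering B i k * d k * centering B k j =
      (if i = k then d k * centering B k j else 0) - 1 / B * (if k = j then d k else 0) +
        1 / B * (1 / B) * d k := by
    intro k
    simp only [centering_apply]
    split_ifs <;> ring
  rw [centerOp_apply, Matrix.mul_apply]
  simp_rw [Matrix.mul_diagonal, e, Finset.sum_add_distrib, Finset.sum_sub_distrib,
    ← Finset.mul_sum, hd]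
  simp only [Finset.sum_ite_eq, Finset.sum_ite_eq', Finset.mem_univ, if_true, centering_apply]
  split_ifs <;> ring

lemma isSymm_centering : (centering B).IsSymm := transpose_centering

lemma centering_mem_spaceH (hB : B ≠ 0) : centering B ∈ spaceH B :=
  ⟨isSymm_centering, by rw [centerOp_apply, centering_mul_self hB, centering_mul_self hB]⟩

lemma spaceG_le (hB : B ≠ 0) : spaceG B ≤ spaceH B := by
  rw [spaceG, Submodule.span_singleton_le_iff_mem]
  exact centering_mem_spaceH hB

lemma spaceL_le (hB : B ≠ 0) : spaceL B ≤ spaceH B := by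
  rintro _ ⟨d, hd, rfl⟩
  refine ⟨?_, ?_⟩
  · ext i j
    rw [Matrix.transpose_apply, centerOp_diagonal_apply hd, centerOp_diagonal_apply hd]
    rcases eq_or_ne i j with rfl | hij
    · rfl
    · rw [if_neg hij, if_neg hij.symm, add_comm]
  · simp only [centerOp_apply, mul_assoc, centering_mul_self hB]
    rw [← mul_assoc, centering_mul_self hB]

lemma spaceM_le : spaceM B ≤ spaceH B := fun _ h => h.1

lemma centerOp_diagonal_diag {d : Fin B → ℝ} (hd : ∑ i, d i = 0) (i : Fin B) :
    centerOp B (Matrix.diagonal d) i i = d i * (1 - 2 / B) := by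
  rw [centerOp_diagonal_apply hd, if_pos rfl]
  ring

lemma trace_centerOp_diagonal {d : Fin B → ℝ} (hd : ∑ i, d i = 0) :
    (centerOp B (Matrix.diagonal d)).trace = 0 := by
  simp only [Matrix.trace, Matrix.diag_apply, centerOp_diagonal_diag hd]
  rw [← Finset.sum_mul, hd, zero_mul]

lemma trace_centering (hB : B ≠ 0) : (centering B).trace = (B : ℝ) - 1 := by
  have : (B : ℝ) ≠ 0 := by exact_mod_cast hB
  simp [Matrix.trace, centering_apply]
  field_simp

lemma trace_eq_zero_of_mem_spaceL {X : Matrix (Fin B) (Fin B) ℝ} (h : X ∈ spaceL B) :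
    X.trace = 0 := by
  obtain ⟨d, hd, rfl⟩ := h
  exact trace_centerOp_diagonal hd

lemma trace_eq_zero_of_mem_spaceM {X : Matrix (Fin B) (Fin B) ℝ} (h : X ∈ spaceM B) :
    X.trace = 0 := by
  rw [Matrix.trace, h.2]; simp

lemma sup_eq_spaceH (hB : 4 ≤ B) : spaceG B ⊔ spaceL B ⊔ spaceM B = spaceH B := by
  have hB' : (4 : ℝ) ≤ B := by exact_mod_cast hB
  have hb0 : (B : ℝ) ≠ 0 := by linarith
  have hb1 : (B : ℝ) - 1 ≠ 0 := by linarith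
  have hb2 : (B : ℝ) - 2 ≠ 0 := by linarith
  refine le_antisymm (sup_le (sup_le (spaceG_le (by omega)) (spaceL_le (by omega))) spaceM_le) ?_
  intro Λ hΛ
  -- Since tr G = B - 1, this q matches the trace; d then matches the remaining diagonal, because
  -- GDG has diagonal (1-2/B)d_i.
  set q := Λ.trace / ((B : ℝ) - 1) with hq
  set d : Fin B → ℝ := fun i => (Λ i i - q * (1 - 1 / B)) / (1 - 2 / B) with hd
  have hd0 : ∑ i, d i = 0 := by
    simp only [hd]
    rw [← Finset.sum_div, Finset.sum_sub_distrib]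
    have : ∑ i, Λ i i = Λ.trace := rfl
    rw [this, Finset.sum_const, Finset.card_univ, Fintype.card_fin, nsmul_eq_mul, hq]
    field_simp
    simp
  have hG : q • centering B ∈ spaceG B :=
    Submodule.smul_mem _ _ (Submodule.mem_span_singleton_self _)
  have hL : centerOp B (Matrix.diagonal d) ∈ spaceL B := ⟨d, hd0, rfl⟩
  have hM : Λ - q • centering B - centerOp B (Matrix.diagonal d) ∈ spaceM B := by
    refine ⟨sub_mem (sub_mem hΛ (spaceG_le (by omega) hG)) (spaceL_le (by omega) hL), ?_⟩
    ext i
    rw [Matrix.diag_apply, Matrix.sub_apply, Matrix.sub_apply, centerOp_diagonal_diag hd0]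
    simp only [Matrix.smul_apply, smul_eq_mul, centering_apply, if_true, Pi.zero_apply, hd]
    have : (1 : ℝ) - 2 / B ≠ 0 := by
      rw [one_sub_div hb0]; exact div_ne_zero hb2 hb0
    rw [div_mul_cancel₀ _ this]
    ring
  rw [show Λ = q • centering B + centerOp B (Matrix.diagonal d) +
    (Λ - q • centering B - centerOp B (Matrix.diagonal d)) by abel]
  exact Submodule.add_mem_sup (Submodule.add_mem_sup hG hL) hM

lemma exists_add_of_mem_spaceH (hB : 4 ≤ B) {Y : Matrix (Fin B) (Fin B) ℝ} (hY : Y ∈ spaceH B) :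
    ∃ g ∈ spaceG B, ∃ l ∈ spaceL B, ∃ m ∈ spaceM B, Y = g + l + m := by
  rw [← sup_eq_spaceH hB] at hY
  obtain ⟨gl, hgl, m, hm, rfl⟩ := Submodule.mem_sup.1 hY
  obtain ⟨g, hg, l, hl, rfl⟩ := Submodule.mem_sup.1 hgl
  exact ⟨g, hg, l, hl, m, hm, rfl⟩

lemma spaceG_ne_bot (hB : 4 ≤ B) : spaceG B ≠ ⊥ := by
  rw [spaceG, Ne, Submodule.span_singleton_eq_bot]
  exact centering_ne_zero (by omega)

lemma spaceL_ne_bot (hB : 4 ≤ B) : spaceL B ≠ ⊥ := by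
  have hB' : (4 : ℝ) ≤ B := by exact_mod_cast hB
  rw [Submodule.ne_bot_iff]
  set i₀ : Fin B := ⟨0, by omega⟩
  set i₁ : Fin B := ⟨1, by omega⟩
  have h01 : i₀ ≠ i₁ := by simp [i₀, i₁]
  have hd : ∑ i, (Pi.single i₀ (1 : ℝ) - Pi.single i₁ 1 : Fin B → ℝ) i = 0 := by
    simp [Finset.sum_sub_distrib]
  refine ⟨_, ⟨_, hd, rfl⟩, fun h => ?_⟩
  have h2 := congrFun (congrFun h i₀) i₀
  rw [centerOp_diagonal_diag hd] at h2
  simp [h01] at h2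
  field_simp at h2
  linarith

lemma spaceM_ne_bot (hB : 4 ≤ B) : spaceM B ≠ ⊥ := by
  rw [Submodule.ne_bot_iff]
  set i₀ : Fin B := ⟨0, by omega⟩
  set i₁ : Fin B := ⟨1, by omega⟩
  set i₂ : Fin B := ⟨2, by omega⟩
  set i₃ : Fin B := ⟨3, by omega⟩
  -- Two sum-zero vectors with disjoint supports: u vᵀ + v uᵀ then has zero diagonal. This is where
  -- four indices are used.
  set u : Fin B → ℝ := Pi.single i₀ 1 - Pi.single i₂ 1 with hu
  set v : Fin B → ℝ := Pi.single i₁ 1 - Pi.single i₃ 1 with hv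
  have su : ∑ i, u i = 0 := by simp [hu, Finset.sum_sub_distrib]
  have sv : ∑ i, v i = 0 := by simp [hv, Finset.sum_sub_distrib]
  refine ⟨Matrix.of fun i j => u i * v j + v i * u j, ⟨mem_spaceH_of_sum_eq_zero ?_ ?_, ?_⟩,
    fun h => ?_⟩
  · ext i j
    simp only [Matrix.transpose_apply, Matrix.of_apply]
    ring
  · intro i
    simp only [Matrix.of_apply, Finset.sum_add_distrib, ← Finset.mul_sum, su, sv]
    ring
  · ext i
    simp only [Matrix.diag_apply, Matrix.of_apply, Pi.zero_apply, hu, hv, Pi.sub_apply,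
      Pi.single_apply]
    by_cases h0 : i = i₀
    · subst h0; simp [i₀, i₁, i₂, i₃]
    by_cases h2 : i = i₂
    · subst h2; simp [i₀, i₁, i₂, i₃]
    simp [h0, h2]
  · have h2 := congrFun (congrFun h i₀) i₁
    simp [hu, hv, Pi.single_apply, i₀, i₁, i₂, i₃] at h2

lemma traceOrthogonal_spaceG {W : Submodule ℝ (Matrix (Fin B) (Fin B) ℝ)} (hB : B ≠ 0)
    (hW : W ≤ spaceH B) (ht : ∀ Y ∈ W, Y.trace = 0) : TraceOrthogonal (spaceG B) W := by
  intro X hX Y hY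
  obtain ⟨q, rfl⟩ := Submodule.mem_span_singleton.1 hX
  rw [Matrix.transpose_smul, transpose_centering, Matrix.smul_mul,
    centering_mul_of_sum_eq_zero fun j => ?_, Matrix.trace_smul, ht Y hY, smul_zero]
  rw [← sum_row_of_mem_spaceH hB (hW hY) j]
  exact Finset.sum_congr rfl fun i _ => (hW hY).1.apply j i

lemma trace_transpose_centerOp_mul (X Y : Matrix (Fin B) (Fin B) ℝ) :
    ((centerOp B X).transpose * Y).trace = (X.transpose * centerOp B Y).trace := by
  simp only [centerOp_apply, Matrix.transpose_mul, transpose_centering]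
  rw [Matrix.mul_assoc, Matrix.trace_mul_comm]
  simp only [Matrix.mul_assoc]

lemma traceOrthogonal_spaceL_spaceM : TraceOrthogonal (spaceL B) (spaceM B) := by
  rintro _ ⟨d, hd, rfl⟩ Y hY
  rw [trace_transpose_centerOp_mul, hY.1.2, Matrix.diagonal_transpose]
  have : ∀ i, Y i i = 0 := fun i => congrFun hY.2 i
  simp [Matrix.trace, Matrix.diagonal_mul, this]

lemma eq_zero_of_trace_transpose_mul_self {X : Matrix (Fin B) (Fin B) ℝ}
    (h : (X.transpose * X).trace = 0) : X = 0 := by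
  rw [← Matrix.conjTranspose_eq_transpose_of_trivial] at h
  exact Matrix.trace_conjTranspose_mul_self_eq_zero_iff.1 h

lemma TraceOrthogonal.symm {U W : Submodule ℝ (Matrix (Fin B) (Fin B) ℝ)}
    (h : TraceOrthogonal U W) : TraceOrthogonal W U := by
  intro X hX Y hY
  rw [← Matrix.trace_transpose, Matrix.transpose_mul, Matrix.transpose_transpose]
  exact h Y hY X hX

/-- The eigenvalues of an operator with the three eigenspaces pass to its adjoint. -/
lemma HasEigenvaluesGLM.adjoint (hB : 4 ≤ B) {F T : Module.End ℝ (Matrix (Fin B) (Fin B) ℝ)}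
    {lG lL lM : ℝ} (hF : HasEigenvaluesGLM F lG lL lM)
    (hadj : ∀ X ∈ spaceH B, ∀ Y ∈ spaceH B,
      ((T X).transpose * Y).trace = (X.transpose * F Y).trace)
    (hT : ∀ X ∈ spaceH B, T X ∈ spaceH B) : HasEigenvaluesGLM T lG lL lM := by
  have oGL := traceOrthogonal_spaceG (by omega) (spaceL_le (by omega))
    fun Y (hY : Y ∈ spaceL B) => trace_eq_zero_of_mem_spaceL hY
  have oGM := traceOrthogonal_spaceG (by omega) spaceM_le
    fun Y (hY : Y ∈ spaceM B) => trace_eq_zero_of_mem_spaceM hY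
  have oLM := traceOrthogonal_spaceL_spaceM (B := B)
  obtain ⟨-, hG, hL, hM⟩ := hF
  -- The matrix TX - λX lies in ℍ^G and is orthogonal to all of ℍ^G, hence to itself.
  have key : ∀ X ∈ spaceH B, ∀ lam : ℝ, (∀ Y ∈ spaceH B,
      (X.transpose * F Y).trace = lam * (X.transpose * Y).trace) → T X = lam • X := by
    intro X hX lam h
    have hmem : T X - lam • X ∈ spaceH B := sub_mem (hT X hX) (Submodule.smul_mem _ _ hX)
    have h0 : ((T X - lam • X).transpose * (T X - lam • X)).trace = 0 := by
      generalize hY : T X - lam • X = Y at hmem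
      nth_rewrite 1 [← hY]
      rw [Matrix.transpose_sub, sub_mul, Matrix.trace_sub, hadj X hX Y hmem, h Y hmem,
        Matrix.transpose_smul, Matrix.smul_mul, Matrix.trace_smul, smul_eq_mul, sub_self]
    exact sub_eq_zero.1 (eq_zero_of_trace_transpose_mul_self h0)
  refine ⟨hT, fun X hX => ?_, fun X hX => ?_, fun X hX => ?_⟩ <;>
    rw [Module.End.mem_eigenspace_iff]
  · refine key X (spaceG_le (by omega) hX) lG fun Y hY => ?_
    obtain ⟨g, hg, l, hl, m, hm, rfl⟩ := exists_add_of_mem_spaceH hB hY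
    rw [map_add, map_add, Module.End.mem_eigenspace_iff.1 (hG hg),
      Module.End.mem_eigenspace_iff.1 (hL hl), Module.End.mem_eigenspace_iff.1 (hM hm)]
    simp only [mul_add, Matrix.mul_smul, Matrix.trace_add, Matrix.trace_smul, smul_eq_mul,
      oGL X hX l hl, oGM X hX m hm]
    ring
  · refine key X (spaceL_le (by omega) hX) lL fun Y hY => ?_
    obtain ⟨g, hg, l, hl, m, hm, rfl⟩ := exists_add_of_mem_spaceH hB hY
    rw [map_add, map_add, Module.End.mem_eigenspace_iff.1 (hG hg),
      Module.End.mem_eigenspace_iff.1 (hL hl), Module.End.mem_eigenspace_iff.1 (hM hm)]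
    simp only [mul_add, Matrix.mul_smul, Matrix.trace_add, Matrix.trace_smul, smul_eq_mul,
      oGL.symm X hX g hg, oLM X hX m hm]
    ring
  · refine key X (spaceM_le hX) lM fun Y hY => ?_
    obtain ⟨g, hg, l, hl, m, hm, rfl⟩ := exists_add_of_mem_spaceH hB hY
    rw [map_add, map_add, Module.End.mem_eigenspace_iff.1 (hG hg),
      Module.End.mem_eigenspace_iff.1 (hL hl), Module.End.mem_eigenspace_iff.1 (hM hm)]
    simp only [mul_add, Matrix.mul_smul, Matrix.trace_add, Matrix.trace_smul, smul_eq_mul,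
      oGM.symm X hX g hg, oLM.symm X hX l hl]
    ring

/-- An operator acting as a scalar on each of the three spaces preserves their sum. -/
lemma hasEigenvaluesGLM_of_le (hB : 4 ≤ B) {F : Module.End ℝ (Matrix (Fin B) (Fin B) ℝ)}
    {lG lL lM : ℝ} (hG : spaceG B ≤ Module.End.eigenspace F lG)
    (hL : spaceL B ≤ Module.End.eigenspace F lL)
    (hM : spaceM B ≤ Module.End.eigenspace F lM) : HasEigenvaluesGLM F lG lL lM := by
  refine ⟨fun Y hY => ?_, hG, hL, hM⟩
  obtain ⟨g, hg, l, hl, m, hm, rfl⟩ := exists_add_of_mem_spaceH hB hY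
  rw [map_add, map_add, Module.End.mem_eigenspace_iff.1 (hG hg),
    Module.End.mem_eigenspace_iff.1 (hL hl), Module.End.mem_eigenspace_iff.1 (hM hm)]
  exact add_mem (add_mem (Submodule.smul_mem _ _ (spaceG_le (by omega) hg))
    (Submodule.smul_mem _ _ (spaceL_le (by omega) hl))) (Submodule.smul_mem _ _ (spaceM_le hm))

end BatchNorm

namespace BatchNorm

/-! ### The operators at the fixed point -/

variable {B : ℕ} {α : ℝ} {φ : ℝ → ℝ}

lemma secondMomentOp_apply (T : EuclideanSpace ℝ (Fin B) → Matrix (Fin B) (Fin B) ℝ)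
    (S Λ : Matrix (Fin B) (Fin B) ℝ) (i j : Fin B) :
    secondMomentOp T S Λ i j =
      ∑ k, ∑ l, (∫ h, T h i k * T h j l ∂(gaussianLaw S)) * Λ k l := rfl

lemma isSymm_secondMomentOp (T : EuclideanSpace ℝ (Fin B) → Matrix (Fin B) (Fin B) ℝ)
    (S : Matrix (Fin B) (Fin B) ℝ) {Λ : Matrix (Fin B) (Fin B) ℝ} (hΛ : Λ.IsSymm) :
    (secondMomentOp T S Λ).IsSymm := by
  ext i j
  rw [Matrix.transpose_apply, secondMomentOp_apply, secondMomentOp_apply, Finset.sum_comm]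
  refine Finset.sum_congr rfl fun k _ => Finset.sum_congr rfl fun l _ => ?_
  rw [hΛ.apply]
  simp_rw [mul_comm]

lemma IsPosHomogeneous.hasSecondMoments_jacobian (h : IsPosHomogeneous α φ) (hα : 1 / 2 < α)
    (hB : 4 ≤ B) (hφ : φ ≠ 0) :
    HasSecondMoments (fun x => jacobian (phiNormalize φ) (center x)) (fixedCov B α φ) :=
  fun i j k l => (h.jacobian_mul_fixedCov hα hB hφ i j k l).1

/-- The second moment of two entries of the Jacobian at the fixed point. -/
noncomputable def jacobianMoment (α : ℝ) (φ : ℝ → ℝ) (i j k l : Fin B) : ℝ :=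
  ∫ x, jacobian (phiNormalize φ) (center x) i k * jacobian (phiNormalize φ) (center x) j l
      ∂(gaussianLaw (fixedCov B α φ))

lemma backwardF_apply (Λ : Matrix (Fin B) (Fin B) ℝ) (i j : Fin B) :
    backwardF φ (fixedCov B α φ) Λ i j = ∑ k, ∑ l, jacobianMoment α φ i j k l * Λ k l := rfl

lemma IsPosHomogeneous.jacobian_batchNorm_mul_ae (h : IsPosHomogeneous α φ) (hα : 1 / 2 < α)
    (hB : 4 ≤ B) (hφ : φ ≠ 0) (i j k l : Fin B) :
    (fun x => (jacobian (batchNorm φ) x).transpose i k * (jacobian (batchNorm φ) x).transpose j l)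
      =ᵐ[gaussianLaw (fixedCov B α φ)] fun x => ∑ a, ∑ b, centering B a i * centering B b j *
        (jacobian (phiNormalize φ) (center x) k a * jacobian (phiNormalize φ) (center x) l b) := by
  have hab : 0 < fixedScale B α * diagMoment B α φ - fixedScale B α * offMoment B α φ := by
    rw [← mul_sub]
    exact mul_pos (fixedScale_pos hα hB) (by linarith [h.offMoment_lt_diagMoment hα hB hφ])
  filter_upwards [ae_center_ne_zero (by omega) (h.posSemidef_fixedCov hα hB) hab] with x hx
  rw [Matrix.transpose_apply, Matrix.transpose_apply, h.jacobian_batchNorm (by omega) hx,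
    Matrix.mul_apply, Matrix.mul_apply, Finset.sum_mul_sum]
  exact Finset.sum_congr rfl fun a _ => Finset.sum_congr rfl fun b _ => by ring

lemma IsPosHomogeneous.hasSecondMoments_jacobian_batchNorm (h : IsPosHomogeneous α φ)
    (hα : 1 / 2 < α) (hB : 4 ≤ B) (hφ : φ ≠ 0) :
    HasSecondMoments (fun x => (jacobian (batchNorm φ) x).transpose) (fixedCov B α φ) :=
  fun i j k l => (integrable_finsetSum _ fun a _ => integrable_finsetSum _ fun b _ =>
    (h.jacobian_mul_fixedCov hα hB hφ k l a b).1.const_mul _).congr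
    (h.jacobian_batchNorm_mul_ae hα hB hφ i j k l).symm

lemma IsPosHomogeneous.backwardOp_apply (h : IsPosHomogeneous α φ) (hα : 1 / 2 < α)
    (hB : 4 ≤ B) (hφ : φ ≠ 0) (P : Matrix (Fin B) (Fin B) ℝ) (i j : Fin B) :
    backwardOp φ (fixedCov B α φ) P i j = ∑ k, ∑ l, (∑ a, ∑ b,
      centering B a i * centering B b j * jacobianMoment α φ k l a b) * P k l := by
  rw [backwardOp, secondMomentOp_apply]
  refine Finset.sum_congr rfl fun k _ => Finset.sum_congr rfl fun l _ => ?_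
  rw [integral_congr_ae (h.jacobian_batchNorm_mul_ae hα hB hφ i j k l),
    integral_finsetSum _ fun a _ => integrable_finsetSum _ fun b _ =>
      (h.jacobian_mul_fixedCov hα hB hφ k l a b).1.const_mul _]
  congr 1
  refine Finset.sum_congr rfl fun a _ => ?_
  rw [integral_finsetSum _ fun b _ => (h.jacobian_mul_fixedCov hα hB hφ k l a b).1.const_mul _]
  exact Finset.sum_congr rfl fun b _ => integral_const_mul _ _

lemma trace_transpose_mul_eq (X Y : Matrix (Fin B) (Fin B) ℝ) :
    (X.transpose * Y).trace = ∑ i, ∑ j, X i j * Y i j := by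
  simp only [Matrix.trace, Matrix.diag_apply, Matrix.mul_apply, Matrix.transpose_apply]
  exact Finset.sum_comm

lemma centerOp_entry (Y : Matrix (Fin B) (Fin B) ℝ) (a b : Fin B) :
    centerOp B Y a b = ∑ i, ∑ j, centering B a i * centering B b j * Y i j := by
  rw [centerOp_apply, Matrix.mul_apply, Finset.sum_comm]
  refine Finset.sum_congr rfl fun j _ => ?_
  rw [Matrix.mul_apply, Finset.sum_mul]
  refine Finset.sum_congr rfl fun i _ => ?_
  rw [centering_apply_comm j b]
  ring

lemma sum_comm_pair (F : Fin B → Fin B → Fin B → Fin B → ℝ) :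
    ∑ i, ∑ j, ∑ k, ∑ l, F i j k l = ∑ k, ∑ l, ∑ i, ∑ j, F i j k l := by
  have e1 : ∑ i, ∑ j, ∑ k, ∑ l, F i j k l =
      ∑ q : Fin B × Fin B, ∑ p : Fin B × Fin B, F q.1 q.2 p.1 p.2 := by
    simp only [Fintype.sum_prod_type]
  have e2 : ∑ k, ∑ l, ∑ i, ∑ j, F i j k l =
      ∑ p : Fin B × Fin B, ∑ q : Fin B × Fin B, F q.1 q.2 p.1 p.2 := by
    simp only [Fintype.sum_prod_type]
  rw [e1, e2, Finset.sum_comm]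

/-- By the chain rule the Jacobian of batch normalization is that of φ∘𝗇 times G, so the adjoint of
the backward operator for the trace form is 𝓕 preceded by G^{⊗2}. -/
lemma IsPosHomogeneous.trace_backwardOp_mul (h : IsPosHomogeneous α φ) (hα : 1 / 2 < α)
    (hB : 4 ≤ B) (hφ : φ ≠ 0) (P Y : Matrix (Fin B) (Fin B) ℝ) :
    ((backwardOp φ (fixedCov B α φ) P).transpose * Y).trace =
      (P.transpose * backwardF φ (fixedCov B α φ) (centerOp B Y)).trace := by
  rw [trace_transpose_mul_eq, trace_transpose_mul_eq]
  simp_rw [h.backwardOp_apply hα hB hφ, backwardF_apply, centerOp_entry, Finset.mul_sum,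
    Finset.sum_mul]
  rw [sum_comm_pair]
  refine Finset.sum_congr rfl fun k _ => Finset.sum_congr rfl fun l _ => ?_
  rw [sum_comm_pair]
  refine Finset.sum_congr rfl fun a _ => Finset.sum_congr rfl fun b _ =>
    Finset.sum_congr rfl fun i _ => Finset.sum_congr rfl fun j _ => ?_
  ring

/-- The adjoint begins with the idempotent G^{⊗2}, so pairing with any Y cannot distinguish 𝒯P from
G(𝒯P)G. P itself need not be in ℍ^G: a single step suffices to enter it. -/
lemma IsPosHomogeneous.backwardOp_mem_spaceH (h : IsPosHomogeneous α φ) (hα : 1 / 2 < α)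
    (hB : 4 ≤ B) (hφ : φ ≠ 0) {P : Matrix (Fin B) (Fin B) ℝ} (hP : P.IsSymm) :
    backwardOp φ (fixedCov B α φ) P ∈ spaceH B := by
  refine ⟨isSymm_secondMomentOp _ _ hP, sub_eq_zero.1 (eq_zero_of_trace_transpose_mul_self ?_)⟩
  have aux : ∀ Y : Matrix (Fin B) (Fin B) ℝ,
      ((centerOp B (backwardOp φ (fixedCov B α φ) P) - backwardOp φ (fixedCov B α φ) P).transpose *
        Y).trace = 0 := by
    intro Y
    have e : centerOp B (centerOp B Y) = centerOp B Y := by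
      simp only [centerOp_apply, mul_assoc, centering_mul_self (by omega : B ≠ 0)]
      rw [← mul_assoc (centering B) (centering B), centering_mul_self (by omega)]
    rw [Matrix.transpose_sub, sub_mul, Matrix.trace_sub, trace_transpose_centerOp_mul,
      h.trace_backwardOp_mul hα hB hφ, h.trace_backwardOp_mul hα hB hφ, e, sub_self]
  exact aux _

section Eigenvalues

variable {J₁ J D : ℝ}

lemma IsPosHomogeneous.diagMoment_sub_offMoment (hJ₁ : J₁ = homJ α φ 1)
    (hJ : J = homJ α φ (coordCorr B)) :
    diagMoment B α φ - offMoment B α φ = momentScale B α * (J₁ - J) := by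
  rw [diagMoment, offMoment, hJ₁, hJ]
  ring

lemma IsPosHomogeneous.backwardF_eq_sum (h : IsPosHomogeneous α φ) (hα : 1 / 2 < α)
    (hB : 4 ≤ B) (hφ : φ ≠ 0) (hJ₁ : J₁ = homJ α φ 1) (hJ : J = homJ α φ (coordCorr B))
    (Λ : Matrix (Fin B) (Fin B) ℝ) (i j : Fin B) :
    backwardF φ (fixedCov B α φ) Λ i j = (momentScale B α)⁻¹ *
      (∑ k, ∑ l, kernelMoment α φ i j k l * Λ k l) / (((B : ℝ) - 3) * (J₁ - J)) := by
  have hs := (momentScale_pos hα hB).ne'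
  rw [backwardF_apply, Finset.mul_sum, Finset.sum_div]
  refine Finset.sum_congr rfl fun k _ => ?_
  rw [Finset.mul_sum, Finset.sum_div]
  refine Finset.sum_congr rfl fun l _ => ?_
  rw [jacobianMoment, (h.jacobian_mul_fixedCov hα hB hφ i j k l).2,
    IsPosHomogeneous.diagMoment_sub_offMoment hJ₁ hJ]
  simp only [div_eq_mul_inv, mul_inv]
  ring

variable {Λ : Matrix (Fin B) (Fin B) ℝ}

lemma IsPosHomogeneous.backwardF_off (h : IsPosHomogeneous α φ) (hα : 1 / 2 < α)
    (hB : 4 ≤ B) (hφ : φ ≠ 0) (hJ₁ : J₁ = homJ α φ 1) (hJ : J = homJ α φ (coordCorr B))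
    (hD : D = deriv (homJ α φ) (coordCorr B)) (hΛ : Λ ∈ spaceH B) {i j : Fin B} (hij : i ≠ j) :
    backwardF φ (fixedCov B α φ) Λ i j = (coeffOff B α J D * Λ i j +
      coeffOffDiag B α J D * (Λ i i + Λ j j) + coeffOffTrace B α J D * Λ.trace) /
        (((B : ℝ) - 3) * (J₁ - J)) := by
  rw [h.backwardF_eq_sum hα hB hφ hJ₁ hJ, h.sum_kernelMoment_off hα hB hJ hD hij hΛ.1
    (sum_row_of_mem_spaceH (by omega) hΛ), inv_mul_cancel_left₀ (momentScale_pos hα hB).ne']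

lemma IsPosHomogeneous.backwardF_diag (h : IsPosHomogeneous α φ) (hα : 1 / 2 < α)
    (hB : 4 ≤ B) (hφ : φ ≠ 0) (hJ₁ : J₁ = homJ α φ 1) (hJ : J = homJ α φ (coordCorr B))
    (hΛ : Λ ∈ spaceH B) (i : Fin B) :
    backwardF φ (fixedCov B α φ) Λ i i = (coeffDiag B α J₁ * Λ i i +
      coeffDiagTrace B α J₁ * Λ.trace) / (((B : ℝ) - 3) * (J₁ - J)) := by
  rw [h.backwardF_eq_sum hα hB hφ hJ₁ hJ, h.sum_kernelMoment_diag hα hB hJ₁ i hΛ.1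
    (sum_row_of_mem_spaceH (by omega) hΛ), inv_mul_cancel_left₀ (momentScale_pos hα hB).ne']

/-- The matrix is u1ᵀ + 1uᵀ and G1 = 0. It absorbs the non-diagonal part of 𝓕 on 𝕃. -/
lemma centerOp_add_of (hB : B ≠ 0) (u : Fin B → ℝ) :
    centerOp B (Matrix.of fun i j => u i + u j) = 0 := by
  ext a b
  rw [centerOp_entry]
  simp only [Matrix.of_apply, mul_add, Finset.sum_add_distrib]
  have e1 : ∀ i, ∑ j, centering B a i * centering B b j * u i = 0 := fun i => by
    rw [← Finset.sum_mul, ← Finset.mul_sum, sum_centering_row hB, mul_zero, zero_mul]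
  have e2 : ∑ i, ∑ j, centering B a i * centering B b j * u j = 0 := by
    rw [Finset.sum_comm]
    refine Finset.sum_eq_zero fun j _ => ?_
    rw [← Finset.sum_mul, ← Finset.sum_mul, sum_centering_row hB, zero_mul, zero_mul]
  simp [e1, e2]

/-- 𝓕(G) is again of BSB1 form, and G keeps only the difference of its two entries. On 𝕃 the image
is λD plus a matrix u_i + u_j killed by G. On 𝕄 the diagonal and the trace vanish, so 𝓕 is already
scalar before projection. -/
lemma IsPosHomogeneous.hasEigenvaluesGLM_backwardF (h : IsPosHomogeneous α φ) (hα : 1 / 2 < α)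
    (hB : 4 ≤ B) (hφ : φ ≠ 0) (hJ₁ : J₁ = homJ α φ 1) (hJ : J = homJ α φ (coordCorr B))
    (hD : D = deriv (homJ α φ) (coordCorr B)) :
    HasEigenvaluesGLM (centerOp B * backwardF φ (fixedCov B α φ)) (eigenvalueG α B J₁ J D)
      (eigenvalueL α B J₁ J D) (eigenvalueM α B J₁ J D) := by
  have hB' : (4 : ℝ) ≤ B := by exact_mod_cast hB
  have hB0 : B ≠ 0 := by omega
  have hΔ : J₁ - J ≠ 0 := by
    rw [hJ₁, hJ]
    exact (h.homJ_one_sub_pos hα hB hφ).ne'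
  refine hasEigenvaluesGLM_of_le hB ?_ ?_ ?_
  · rw [spaceG, Submodule.span_singleton_le_iff_mem, Module.End.mem_eigenspace_iff,
      Module.End.mul_apply]
    have hG := centering_mem_spaceH hB0
    have e : backwardF φ (fixedCov B α φ) (centering B) = bsb1 B
        ((coeffDiag B α J₁ * (1 - 1 / B) + coeffDiagTrace B α J₁ * (B - 1)) /
          (((B : ℝ) - 3) * (J₁ - J)))
        ((-(coeffOff B α J D / B) + 2 * (coeffOffDiag B α J D * (1 - 1 / B)) +
          coeffOffTrace B α J D * (B - 1)) / (((B : ℝ) - 3) * (J₁ - J))) := by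
      ext i j
      rw [bsb1, Matrix.of_apply]
      split_ifs with hij
      · rw [← hij, h.backwardF_diag hα hB hφ hJ₁ hJ hG, centering_apply, if_pos rfl,
          trace_centering hB0]
      · rw [h.backwardF_off hα hB hφ hJ₁ hJ hD hG hij, centering_apply, centering_apply,
          centering_apply, if_pos rfl, if_pos rfl, if_neg hij, trace_centering hB0]
        congr 1
        ring
    rw [e, centerOp_bsb1 hB0, ← sub_div, eigenvalueG_eq hB' hα hΔ]
  · rintro _ ⟨d, hd, rfl⟩
    rw [Module.End.mem_eigenspace_iff, Module.End.mul_apply]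
    have hL := spaceL_le hB0 ⟨d, hd, rfl⟩
    have e : backwardF φ (fixedCov B α φ) (centerOp B (Matrix.diagonal d)) =
        eigenvalueL α B J₁ J D • Matrix.diagonal d + Matrix.of fun i j =>
          (-(coeffOff B α J D / B) + coeffOffDiag B α J D * (1 - 2 / B)) /
            (((B : ℝ) - 3) * (J₁ - J)) * d i +
          (-(coeffOff B α J D / B) + coeffOffDiag B α J D * (1 - 2 / B)) /
            (((B : ℝ) - 3) * (J₁ - J)) * d j := by
      ext i j
      rw [Matrix.add_apply, Matrix.smul_apply, Matrix.of_apply, smul_eq_mul]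
      rcases eq_or_ne i j with rfl | hij
      · rw [h.backwardF_diag hα hB hφ hJ₁ hJ hL, centerOp_diagonal_diag hd,
          trace_centerOp_diagonal hd, Matrix.diagonal_apply_eq, ← eigenvalueL_eq hB' hα hΔ]
        ring
      · rw [h.backwardF_off hα hB hφ hJ₁ hJ hD hL hij, centerOp_diagonal_diag hd,
          centerOp_diagonal_diag hd, trace_centerOp_diagonal hd, Matrix.diagonal_apply_ne _ hij,
          centerOp_diagonal_apply hd, if_neg hij]
        ring
    rw [e, map_add, map_smul, centerOp_add_of hB0, add_zero]
  · intro X hX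
    rw [Module.End.mem_eigenspace_iff, Module.End.mul_apply]
    have hd : ∀ i, X i i = 0 := fun i => congrFun hX.2 i
    have e : backwardF φ (fixedCov B α φ) X = eigenvalueM α B J₁ J D • X := by
      ext i j
      rw [Matrix.smul_apply, smul_eq_mul]
      rcases eq_or_ne i j with rfl | hij
      · rw [h.backwardF_diag hα hB hφ hJ₁ hJ hX.1, trace_eq_zero_of_mem_spaceM hX, hd]
        ring
      · rw [h.backwardF_off hα hB hφ hJ₁ hJ hD hX.1 hij, trace_eq_zero_of_mem_spaceM hX, hd, hd,
          ← eigenvalueM_eq hB' hα hΔ]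
        ring
    rw [e, map_smul, hX.1.2]

lemma IsPosHomogeneous.hasEigenvaluesGLM_backwardOp (h : IsPosHomogeneous α φ) (hα : 1 / 2 < α)
    (hB : 4 ≤ B) (hφ : φ ≠ 0) (hJ₁ : J₁ = homJ α φ 1) (hJ : J = homJ α φ (coordCorr B))
    (hD : D = deriv (homJ α φ) (coordCorr B)) :
    HasEigenvaluesGLM (backwardOp φ (fixedCov B α φ)) (eigenvalueG α B J₁ J D)
      (eigenvalueL α B J₁ J D) (eigenvalueM α B J₁ J D) := by
  refine (h.hasEigenvaluesGLM_backwardF hα hB hφ hJ₁ hJ hD).adjoint hB (fun X hX Y hY => ?_)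
    fun X hX => h.backwardOp_mem_spaceH hα hB hφ hX.1
  rw [h.trace_backwardOp_mul hα hB hφ, hY.2, Module.End.mul_apply,
    ← trace_transpose_centerOp_mul, hX.2]

end Eigenvalues

end BatchNorm

namespace BatchNorm

/-! ### Growth of the gradients -/

variable {B : ℕ} {α : ℝ} {φ : ℝ → ℝ}

/-- The quadratic form at x is the expectation of (Tᵀx)ᵀP(Tᵀx) ≥ 0; finite second moments justify
moving the sums inside the integral. -/
lemma posSemidef_secondMomentOp {T : EuclideanSpace ℝ (Fin B) → Matrix (Fin B) (Fin B) ℝ}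
    {S : Matrix (Fin B) (Fin B) ℝ} (hT : HasSecondMoments T S) {P : Matrix (Fin B) (Fin B) ℝ}
    (hP : P.PosSemidef) : (secondMomentOp T S P).PosSemidef := by
  have hsymm : P.IsSymm := by
    have := hP.isHermitian
    rwa [Matrix.IsHermitian, Matrix.conjTranspose_eq_transpose_of_trivial] at this
  refine Matrix.PosSemidef.of_dotProduct_mulVec_nonneg ?_ fun x => ?_
  · rw [Matrix.IsHermitian, Matrix.conjTranspose_eq_transpose_of_trivial]
    exact isSymm_secondMomentOp T S hsymm
  · have hi : ∀ i j k l, Integrable (fun h => x i * x j * P k l * (T h i k * T h j l))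
      (gaussianLaw S) := fun i j k l => (hT i j k l).const_mul _
    have e : star x ⬝ᵥ (secondMomentOp T S P).mulVec x =
        ∫ h, ∑ k, ∑ l, ∑ i, ∑ j, x i * x j * P k l * (T h i k * T h j l) ∂(gaussianLaw S) := by
      have i1 := fun k l i => integrable_finsetSum Finset.univ fun j _ => hi i j k l
      have i2 := fun k l => integrable_finsetSum Finset.univ fun i _ => i1 k l i
      have i3 := fun k => integrable_finsetSum Finset.univ fun l _ => i2 k l
      rw [integral_finsetSum _ fun k _ => i3 k]
      simp_rw [integral_finsetSum _ fun l _ => i2 _ l, integral_finsetSum _ fun i _ => i1 _ _ i,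
        integral_finsetSum _ fun j _ => hi _ j _ _, integral_const_mul]
      rw [sum_comm_pair]
      simp only [dotProduct, Matrix.mulVec, star_trivial, secondMomentOp_apply, Finset.sum_mul,
        Finset.mul_sum]
      refine Finset.sum_congr rfl fun i _ => Finset.sum_congr rfl fun j _ =>
        Finset.sum_congr rfl fun k _ => Finset.sum_congr rfl fun l _ => ?_
      ring
    rw [e]
    refine integral_nonneg fun h => ?_
    have := hP.dotProduct_mulVec_nonneg (fun k => ∑ i, T h i k * x i)
    refine this.trans_eq ?_
    simp only [dotProduct, Matrix.mulVec, star_trivial, Finset.sum_mul, Finset.mul_sum]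
    refine Finset.sum_congr rfl fun k _ => Finset.sum_congr rfl fun l _ => ?_
    rw [Finset.sum_comm]
    refine Finset.sum_congr rfl fun i _ => Finset.sum_congr rfl fun j _ => ?_
    ring

lemma trace_pos_of_posSemidef {P : Matrix (Fin B) (Fin B) ℝ} (hP : P.PosSemidef) (h0 : P ≠ 0) :
    0 < P.trace :=
  lt_of_le_of_ne hP.trace_nonneg fun h => h0 (hP.trace_eq_zero_iff.1 h.symm)

/-- The trace sees only the ℝG component, since 𝕃 and 𝕄 are traceless. Hence λ_G alone governs the
gradient norm, whatever the sizes of the other eigenvalues. -/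
lemma HasEigenvaluesGLM.trace_apply (hB : 4 ≤ B)
    {T : Module.End ℝ (Matrix (Fin B) (Fin B) ℝ)} {lG lL lM : ℝ}
    (hT : HasEigenvaluesGLM T lG lL lM) {Y : Matrix (Fin B) (Fin B) ℝ} (hY : Y ∈ spaceH B) :
    (T Y).trace = lG * Y.trace := by
  obtain ⟨g, hg, l, hl, m, hm, rfl⟩ := exists_add_of_mem_spaceH hB hY
  rw [map_add, map_add, Module.End.mem_eigenspace_iff.1 (hT.2.1 hg),
    Module.End.mem_eigenspace_iff.1 (hT.2.2.1 hl), Module.End.mem_eigenspace_iff.1 (hT.2.2.2 hm)]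
  simp [trace_eq_zero_of_mem_spaceL hl, trace_eq_zero_of_mem_spaceM hm]

lemma HasEigenvaluesGLM.trace_pow_apply (hB : 4 ≤ B)
    {T : Module.End ℝ (Matrix (Fin B) (Fin B) ℝ)} {lG lL lM : ℝ}
    (hT : HasEigenvaluesGLM T lG lL lM) {Y : Matrix (Fin B) (Fin B) ℝ} (hY : Y ∈ spaceH B)
    (L : ℕ) : (T ^ L) Y ∈ spaceH B ∧ ((T ^ L) Y).trace = lG ^ L * Y.trace := by
  induction L with
  | zero => simpa using hY
  | succ L ih =>
    rw [pow_succ', Module.End.mul_apply]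
    refine ⟨hT.1 _ ih.1, ?_⟩
    rw [hT.trace_apply hB ih.1, ih.2, pow_succ]
    ring

/-- The correction exponent is constant for L ≥ 1, hence o(L). L = 0 is separate because u 0 is the
trace of the initial matrix, unrelated to c; β > 1 makes log β nonzero. -/
lemma exists_rate_of_eq {β c : ℝ} (hβ : 1 < β) (hc : 0 < c) {u : ℕ → ℝ} (h0 : 0 < u 0)
    (hu : ∀ L, u (L + 1) = β ^ L * c) :
    ∃ e : ℕ → ℝ, e =o[atTop] (fun L : ℕ => (L : ℝ)) ∧ ∀ L : ℕ, u L = β ^ ((L : ℝ) + e L) := by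
  have hβ0 : 0 < β := by linarith
  have hl : Real.log β ≠ 0 := (Real.log_pos hβ).ne'
  have hexp : ∀ x, 0 < x → β ^ (Real.log x / Real.log β) = x := fun x hx => by
    rw [Real.rpow_def_of_pos hβ0, mul_div_cancel₀ _ hl, Real.exp_log hx]
  refine ⟨fun L => if L = 0 then Real.log (u 0) / Real.log β else
    Real.log c / Real.log β - 1, ?_, fun L => ?_⟩
  · have h1 : (fun L : ℕ => if L = 0 then Real.log (u 0) / Real.log β else
        Real.log c / Real.log β - 1) =ᶠ[atTop] fun _ => Real.log c / Real.log β - 1 := by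
      filter_upwards [eventually_ne_atTop 0] with L hL
      rw [if_neg hL]
    refine h1.trans_isLittleO (isLittleO_const_left.2 (Or.inr ?_))
    exact tendsto_norm_atTop_atTop.comp tendsto_natCast_atTop_atTop
  · cases L with
    | zero => simp [hexp _ h0]
    | succ L =>
      simp only [Nat.add_eq_zero_iff, one_ne_zero, and_false, if_false]
      rw [hu]
      push_cast
      rw [show (L : ℝ) + 1 + (Real.log c / Real.log β - 1) = L + Real.log c / Real.log β by ring,
        Real.rpow_add hβ0, hexp _ hc, Real.rpow_natCast]

/-- After one step the matrix is in ℍ^G, nonzero and positive semidefinite, so its trace is positive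
and is multiplied by λ_G from then on. -/
lemma IsPosHomogeneous.gradientExplodesAtRate (h : IsPosHomogeneous α φ) (hα : 1 / 2 < α)
    (hB : 4 ≤ B) (hφ : φ ≠ 0) {S : Matrix (Fin B) (Fin B) ℝ} (hS : IsBSB1FixedPoint φ S) {β : ℝ}
    (hβ : β = eigenvalueG α B (homJ α φ 1) (homJ α φ (coordCorr B))
      (deriv (homJ α φ) (coordCorr B))) (h1 : 1 < β) : GradientExplodesAtRate φ S β := by
  rw [h.isBSB1FixedPoint_iff hα hB hφ] at hS
  subst hS
  intro P hP hne
  have hT := h.hasEigenvaluesGLM_backwardOp hα hB hφ rfl rfl rfl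
  rw [← hβ] at hT
  have hsymm : P.IsSymm := by
    have := hP.isHermitian
    rwa [Matrix.IsHermitian, Matrix.conjTranspose_eq_transpose_of_trivial] at this
  have hTP := h.backwardOp_mem_spaceH hα hB hφ hsymm
  refine exists_rate_of_eq h1 (trace_pos_of_posSemidef (posSemidef_secondMomentOp
    (h.hasSecondMoments_jacobian_batchNorm hα hB hφ) hP) hne)
    (u := fun L => ((backwardOp φ (fixedCov B α φ) ^ L) P).trace) ?_ fun L => ?_
  · simp only [pow_zero, Module.End.one_apply]
    exact trace_pos_of_posSemidef hP fun h0 => hne (by rw [h0]; exact LinearMap.map_zero _)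
  · simp only [pow_succ, Module.End.mul_apply]
    exact (hT.trace_pow_apply hB hTP L).2

/-! ### The arc-cosine kernel -/

lemma isPosHomogeneous_relu : IsPosHomogeneous 1 relu := by
  intro r hr x
  rw [relu, relu, Real.rpow_one, mul_max_of_nonneg _ _ hr.le, mul_zero]

lemma relu_ne_zero : relu ≠ 0 := by
  intro h
  have := congrFun h 1
  simp [relu] at this

lemma isPosHomogeneous_linear (m : ℝ) : IsPosHomogeneous 1 (fun x => m * x) := by
  intro r hr x
  simp only
  rw [Real.rpow_one]
  ring

lemma cConst_one : cConst 1 = 1 / 2 := by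
  have : √Real.pi ≠ 0 := (Real.sqrt_pos.2 Real.pi_pos).ne'
  rw [cConst, add_comm (1 : ℝ) (1 / 2), Real.Gamma_add_one (by norm_num), Real.Gamma_one_half_eq, sub_self, Real.rpow_zero]
  field_simp

/-- For α = 1 the integral of cos θ + cos t over [0, π-θ] in `integral_cos_add_cos_rpow` is
elementary. -/
lemma kernelJ_one_eq_arcCosKernel {c : ℝ} (h1 : -1 < c) (h2 : c < 1) :
    kernelJ 1 c = arcCosKernel c := by
  have hθ0 : 0 < Real.arccos c := Real.arccos_pos.2 h2
  have hθ1 : Real.arccos c < Real.pi := by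
    have := Real.arccos_lt_pi.2 h1
    exact this
  have h := integral_cos_add_cos_rpow 1 hθ0 hθ1
  have hk := cConst_mul_kernelJ (α := 1) (by norm_num) h1.le h2
  have hpi := Real.pi_pos.ne'
  simp only [Real.rpow_one] at h
  rw [intervalIntegral.integral_add (by simp) (Real.continuous_cos.intervalIntegrable _ _),
    intervalIntegral.integral_const, integral_cos, Real.sin_pi_sub, Real.sin_zero, sub_zero,
    sub_zero, smul_eq_mul, Real.cos_arccos h1.le h2.le, Real.sin_arccos] at h
  have e : √(1 - c ^ 2) ^ (2 * 1 + 1 : ℝ) = (1 - c ^ 2) ^ (1 + 1 / 2 : ℝ) := by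
    rw [Real.sqrt_eq_rpow, ← Real.rpow_mul (by nlinarith)]
    norm_num
  rw [e] at h
  rw [← h, cConst_one, one_add_one_eq_two, Real.Gamma_two] at hk
  rw [arcCosKernel]
  linear_combination 2 * hk

lemma hasDerivAt_arcCosKernel {c : ℝ} (h1 : -1 < c) (h2 : c < 1) :
    HasDerivAt arcCosKernel ((Real.pi - Real.arccos c) / Real.pi) c := by
  have hpos : 0 < 1 - c ^ 2 := by nlinarith
  have hs := (Real.sqrt_pos.2 hpos).ne'
  have hpi := Real.pi_pos.ne'
  have d1 : HasDerivAt (fun x : ℝ => √(1 - x ^ 2)) (-(2 * c) / (2 * √(1 - c ^ 2))) c := by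
    have : HasDerivAt (fun x : ℝ => 1 - x ^ 2) (-(2 * c)) c := by
      simpa using (hasDerivAt_pow 2 c).const_sub 1
    exact this.sqrt hpos.ne'
  have d2 := ((Real.hasDerivAt_arccos h1.ne' h2.ne).const_sub Real.pi).mul (hasDerivAt_id c)
  refine ((d1.add d2).const_mul (1 / Real.pi)).congr_deriv ?_
  simp only [id]
  field_simp
  ring

/-- The kernel counterpart of x = relu(x) - relu(-x); it makes 𝕁_φ linear in c for linear φ. -/
lemma arcCosKernel_sub_neg (c : ℝ) : arcCosKernel c - arcCosKernel (-c) = c := by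
  have hpi := Real.pi_pos.ne'
  rw [arcCosKernel, arcCosKernel, Real.arccos_neg, neg_sq]
  field_simp
  ring

/-! ### Rates -/

lemma homJ_relu {c : ℝ} (h1 : -1 < c) (h2 : c < 1) : homJ 1 relu c = arcCosKernel c := by
  rw [homJ, kernelJ_one_eq_arcCosKernel h1 h2]
  norm_num [relu]

lemma deriv_homJ_relu {c : ℝ} (h1 : -1 < c) (h2 : c < 1) :
    deriv (homJ 1 relu) c = deriv arcCosKernel c := by
  refine Filter.EventuallyEq.deriv_eq ?_
  filter_upwards [Ioo_mem_nhds h1 h2] with x hx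
  exact homJ_relu hx.1 hx.2

lemma homJ_linear (m : ℝ) {c : ℝ} (h1 : -1 < c) (h2 : c < 1) :
    homJ 1 (fun x => m * x) c = 2 * m ^ 2 * c := by
  rw [homJ, kernelJ_one_eq_arcCosKernel h1 h2,
    kernelJ_one_eq_arcCosKernel (by linarith) (by linarith)]
  linear_combination 2 * m ^ 2 * arcCosKernel_sub_neg c

lemma deriv_homJ_linear (m : ℝ) {c : ℝ} (h1 : -1 < c) (h2 : c < 1) :
    deriv (homJ 1 (fun x => m * x)) c = 2 * m ^ 2 := by
  have : homJ 1 (fun x => m * x) =ᶠ[𝓝 c] fun x => 2 * m ^ 2 * x := by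
    filter_upwards [Ioo_mem_nhds h1 h2] with x hx
    exact homJ_linear m hx.1 hx.2
  rw [this.deriv_eq, deriv_const_mul_field, deriv_id'', mul_one]

lemma linearRate_eq {b m : ℝ} (hb : 4 ≤ b) (hm : m ≠ 0) :
    linearRate b = eigenvalueG 1 b (2 * m ^ 2) (2 * m ^ 2 * (-1 / (b - 1))) (2 * m ^ 2) := by
  have h0 : b ≠ 0 := by linarith
  have h1 : b - 1 ≠ 0 := by linarith
  have h3 : b - 3 ≠ 0 := by linarith
  have e : 2 * m ^ 2 - 2 * m ^ 2 * (-1 / (b - 1)) = 2 * m ^ 2 * b / (b - 1) := by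
    field_simp
    ring
  rw [linearRate, eigenvalueG, e]
  field_simp
  ring

lemma one_lt_linearRate {b : ℝ} (hb : 4 ≤ b) : 1 < linearRate b := by
  rw [linearRate, one_lt_div (by linarith)]
  linarith

lemma gradientExplodesAtRate_linear (hB : 4 ≤ B) {m : ℝ} (hm : m ≠ 0)
    {S : Matrix (Fin B) (Fin B) ℝ} (hS : IsBSB1FixedPoint (fun x => m * x) S) :
    GradientExplodesAtRate (fun x => m * x) S (linearRate B) := by
  have hB' : (4 : ℝ) ≤ B := by exact_mod_cast hB
  have h1 := neg_one_lt_coordCorr (by omega : 3 ≤ B)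
  have h2 := (coordCorr_neg (by omega : 2 ≤ B)).trans one_pos
  refine (isPosHomogeneous_linear m).gradientExplodesAtRate (by norm_num) hB (fun h => hm ?_) hS ?_
    (one_lt_linearRate hB')
  · simpa using congrFun h 1
  · rw [homJ_linear m h1 h2, deriv_homJ_linear m h1 h2, homJ_one (by norm_num), linearRate_eq hB' hm,
      coordCorr]
    congr 1
    ring

lemma tendsto_linearRate : Tendsto (fun B : ℕ => linearRate B) atTop (𝓝 1) := by
  have h1 : Tendsto (fun B : ℕ => (B : ℝ) - 3) atTop atTop :=
    tendsto_atTop_add_const_right _ (-3) tendsto_natCast_atTop_atTop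
  have h2 : Tendsto (fun B : ℕ => 1 + ((B : ℝ) - 3)⁻¹) atTop (𝓝 (1 + 0)) :=
    h1.inv_tendsto_atTop.const_add 1
  rw [add_zero] at h2
  refine h2.congr' ?_
  filter_upwards [eventually_ge_atTop 4] with B hB
  have hB' : (4 : ℝ) ≤ B := by exact_mod_cast hB
  have h3 : (B : ℝ) - 3 ≠ 0 := by linarith
  rw [linearRate]
  field_simp
  ring

/-! ### Monotonicity and limit of the ReLU rate -/

/-- `1 - 𝕁_1(-t)`. -/
noncomputable def reluGap (t : ℝ) : ℝ := 1 - arcCosKernel (-t)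

lemma hasDerivAt_reluGap {t : ℝ} (h1 : -1 < t) (h2 : t < 1) :
    HasDerivAt reluGap (Real.arccos t / Real.pi) t := by
  have d := ((hasDerivAt_arcCosKernel (c := -t) (by linarith) (by linarith)).comp t
    (hasDerivAt_neg t)).const_sub 1
  refine d.congr_deriv ?_
  rw [Real.arccos_neg]
  ring

lemma reluGap_zero : reluGap 0 = 1 - 1 / Real.pi := by
  simp [reluGap, arcCosKernel]

lemma reluGap_eq (t : ℝ) :
    reluGap t = 1 - 1 / Real.pi * (√(1 - t ^ 2) - t * Real.arccos t) := by
  rw [reluGap, arcCosKernel, Real.arccos_neg, neg_sq]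
  ring

/-- Mean value inequality: the derivative arccos(x)/π is at most 1/2 for x ≥ 0. -/
lemma reluGap_sub_le {s t : ℝ} (h0 : 0 ≤ s) (hst : s ≤ t) (h1 : t < 1) :
    reluGap t - reluGap s ≤ 1 / 2 * (t - s) := by
  have hd : ∀ x ∈ Set.Ioo (-1 : ℝ) 1, HasDerivAt reluGap (Real.arccos x / Real.pi) x :=
    fun x hx => hasDerivAt_reluGap hx.1 hx.2
  refine (convex_Icc s t).image_sub_le_mul_sub_of_deriv_le (f := reluGap) (C := 1 / 2)
    (fun x hx => (hd x ⟨by linarith [hx.1], by linarith [hx.2]⟩).continuousAt.continuousWithinAt)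
    (fun x hx => ?_) (fun x hx => ?_) s (Set.left_mem_Icc.2 hst) t (Set.right_mem_Icc.2 hst) hst
  · rw [interior_Icc] at hx
    exact (hd x ⟨by linarith [hx.1], by linarith [hx.2]⟩).differentiableAt.differentiableWithinAt
  · rw [interior_Icc] at hx
    rw [(hd x ⟨by linarith [hx.1], by linarith [hx.2]⟩).deriv, div_le_iff₀ Real.pi_pos]
    have := Real.arccos_le_pi_div_two.2 (by linarith [hx.1] : 0 ≤ x)
    linarith

lemma le_reluGap {t : ℝ} (h0 : 0 ≤ t) : 1 / 2 ≤ reluGap t := by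
  have hpi := Real.pi_gt_three
  rw [reluGap_eq]
  have e1 : √(1 - t ^ 2) ≤ 1 := Real.sqrt_le_one.2 (by nlinarith)
  have e2 := mul_nonneg h0 (Real.arccos_nonneg t)
  have e3 : 1 / Real.pi * (√(1 - t ^ 2) - t * Real.arccos t) ≤ 1 / Real.pi * 1 := by
    gcongr
    linarith
  have e4 : 1 / Real.pi ≤ 1 / 2 := by
    gcongr
    linarith
  linarith

/-- The ReLU rate as a function of `t = 1 / (B - 1)`. -/
noncomputable def reluProfile (t : ℝ) : ℝ :=
  (1 - t) / (1 - 2 * t) * (1 + √((1 + t) / (1 - t)) / (Real.pi * reluGap t))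

/-- The relation √(1-t²) = π(1-K) + t arccos t, with K the gap, removes the arccos coming from the
derivative of the kernel. Only factors whose monotonicity can be checked separately remain. -/
lemma reluRate_eq {b : ℝ} (hb : 4 ≤ b) : reluRate b = reluProfile (1 / (b - 1)) := by
  set t := 1 / (b - 1) with ht
  have hb1 : 0 < b - 1 := by linarith
  have h0 : 0 < t := by positivity
  have h1 : t ≤ 1 / 3 := by
    rw [ht]
    gcongr
    linarith
  have hb' : b - 1 = 1 / t := by rw [ht, one_div_one_div]
  have hb3 : b - 3 = (1 - 2 * t) / t := by
    have : b - 3 = 1 / t - 2 := by linarith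
    rw [this]
    field_simp
  have hc : -1 / (b - 1) = -t := by rw [ht]; ring
  have hK : 0 < reluGap t := by linarith [le_reluGap h0.le]
  have e1 : (1 : ℝ) - 2 * t ≠ 0 := by linarith
  have e2 : (0 : ℝ) < 1 - t := by linarith
  have hpi := Real.pi_pos
  have hw : √((1 + t) / (1 - t)) = √(1 - t ^ 2) / (1 - t) := by
    rw [show (1 + t) / (1 - t) = (1 - t ^ 2) / (1 - t) ^ 2 by field_simp; ring,
      Real.sqrt_div' _ (by positivity), Real.sqrt_sq e2.le]
  have hg : √(1 - t ^ 2) = Real.pi * (1 - reluGap t) + t * Real.arccos t := by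
    rw [reluGap_eq]
    field_simp
    ring
  rw [reluRate, hc, (hasDerivAt_arcCosKernel (by linarith) (by linarith)).deriv, Real.arccos_neg]
  change 1 / (b - 3) * ((b - 1 + _) / reluGap t - 1) = _
  rw [hb', hb3, reluProfile, hw, hg]
  field_simp
  ring

lemma reluRate_eq_eigenvalueG {b : ℝ} (hb : 4 ≤ b) :
    reluRate b = eigenvalueG 1 b 1 (arcCosKernel (-1 / (b - 1)))
      (deriv arcCosKernel (-1 / (b - 1))) := by
  have h1 : b - 1 ≠ 0 := by linarith
  have h3 : b - 3 ≠ 0 := by linarith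
  rw [reluRate, eigenvalueG]
  field_simp
  ring

/-- The only decreasing factor is 1/K. The factor (1-t)/(1-2t) outweighs it because K ≥ 1/2 while K
grows with slope at most 1/2. -/
lemma reluProfile_strictMonoOn : StrictMonoOn reluProfile (Set.Icc 0 (1 / 3)) := by
  rintro s ⟨hs0, hs1⟩ t ⟨ht0, ht1⟩ hst
  have hpi := Real.pi_pos
  have ks := le_reluGap hs0
  have kt := le_reluGap ht0
  have hk := reluGap_sub_le hs0 hst.le (by linarith)
  have e1 : (1 - s) / (1 - 2 * s) < (1 - t) / (1 - 2 * t) := by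
    rw [div_lt_div_iff₀ (by linarith) (by linarith)]
    nlinarith
  have e2 : √((1 + s) / (1 - s)) ≤ √((1 + t) / (1 - t)) := by
    refine Real.sqrt_le_sqrt ?_
    rw [div_le_div_iff₀ (by linarith) (by linarith)]
    nlinarith
  have e3 : (1 - s) / (1 - 2 * s) / reluGap s ≤ (1 - t) / (1 - 2 * t) / reluGap t := by
    have : 0 < 1 - 2 * s := by linarith
    have : 0 < 1 - 2 * t := by linarith
    rw [div_div, div_div, div_le_div_iff₀ (by positivity) (by positivity)]
    have h1 : (1 - s) * (1 - 2 * t) * reluGap t ≤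
        (1 - s) * (1 - 2 * t) * (reluGap s + 1 / 2 * (t - s)) := by
      refine mul_le_mul_of_nonneg_left (by linarith) (mul_nonneg (by linarith) (by linarith))
    -- Since (1-s)(1-2t) = (1-t)(1-2s) - (t-s), the claim reduces to (1-s)(1-2t)/2 ≤ K(s), which
    -- follows from K(s) ≥ 1/2.
    nlinarith [mul_nonneg (by linarith : 0 ≤ t - s) (by linarith : 0 ≤ reluGap s - 1 / 2),
      mul_nonneg (by linarith : 0 ≤ t - s) (mul_nonneg hs0 (by linarith : 0 ≤ 1 - 2 * t))]
  have a1 : ∀ x, reluProfile x = (1 - x) / (1 - 2 * x) +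
      (1 - x) / (1 - 2 * x) / reluGap x * (√((1 + x) / (1 - x)) / Real.pi) := fun x => by
    rw [reluProfile]
    ring
  rw [a1, a1]
  refine add_lt_add_of_lt_of_le e1 (mul_le_mul e3 (by gcongr) (by positivity) ?_)
  refine div_nonneg (div_nonneg ?_ ?_) ?_ <;> linarith

lemma inv_mem_Icc {b : ℝ} (hb : 4 ≤ b) : 1 / (b - 1) ∈ Set.Icc (0 : ℝ) (1 / 3) := by
  have hb1 : 0 < b - 1 := by linarith
  refine ⟨by positivity, ?_⟩
  gcongr
  linarith

lemma strictAntiOn_reluRate : StrictAntiOn (fun B : ℕ => reluRate B) (Set.Ici 4) := by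
  intro a ha b hb hab
  have ha' : (4 : ℝ) ≤ a := by exact_mod_cast ha
  have hb' : (4 : ℝ) ≤ b := by exact_mod_cast hb
  have hab' : (a : ℝ) < b := by exact_mod_cast hab
  simp only
  rw [reluRate_eq ha', reluRate_eq hb']
  refine reluProfile_strictMonoOn (inv_mem_Icc hb') (inv_mem_Icc ha') ?_
  exact one_div_lt_one_div_of_lt (by linarith) (by linarith)

lemma reluProfile_zero : reluProfile 0 = Real.pi / (Real.pi - 1) := by
  have hpi := Real.pi_gt_three
  have h1 : Real.pi - 1 ≠ 0 := by linarith
  have h0 : Real.pi ≠ 0 := by linarith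
  have e : Real.pi * (1 - 1 / Real.pi) = Real.pi - 1 := by
    field_simp
  rw [reluProfile, reluGap_zero, e]
  simp
  field_simp
  ring

lemma one_lt_reluRate {b : ℝ} (hb : 4 ≤ b) : 1 < reluRate b := by
  have hpi := Real.pi_gt_three
  rw [reluRate_eq hb]
  refine lt_of_lt_of_le ?_ (reluProfile_strictMonoOn.monotoneOn (Set.left_mem_Icc.2 (by norm_num))
    (inv_mem_Icc hb) (inv_mem_Icc hb).1)
  rw [reluProfile_zero, one_lt_div (by linarith)]
  linarith

lemma tendsto_reluRate :
    Tendsto (fun B : ℕ => reluRate B) atTop (𝓝 (Real.pi / (Real.pi - 1))) := by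
  have h1 : Tendsto (fun B : ℕ => (B : ℝ) - 1) atTop atTop :=
    tendsto_atTop_add_const_right _ (-1) tendsto_natCast_atTop_atTop
  have h2 : Tendsto (fun B : ℕ => 1 / ((B : ℝ) - 1)) atTop (𝓝 0) := by
    simp only [one_div]
    exact h1.inv_tendsto_atTop
  have hK : ContinuousAt reluGap 0 :=
    (hasDerivAt_reluGap (by norm_num) (by norm_num)).continuousAt
  have hK0 : Real.pi * reluGap 0 ≠ 0 :=
    mul_ne_zero Real.pi_pos.ne' (by linarith [le_reluGap le_rfl])
  have hc : ContinuousAt reluProfile 0 := by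
    have c1 : ContinuousAt (fun t : ℝ => (1 - t) / (1 - 2 * t)) 0 :=
      ContinuousAt.div (by fun_prop) (by fun_prop) (by norm_num)
    have c2 : ContinuousAt (fun t : ℝ => √((1 + t) / (1 - t))) 0 :=
      (ContinuousAt.div (by fun_prop) (by fun_prop) (by norm_num)).sqrt
    exact c1.mul ((c2.div (hK.const_mul _) hK0).const_add _)
  have h3 := hc.tendsto.comp h2
  rw [reluProfile_zero] at h3
  refine h3.congr' ?_
  filter_upwards [eventually_ge_atTop 4] with B hB
  exact (reluRate_eq (by exact_mod_cast hB)).symm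

lemma gradientExplodesAtRate_relu (hB : 4 ≤ B) {S : Matrix (Fin B) (Fin B) ℝ}
    (hS : IsBSB1FixedPoint relu S) : GradientExplodesAtRate relu S (reluRate B) := by
  have hB' : (4 : ℝ) ≤ B := by exact_mod_cast hB
  have h1 := neg_one_lt_coordCorr (by omega : 3 ≤ B)
  have h2 := (coordCorr_neg (by omega : 2 ≤ B)).trans one_pos
  have hone : homJ 1 relu 1 = 1 := by
    rw [homJ_one (by norm_num)]
    norm_num [relu]
  refine isPosHomogeneous_relu.gradientExplodesAtRate (by norm_num) hB relu_ne_zero hS ?_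
    (one_lt_reluRate hB')
  rw [hone, homJ_relu h1 h2, deriv_homJ_relu h1 h2]
  exact reluRate_eq_eigenvalueG hB'

end BatchNorm

theorem mainTheorem5 :
    -- positive-homogeneous nonlinearities
    (∀ (B : ℕ), 4 ≤ B → ∀ (α : ℝ), 1 / 2 < α → ∀ φ : ℝ → ℝ, IsPosHomogeneous α φ → φ ≠ 0 →
      (∃! S : Matrix (Fin B) (Fin B) ℝ, IsBSB1FixedPoint φ S) ∧
      -- the orthogonal decomposition of the space on which the operators act
      (spaceG B ⊔ spaceL B ⊔ spaceM B = spaceH B ∧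
        spaceG B ≠ ⊥ ∧ spaceL B ≠ ⊥ ∧ spaceM B ≠ ⊥ ∧
        TraceOrthogonal (spaceG B) (spaceL B) ∧ TraceOrthogonal (spaceG B) (spaceM B) ∧
        TraceOrthogonal (spaceL B) (spaceM B)) ∧
      ∀ (c j₁ jc dj jd : ℝ), c = -1 / ((B : ℝ) - 1) → j₁ = homJ α φ 1 → jc = homJ α φ c →
        dj = deriv (homJ α φ) c → jd = homJ (α - 1) (fun x => α⁻¹ * deriv φ x) c →
        DifferentiableAt ℝ (homJ α φ) c ∧ j₁ - jc ≠ 0 ∧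
        eigenvalueG α B j₁ jc dj = eigenvalueG' α B j₁ jc jd ∧
        eigenvalueG α B j₁ jc dj = eigenvalueG'' α B j₁ jc jd ∧
        ∀ S : Matrix (Fin B) (Fin B) ℝ, IsBSB1FixedPoint φ S →
          HasSecondMoments (fun h => jacobian (phiNormalize φ) (center h)) S ∧
          HasSecondMoments (fun h => (jacobian (batchNorm φ) h).transpose) S ∧
          HasEigenvaluesGLM (centerOp B * backwardF φ S) (eigenvalueG α B j₁ jc dj)
            (eigenvalueL α B j₁ jc dj) (eigenvalueM α B j₁ jc dj) ∧
          HasEigenvaluesGLM (backwardOp φ S) (eigenvalueG α B j₁ jc dj)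
            (eigenvalueL α B j₁ jc dj) (eigenvalueM α B j₁ jc dj)) ∧
    -- ReLU
    ((∀ B : ℕ, 4 ≤ B → ∀ S : Matrix (Fin B) (Fin B) ℝ, IsBSB1FixedPoint relu S →
        GradientExplodesAtRate relu S (reluRate B)) ∧
      StrictAntiOn (fun B : ℕ => reluRate B) (Set.Ici 4) ∧
      Tendsto (fun B : ℕ => reluRate B) atTop (𝓝 (Real.pi / (Real.pi - 1)))) ∧
    -- linear nonlinearities
    ((∀ B : ℕ, 4 ≤ B → ∀ m : ℝ, m ≠ 0 → ∀ S : Matrix (Fin B) (Fin B) ℝ,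
        IsBSB1FixedPoint (fun x => m * x) S →
        GradientExplodesAtRate (fun x => m * x) S (linearRate B)) ∧
      Tendsto (fun B : ℕ => linearRate B) atTop (𝓝 1)) := by
  refine ⟨fun B hB α hα φ h hφ => ⟨?_, ?_, ?_⟩, ⟨fun B hB S hS => gradientExplodesAtRate_relu hB hS,
    strictAntiOn_reluRate, tendsto_reluRate⟩,
    fun B hB m hm S hS => gradientExplodesAtRate_linear hB hm hS, tendsto_linearRate⟩
  · exact ⟨fixedCov B α φ, (h.isBSB1FixedPoint_iff hα hB hφ _).2 rfl,
      fun S hS => (h.isBSB1FixedPoint_iff hα hB hφ S).1 hS⟩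
  · exact ⟨sup_eq_spaceH hB, spaceG_ne_bot hB, spaceL_ne_bot hB, spaceM_ne_bot hB,
      traceOrthogonal_spaceG (by omega) (spaceL_le (by omega))
        fun _ => trace_eq_zero_of_mem_spaceL,
      traceOrthogonal_spaceG (by omega) spaceM_le fun _ => trace_eq_zero_of_mem_spaceM,
      traceOrthogonal_spaceL_spaceM⟩
  · rintro c j₁ jc dj jd rfl hj₁ hjc hdj hjd
    have hB' : (4 : ℝ) ≤ B := by exact_mod_cast hB
    have h1 := neg_one_lt_coordCorr (by omega : 3 ≤ B)
    have h2 := (coordCorr_neg (by omega : 2 ≤ B)).trans one_pos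
    have hd := h.hasDerivAt_homJ hα h1 h2
    have hΔ : j₁ - jc ≠ 0 := by
      rw [hj₁, hjc]
      exact (h.homJ_one_sub_pos hα hB hφ).ne'
    have hD : dj = α ^ 2 / (2 * α - 1) * jd := by
      refine (hdj.trans hd.deriv).trans ?_
      rw [homJ_deriv (by linarith), hjd, coordCorr]
      ring
    refine ⟨hd.differentiableAt, hΔ, eigenvalueG_eq_eigenvalueG' hB' hα hΔ hD,
      eigenvalueG_eq_eigenvalueG'' hB' hα hΔ hD, fun S hS => ?_⟩
    rw [h.isBSB1FixedPoint_iff hα hB hφ] at hS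
    subst hS
    exact ⟨h.hasSecondMoments_jacobian hα hB hφ, h.hasSecondMoments_jacobian_batchNorm hα hB hφ,
      h.hasEigenvaluesGLM_backwardF hα hB hφ hj₁ hjc hdj,
      h.hasEigenvaluesGLM_backwardOp hα hB hφ hj₁ hjc hdj⟩
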